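/- **Setting.** Graphs are finite; undirected graphs are simple, and directed graphs have no loops (antiparallel edges are allowed and are different edges). A directed graph is $d$-regular if all in- and out-degrees equal $d$. For a set $S$ of vertices, $e_G(S)$ is the number of edges with both endpoints in $S$. For $\beta,\gamma>0$, a $d$-regular undirected graph $G$ on $n$ vertices is a $(\beta,\gamma)$-expander if for every $S\subseteq V(G)$ with $|S|\le n/2$ we have $e_G(S)\le \gamma d|S|$ if $|S|\le\beta n$, and $e_G(S)\le d|S|/3$ if $|S|>\beta n$; a $d$-regular directed graph is a $(\beta,\gamma)$-expander if the $2d$-regular multigraph obtained by ignoring the directions of its edges satisfies these inequalities with $2d$ in place of $d$. In the *$r$-Routing game (with removals)* on a $d$-regular graph $G$, Router maintains a family $\mathcal P$ of pairwise edge-disjoint paths in $G$, initially empty. In each turn Adversary makes one request, which Router has to fulfil before seeing the next one: either *Find-Path $a$ $b$*, for vertices $a,b$ each of which is an endpoint of fewer than $d/200$ paths of $\mathcal P$, and allowed only if $|\mathcal P|<r$; Router then has to find a path from $a$ to $b$ (directed from $a$ to $b$ if $G$ is directed) that is edge-disjoint from all paths in $\mathcal P$, and it is added to $\mathcal P$;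 or *Remove-Path $P$*, for some $P\in\mathcal P$, which is then removed from $\mathcal P$. Router wins if she can fulfil every (infinite) series of requests. **Theorem.** There are absolute constants $C,K$ such that for all $\beta>0$ and $0<\gamma<1/1000$ there are $\varepsilon=\varepsilon(\beta,\gamma)>0$, $n_0=n_0(\beta,\gamma)$ and a deterministic program $p$ (depending only on $\beta,\gamma$) for a random access machine with words of $K\log_2 n$ bits and unit-cost arithmetic, such that the following holds. Let $G$ be a $d$-regular $(\beta,\gamma)$-expander, directed or undirected, on $n\ge n_0$ vertices, with $200<d<n$. Started on $G$, given by its adjacency lists in any order, and keeping its memory between requests, $p$ wins the $r$-Routing game on $G$ for Router with $r=\varepsilon nd/\log n$. Moreover, $p$ responds to each request within $C n^3d^3$ steps, and each path in $\mathcal P$ has length at most $C\log n$. -/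

import Mathlib

namespace Routing

/-! ### Graphs, directed or undirected, on the vertex set `Fin n` -/

/-- A finite graph on `n` labelled vertices: either a simple undirected graph, or a directed graph
without loops (in which both `(u, v)` and `(v, u)` may be present, as two different edges). -/
inductive Network (n : ℕ) where
  | undirected (G : SimpleGraph (Fin n))
  | directed (D : Digraph (Fin n)) (loopless : ∀ v, ¬ D.Adj v v)

namespace Network

variable {n : ℕ}

/-- There is an edge that can be traversed from `u` to `v`. -/
def Adj : Network n → Fin n → Fin n → Prop
  | undirected G => G.Adj
  | directed D _ => D.Adj

/-- `1` for a directed graph and `0` for an undirected one. -/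
def flag : Network n → ℕ
  | undirected _ => 0
  | directed _ _ => 1

/-- Every vertex has degree `d` (undirected), resp. in-degree and out-degree `d` (directed). -/
def IsRegular (d : ℕ) : Network n → Prop
  | undirected G => ∀ v, {w | G.Adj v w}.ncard = d
  | directed D _ => ∀ v, {w | D.Adj v w}.ncard = d ∧ {w | D.Adj w v}.ncard = d

/-- The number of edges with both endpoints in `S`. For a directed graph this is also the number of
edges inside `S` of the multigraph obtained by ignoring the directions. -/
noncomputable def edgesInside : Network n → Finset (Fin n) → ℕ
  | undirected G, S => {e : Sym2 (Fin n) | e ∈ G.edgeSet ∧ ∀ v ∈ e, v ∈ S}.ncard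
  | directed D _, S => {e : Fin n × Fin n | D.Adj e.1 e.2 ∧ e.1 ∈ S ∧ e.2 ∈ S}.ncard

/-- The degree, for a `d`-regular graph, of the undirected (multi)graph that underlies it: `d` for
an undirected graph and `2 * d` for a directed one. -/
def underlyingDegree (d : ℕ) : Network n → ℕ
  | undirected _ => d
  | directed _ _ => 2 * d

/-- A `d`-regular graph is a `(β, γ)`-expander. A directed graph is one if the `2d`-regular
multigraph obtained by ignoring the directions of its edges is. -/
def IsExpander (G : Network n) (d : ℕ) (β γ : ℝ) : Prop :=
  ∀ S : Finset (Fin n), (S.card : ℝ) ≤ n / 2 →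
    ((S.card : ℝ) ≤ β * n →
      (G.edgesInside S : ℝ) ≤ γ * G.underlyingDegree d * S.card) ∧
    (β * n < (S.card : ℝ) →
      (G.edgesInside S : ℝ) ≤ G.underlyingDegree d * S.card / 3)

/-- The list `P` is the vertex sequence of a path from `a` to `b` (no vertex is repeated, and edges
of a directed graph are used in their direction). For `a = b` this is the one-vertex path. -/
def IsPath (G : Network n) (a b : Fin n) (P : List (Fin n)) : Prop :=
  P.head? = some a ∧ P.getLast? = some b ∧ P.Nodup ∧ P.IsChain G.Adj

/-- Two traversed pairs stand for the same edge: in an undirected graph, up to orientation. -/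
def SameEdge : Network n → Fin n × Fin n → Fin n × Fin n → Prop
  | undirected _, e, f => s(e.1, e.2) = s(f.1, f.2)
  | directed _ _, e, f => e = f

/-- The consecutive pairs of a vertex sequence. -/
def steps (P : List (Fin n)) : List (Fin n × Fin n) := P.zip P.tail

/-- The paths `P` and `Q` have no common edge. -/
def EdgeDisjoint (G : Network n) (P Q : List (Fin n)) : Prop :=
  ∀ e ∈ steps P, ∀ f ∈ steps Q, ¬ G.SameEdge e f

end Network

/-! ### Word-RAM programs with a step count

Memory consists of variables and arrays, each cell holding one machine word. A program is a finite
text, so it mentions only finitely many variables and arrays. All arithmetic is on words, that is,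
modulo the word bound `W`. -/

/-- The arithmetic operations; comparisons return `1` or `0`, subtraction is truncated at `0`. -/
inductive Op where
  | add | sub | mul | div | mod | lt | eq

/-- The value of an operation, before reduction to a word. -/
def Op.apply : Op → ℕ → ℕ → ℕ
  | .add, x, y => x + y
  | .sub, x, y => x - y
  | .mul, x, y => x * y
  | .div, x, y => x / y
  | .mod, x, y => x % y
  | .lt, x, y => if x < y then 1 else 0
  | .eq, x, y => if x = y then 1 else 0

/-- Expressions: literals, variables, array cells (with computed index) and operations. -/
inductive Term where
  | lit (c : ℕ)
  | var (x : ℕ)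
  | cell (A : ℕ) (i : Term)
  | op (o : Op) (e f : Term)

/-- The content of the memory. -/
structure Store where
  var : ℕ → ℕ
  arr : ℕ → ℕ → ℕ

/-- Write a variable. -/
def Store.setVar (s : Store) (x v : ℕ) : Store :=
  { s with var := Function.update s.var x v }

/-- Write an array cell. -/
def Store.setCell (s : Store) (A i v : ℕ) : Store :=
  { s with arr := Function.update s.arr A (Function.update (s.arr A) i v) }

/-- The value of an expression on a machine whose words are the numbers below `W`. -/
def Term.eval (W : ℕ) (s : Store) : Term → ℕ
  | .lit c => c % W
  | .var x => s.var x
  | .cell A i => s.arr A (i.eval W s)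
  | .op o e f => o.apply (e.eval W s) (f.eval W s) % W

/-- The number of steps needed to evaluate an expression: one for each of its nodes. -/
def Term.cost : Term → ℕ
  | .lit _ => 1
  | .var _ => 1
  | .cell _ i => 1 + i.cost
  | .op _ e f => 1 + e.cost + f.cost

/-- Programs. A test counts as true if its value is not zero. -/
inductive Prog where
  | skip
  | assign (x : ℕ) (e : Term)
  | write (A : ℕ) (i e : Term)
  | seq (p q : Prog)
  | cond (e : Term) (p q : Prog)
  | loop (e : Term) (p : Prog)

/-- `Exec W p s t s'`: on a machine with word bound `W`, the program `p` started in the memory `s`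
halts after exactly `t` steps, in the memory `s'`. -/
inductive Exec (W : ℕ) : Prog → Store → ℕ → Store → Prop where
  | skip (s : Store) : Exec W .skip s 1 s
  | assign (x : ℕ) (e : Term) (s : Store) :
      Exec W (.assign x e) s (1 + e.cost) (s.setVar x (e.eval W s))
  | write (A : ℕ) (i e : Term) (s : Store) :
      Exec W (.write A i e) s (1 + i.cost + e.cost) (s.setCell A (i.eval W s) (e.eval W s))
  | seq {p q : Prog} {s s₁ s₂ : Store} {t₁ t₂ : ℕ} :
      Exec W p s t₁ s₁ → Exec W q s₁ t₂ s₂ → Exec W (.seq p q) s (t₁ + t₂) s₂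
  | cond_true {e : Term} {p q : Prog} {s s₁ : Store} {t : ℕ} :
      e.eval W s ≠ 0 → Exec W p s t s₁ → Exec W (.cond e p q) s (1 + e.cost + t) s₁
  | cond_false {e : Term} {p q : Prog} {s s₁ : Store} {t : ℕ} :
      e.eval W s = 0 → Exec W q s t s₁ → Exec W (.cond e p q) s (1 + e.cost + t) s₁
  | loop_stop {e : Term} {p : Prog} {s : Store} :
      e.eval W s = 0 → Exec W (.loop e p) s (1 + e.cost) s
  | loop_step {e : Term} {p : Prog} {s s₁ s₂ : Store} {t₁ t₂ : ℕ} :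
      e.eval W s ≠ 0 → Exec W p s t₁ s₁ → Exec W (.loop e p) s₁ t₂ s₂ →
      Exec W (.loop e p) s (1 + e.cost + t₁ + t₂) s₂

/-- Execution is deterministic. -/
theorem Exec.deterministic {W : ℕ} {p : Prog} {s s₁ s₂ : Store} {t₁ t₂ : ℕ}
    (h₁ : Exec W p s t₁ s₁) (h₂ : Exec W p s t₂ s₂) : t₁ = t₂ ∧ s₁ = s₂ := by
  induction h₁ generalizing t₂ s₂ with
  | skip s => cases h₂; exact ⟨rfl, rfl⟩
  | assign x e s => cases h₂; exact ⟨rfl, rfl⟩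
  | write A i e s => cases h₂; exact ⟨rfl, rfl⟩
  | seq _ _ ih₁ ih₂ =>
    cases h₂ with
    | seq a b =>
      obtain ⟨rfl, rfl⟩ := ih₁ a
      obtain ⟨rfl, rfl⟩ := ih₂ b
      exact ⟨rfl, rfl⟩
  | cond_true h _ ih =>
    cases h₂ with
    | cond_true _ a => obtain ⟨rfl, rfl⟩ := ih a; exact ⟨rfl, rfl⟩
    | cond_false h' _ => exact absurd h' h
  | cond_false h _ ih =>
    cases h₂ with
    | cond_true h' _ => exact absurd h h'
    | cond_false _ a => obtain ⟨rfl, rfl⟩ := ih a; exact ⟨rfl, rfl⟩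
  | loop_stop h =>
    cases h₂ with
    | loop_stop _ => exact ⟨rfl, rfl⟩
    | loop_step h' _ _ => exact absurd h h'
  | loop_step h _ _ ih₁ ih₂ =>
    cases h₂ with
    | loop_stop h' => exact absurd h' h
    | loop_step _ a b =>
      obtain ⟨rfl, rfl⟩ := ih₁ a
      obtain ⟨rfl, rfl⟩ := ih₂ b
      exact ⟨rfl, rfl⟩

/-! ### Input and output conventions -/

variable {n : ℕ}

/-- `N v` lists the `d` neighbours (out-neighbours, in a directed graph) of `v`, in any order and
without repetition. -/
def IsAdjacencyList (G : Network n) {d : ℕ} (N : Fin n → Fin d → Fin n) : Prop :=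
  ∀ v, Function.Injective (N v) ∧ ∀ w, G.Adj v w ↔ ∃ i, N v i = w

/-- The memory before the first request: variables `0`, `1`, `2` hold `n`, `d` and whether the graph
is directed, cell `v * d + i` of array `0` holds `N v i`, and everything else is `0`. -/
def initialStore (G : Network n) {d : ℕ} (N : Fin n → Fin d → Fin n) : Store where
  var x := if x = 0 then n else if x = 1 then d else if x = 2 then G.flag else 0
  arr A k :=
    if A = 0 then
      if h : k < n * d then (N (Fin.divNat ⟨k, h⟩) (Fin.modNat ⟨k, h⟩) : ℕ) else 0
    else 0

/-- Request a path from `a` to `b`: variables `3`, `4`, `5` are set to `0`, `a`, `b`. -/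
def loadFind (s : Store) (a b : Fin n) : Store :=
  ((s.setVar 3 0).setVar 4 a).setVar 5 b

/-- Request the removal of the path `P`: variable `3` is set to `1`, variable `4` to the number of
vertices of `P`, and the vertices of `P` are written to the first cells of array `1`. -/
def loadRemove (s : Store) (P : List (Fin n)) : Store where
  var := ((s.setVar 3 1).setVar 4 P.length).var
  arr A k := if A = 1 then (if h : k < P.length then (P[k] : ℕ) else s.arr 1 k) else s.arr A k

/-- The answer in the memory `s` is the vertex sequence `P`: its number of vertices is in variable
`6`, and its vertices are in the first cells of array `2`. -/
def Answers (s : Store) (P : List (Fin n)) : Prop :=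
  s.var 6 = P.length ∧ ∀ (k : ℕ) (h : k < P.length), s.arr 2 k = (P[k] : ℕ)

/-! ### The routing game -/

/-- The number of paths of the family that have `v` as an endpoint. -/
def endpointCount (F : Multiset (List (Fin n))) (v : Fin n) : ℕ :=
  F.countP (fun P => P.head? = some v ∨ P.getLast? = some v)

/-- In the `r`-routing game on a `d`-regular graph, Adversary may request a path from `a` to `b`
when `F` is the current family of paths. -/
def MayFind (d : ℕ) (r : ℝ) (F : Multiset (List (Fin n))) (a b : Fin n) : Prop :=
  (endpointCount F a : ℝ) < d / 200 ∧ (endpointCount F b : ℝ) < d / 200 ∧ (F.card : ℝ) < r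

/-- `Reachable d r p W s₀ s F`: when Router answers each request by running the program `p`
(word bound `W`), with memory `s₀` at the start and memory kept between requests, some finite series
of permitted requests leads to the memory `s` and the family of paths `F`. -/
inductive Reachable (d : ℕ) (r : ℝ) (p : Prog) (W : ℕ) (s₀ : Store) :
    Store → Multiset (List (Fin n)) → Prop where
  | start : Reachable d r p W s₀ s₀ 0
  | find {s s' : Store} {F : Multiset (List (Fin n))} {a b : Fin n} {t : ℕ} {P : List (Fin n)} :
      Reachable d r p W s₀ s F → MayFind d r F a b →
      Exec W p (loadFind s a b) t s' → Answers s' P → Reachable d r p W s₀ s' (P ::ₘ F)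
  | remove {s s' : Store} {F : Multiset (List (Fin n))} {t : ℕ} {P : List (Fin n)} :
      Reachable d r p W s₀ s F → P ∈ F →
      Exec W p (loadRemove s P) t s' → Reachable d r p W s₀ s' (F.erase P)

/-- The program `p` wins the `r`-routing game on the `d`-regular graph `G` for Router, for every
behaviour of Adversary: after any series of permitted requests, it halts on each further permitted
request within `T` steps, and each request for a path from `a` to `b` is answered by such a path,
edge-disjoint from all the paths of the current family, and with at most `ℓ` edges. -/
def Wins (G : Network n) (d : ℕ) (r : ℝ) (p : Prog) (W : ℕ) (s₀ : Store) (T : ℕ) (ℓ : ℝ) : Prop :=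
  ∀ (s : Store) (F : Multiset (List (Fin n))), Reachable d r p W s₀ s F →
    (∀ a b : Fin n, MayFind d r F a b →
      ∃ (t : ℕ) (s' : Store) (P : List (Fin n)),
        Exec W p (loadFind s a b) t s' ∧ t ≤ T ∧ Answers s' P ∧
        G.IsPath a b P ∧ (∀ Q ∈ F, G.EdgeDisjoint P Q) ∧
        ((Network.steps P).length : ℝ) ≤ ℓ) ∧
    (∀ P ∈ F, ∃ (t : ℕ) (s' : Store), Exec W p (loadRemove s P) t s' ∧ t ≤ T)

end Routing

/-!
Undirected networks are treated as symmetric relations `E = G.Adj`, in which using an edge uses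
both of its arcs, so that one argument covers both kinds of networks.

At any time, let `U` be the set of used arcs. Call a set `X` closed if no vertex outside `X` meets
more than `d / 50` arcs of `U`, or is joined to `X` by more than `d / 50` arcs. The paths of the
family have length `O(log n)`, so there are few used arcs, and as small sets of vertices are
sparse, there is a closed set `X` with at most `β n` vertices (`Expanding.exists_isClosedUnder`).
Outside `X` the unused arcs still expand, so any two vertices outside `X` are joined by an unused
path of logarithmic length (`Expanding.exists_steps`).

It remains to lead paths out of `X` and into `X`. For this, every congested vertex owns almost all
of its arcs: `O v w` and `J w v` stand for the out-arcs and in-arcs owned by `v`. When a vertex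
enters `X`, it reserves the unused arcs to all vertices that are not in `X` already and do not wait
to make their reservations. Since small sets are sparse, some waiting vertex always has few
neighbours among those waiting, so that it obtains almost all of its arcs (`Peeling.step`,
`Expanding.eq_empty`). A path uses arcs owned by `v ∈ X` only after it arrived at `v` on an arc
owned by another vertex, or before it leaves `v` on such an arc, or if it starts or ends at `v`.
There are at most `d / 40` arcs at `v` owned by others, and few paths end at `v`, so in each
direction at least four fifths of `d` owned arcs remain unused at all times (`Reserved.available`).
As also each vertex of `X` receives at most `d / 40` arcs owned by others, balls in `X` double in
each step, and from each vertex of `X` one leaves `X` after at most `Nat.log 2 n + 1` steps along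
arcs owned by their tails (`exists_steps_notMem`); symmetrically, one enters `X` along arcs owned
by their heads. Hence a breadth-first search for a path of this form succeeds within `10 * (Nat.log
2 n + 1)` steps (`Expanding.exists_reaches`), and its result keeps the invariant
(`Good.cons_route`). The reservations of a vertex are kept until it leaves `X`.

The search works on pairs of a vertex and a phase: phase `false` until the first arc owned by its
head is used, and phase `true` from then on.

The program keeps `n`, `d` and the flag in variables `0`, `1`, `2`, and works with the following
arrays: `0` adjacency lists, `1` path to be removed, `2` answer, `3` adjacency matrix, `4` used
arcs, `5` and `6` arcs owned by their tails and by their heads, `7` the set `X`, `8` the new closed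
set, `9` the waiting vertices, `10` and `11` labels and pointers of the search. It does not depend
on `β` and `γ`.
-/

namespace Routing

/-! ### Reasoning about programs -/

@[simp] theorem Store.setVar_var (s : Store) (x v y : ℕ) :
    (s.setVar x v).var y = if y = x then v else s.var y := by
  simp [Store.setVar, Function.update_apply]

@[simp] theorem Store.setVar_arr (s : Store) (x v : ℕ) : (s.setVar x v).arr = s.arr := rfl

@[simp] theorem Store.setCell_var (s : Store) (A i v : ℕ) : (s.setCell A i v).var = s.var := rfl

@[simp] theorem Store.setCell_arr (s : Store) (A i v B : ℕ) :
    (s.setCell A i v).arr B = if B = A then Function.update (s.arr A) i v else s.arr B := by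
  simp [Store.setCell, Function.update_apply]

/-- Total correctness with a time bound: started in `s`, the program `p` halts within `T` steps in
a memory that satisfies `Q`. -/
def Runs (W : ℕ) (p : Prog) (s : Store) (T : ℕ) (Q : Store → Prop) : Prop :=
  ∃ t s', Exec W p s t s' ∧ t ≤ T ∧ Q s'

/-- The variables that occur as targets of assignments in a program. -/
def Prog.ModVar : Prog → ℕ → Prop
  | .skip, _ => False
  | .assign y _, x => x = y
  | .write _ _ _, _ => False
  | .seq p q, x => p.ModVar x ∨ q.ModVar x
  | .cond _ p q, x => p.ModVar x ∨ q.ModVar x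
  | .loop _ p, x => p.ModVar x

/-- The arrays that occur as targets of write instructions in a program. -/
def Prog.ModArr : Prog → ℕ → Prop
  | .skip, _ => False
  | .assign _ _, _ => False
  | .write B _ _, A => A = B
  | .seq p q, A => p.ModArr A ∨ q.ModArr A
  | .cond _ p q, A => p.ModArr A ∨ q.ModArr A
  | .loop _ p, A => p.ModArr A

/-- The memories `s` and `s'` agree on everything that the program `p` has no instruction to
change. -/
def Same (p : Prog) (s s' : Store) : Prop :=
  (∀ x, ¬ p.ModVar x → s'.var x = s.var x) ∧ (∀ A, ¬ p.ModArr A → s'.arr A = s.arr A)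

theorem Same.refl (p : Prog) (s : Store) : Same p s s := ⟨fun _ _ => rfl, fun _ _ => rfl⟩

theorem Same.trans {p : Prog} {s s' s'' : Store} (h : Same p s s') (h' : Same p s' s'') :
    Same p s s'' :=
  ⟨fun x hx => (h'.1 x hx).trans (h.1 x hx), fun x hx => (h'.2 x hx).trans (h.2 x hx)⟩

theorem Same.mono {p q : Prog} {s s' : Store} (h : Same p s s')
    (hv : ∀ x, p.ModVar x → q.ModVar x) (ha : ∀ x, p.ModArr x → q.ModArr x) : Same q s s' :=
  ⟨fun x hx => h.1 x fun h' => hx (hv x h'), fun x hx => h.2 x fun h' => hx (ha x h')⟩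

theorem Exec.same {W : ℕ} {p : Prog} {s s' : Store} {t : ℕ} (h : Exec W p s t s') :
    Same p s s' := by
  induction h with
  | skip s => exact Same.refl _ _
  | assign x e s => exact ⟨fun y hy => by simp_all [Prog.ModVar], fun _ _ => rfl⟩
  | write A i e s =>
    exact ⟨fun _ _ => rfl, fun B hB => by simp_all [Prog.ModArr]⟩
  | seq _ _ ih₁ ih₂ =>
    exact (ih₁.mono (fun _ => Or.inl) fun _ => Or.inl).trans
      (ih₂.mono (fun _ => Or.inr) fun _ => Or.inr)
  | cond_true _ _ ih => exact ih.mono (fun _ => Or.inl) fun _ => Or.inl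
  | cond_false _ _ ih => exact ih.mono (fun _ => Or.inr) fun _ => Or.inr
  | loop_stop => exact Same.refl _ _
  | loop_step _ _ _ ih₁ ih₂ => exact Same.trans (p := Prog.loop _ _) (ih₁.mono (fun _ h => h) fun _ h => h) ih₂

theorem Runs.same {W : ℕ} {p : Prog} {s : Store} {T : ℕ} {Q : Store → Prop}
    (h : Runs W p s T Q) : Runs W p s T (fun s' => Q s' ∧ Same p s s') := by
  obtain ⟨t, s', h, ht, hQ⟩ := h
  exact ⟨t, s', h, ht, hQ, h.same⟩

theorem Runs.mono {W : ℕ} {p : Prog} {s : Store} {T T' : ℕ} {Q Q' : Store → Prop}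
    (h : Runs W p s T Q) (hT : T ≤ T') (hQ : ∀ s', Q s' → Q' s') : Runs W p s T' Q' := by
  obtain ⟨t, s', h, ht, hQ'⟩ := h
  exact ⟨t, s', h, ht.trans hT, hQ _ hQ'⟩

theorem Runs.seq {W : ℕ} {p q : Prog} {s : Store} {T₁ T₂ : ℕ} {R Q : Store → Prop}
    (h₁ : Runs W p s T₁ R) (h₂ : ∀ s', R s' → Same p s s' → Runs W q s' T₂ Q) :
    Runs W (.seq p q) s (T₁ + T₂) Q := by
  obtain ⟨t, s', h, ht, hR, hS⟩ := h₁.same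
  obtain ⟨t', s'', h', ht', hQ⟩ := h₂ s' hR hS
  exact ⟨t + t', s'', .seq h h', by omega, hQ⟩

theorem Runs.cond {W : ℕ} {e : Term} {p q : Prog} {s : Store} {T : ℕ} {Q : Store → Prop}
    (h₁ : e.eval W s ≠ 0 → Runs W p s T Q) (h₂ : e.eval W s = 0 → Runs W q s T Q) :
    Runs W (.cond e p q) s (1 + e.cost + T) Q := by
  by_cases h : e.eval W s = 0
  · obtain ⟨t, s', h', ht, hQ⟩ := h₂ h
    exact ⟨_, s', .cond_false h h', by omega, hQ⟩
  · obtain ⟨t, s', h', ht, hQ⟩ := h₁ h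
    exact ⟨_, s', .cond_true h h', by omega, hQ⟩

/-- The weakest precondition of a program without loops. -/
def wp (W : ℕ) : Prog → (Store → Prop) → Store → Prop
  | .skip, Q, s => Q s
  | .assign x e, Q, s => Q (s.setVar x (e.eval W s))
  | .write A i e, Q, s => Q (s.setCell A (i.eval W s) (e.eval W s))
  | .seq p q, Q, s => wp W p (wp W q Q) s
  | .cond e p q, Q, s => (e.eval W s ≠ 0 → wp W p Q s) ∧ (e.eval W s = 0 → wp W q Q s)
  | .loop _ _, _, _ => False

/-- A bound on the number of steps of a program without loops. -/
def Prog.time : Prog → ℕ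
  | .skip => 1
  | .assign _ e => 1 + e.cost
  | .write _ i e => 1 + i.cost + e.cost
  | .seq p q => p.time + q.time
  | .cond e p q => 1 + e.cost + max p.time q.time
  | .loop _ _ => 0

theorem Runs.of_wp {W : ℕ} {p : Prog} {s : Store} {Q : Store → Prop} (h : wp W p Q s) :
    Runs W p s p.time Q := by
  induction p generalizing s Q with
  | skip => exact ⟨_, _, .skip s, le_rfl, h⟩
  | assign x e => exact ⟨_, _, .assign x e s, le_rfl, h⟩
  | write A i e => exact ⟨_, _, .write A i e s, le_rfl, h⟩
  | seq p q ih₁ ih₂ => exact (ih₁ h).seq fun s' h' _ => ih₂ h'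
  | cond e p q ih₁ ih₂ =>
    exact Runs.cond (fun h' => (ih₁ (h.1 h')).mono (le_max_left _ _) fun _ => id)
      (fun h' => (ih₂ (h.2 h')).mono (le_max_right _ _) fun _ => id)
  | loop e p => exact h.elim

/-- The rule for loops that terminate because the measure `μ` decreases. -/
theorem Runs.loop {W : ℕ} {e : Term} {p : Prog} {s : Store} {T : ℕ} (Inv : Store → Prop)
    (μ : Store → ℕ) (h₀ : Inv s)
    (hstep : ∀ s', Same p s s' → Inv s' → e.eval W s' ≠ 0 →
      Runs W p s' T (fun s'' => Inv s'' ∧ μ s'' < μ s')) :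
    Runs W (.loop e p) s ((μ s + 1) * (T + 1 + e.cost)) (fun s' => Inv s' ∧ e.eval W s' = 0) := by
  suffices H : ∀ m s', μ s' = m → Same p s s' → Inv s' →
      Runs W (.loop e p) s' ((m + 1) * (T + 1 + e.cost))
        (fun s' => Inv s' ∧ e.eval W s' = 0) from H _ s rfl (Same.refl _ _) h₀
  intro m
  induction m using Nat.strong_induction_on with
  | _ m ih =>
  intro s' hm hS hI
  by_cases h : e.eval W s' = 0
  · exact ⟨_, _, Exec.loop_stop h, by nlinarith, hI, h⟩
  · obtain ⟨t, s₁, h₁, ht, ⟨hI₁, hlt⟩, hS₁⟩ := (hstep s' hS hI h).same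
    obtain ⟨t₂, s₂, h₂, ht₂, hQ⟩ := ih (μ s₁) (hm ▸ hlt) s₁ rfl (hS.trans hS₁) hI₁
    refine ⟨_, s₂, .loop_step h h₁ h₂, ?_, hQ⟩
    have : (μ s₁ + 1) * (T + 1 + e.cost) ≤ m * (T + 1 + e.cost) :=
      Nat.mul_le_mul_right _ (by omega)
    rw [Nat.add_one_mul]
    omega

/-- `for x := 0, …, (value of y) - 1 do p`. -/
def Prog.forUp (x y : ℕ) (p : Prog) : Prog :=
  .seq (.assign x (.lit 0)) (.loop (.op .lt (.var x) (.var y))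
    (.seq p (.assign x (.op .add (.var x) (.lit 1)))))

/-- The rule for `forUp`, with an invariant `Inv k` that holds when `k` iterations are done and that
does not depend on the counter `x`. -/
theorem Runs.forUp {W x y N : ℕ} {p : Prog} {s : Store} {T : ℕ} (Inv : ℕ → Store → Prop)
    (hN : s.var y = N) (hW : N < W) (hxy : x ≠ y) (hx : ¬ p.ModVar x) (hy : ¬ p.ModVar y)
    (h₀ : Inv 0 s) (hins : ∀ k s v, Inv k s → Inv k (s.setVar x v))
    (hstep : ∀ k s', k < N → s'.var x = k → Same (p.forUp x y) s s' → Inv k s' →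
      Runs W p s' T (Inv (k + 1))) :
    Runs W (p.forUp x y) s ((N + 1) * (T + 10)) (fun s' => Inv N s' ∧ Same (p.forUp x y) s s') := by
  refine Runs.same ?_
  have hsub : Same (p.forUp x y) s (s.setVar x 0) :=
    ⟨fun z hz => by simp only [Prog.forUp, Prog.ModVar] at hz; simp; tauto, fun _ _ => rfl⟩
  have key : Runs W (.seq (.assign x (.lit 0)) (.loop (.op .lt (.var x) (.var y))
      (.seq p (.assign x (.op .add (.var x) (.lit 1)))))) s
      (2 + (N + 1) * (T + 4 + 1 + 3)) (Inv N) := by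
    refine Runs.seq (R := fun s' => s' = s.setVar x 0) ⟨2, _, .assign _ _ _, le_rfl, ?_⟩ ?_
    · simp [Term.eval]
    rintro _ rfl -
    refine (Runs.loop (T := T + 4)
      (fun s' => s'.var x ≤ N ∧ s'.var y = N ∧ Inv (s'.var x) s' ∧ Same (p.forUp x y) s s')
      (fun s' => N - s'.var x) ?_ ?_).mono ?_ ?_
    · refine ⟨by simp, by simp [hN, hxy.symm], by simpa using hins _ _ _ h₀, hsub⟩
    · rintro s' - ⟨hle, hy', hI, hS⟩ he
      have hlt : s'.var x < N := by
        by_contra hc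
        apply he
        simp [Term.eval, Op.apply, hy', hc]
      refine (hstep _ s' hlt rfl hS hI).seq (T₂ := 4) ?_
      intro s₁ hI₁ hS₁
      have e1 : s₁.var x = s'.var x := hS₁.1 x hx
      have e2 : s₁.var y = N := (hS₁.1 y hy).trans hy'
      have e3 : (s'.var x + 1) % W = s'.var x + 1 := Nat.mod_eq_of_lt (by omega)
      have e4 : 1 % W = 1 := Nat.mod_eq_of_lt (by omega)
      refine ⟨4, _, .assign _ _ _, le_rfl, ?_⟩
      simp only [Term.eval, Op.apply, Store.setVar_var, e1, e3, e4, if_true, hxy.symm, if_false, e2]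
      refine ⟨⟨by omega, trivial, hins _ _ _ hI₁, hS.trans ?_⟩, by omega⟩
      refine ⟨fun z hz => ?_, fun A hA => ?_⟩
      · simp only [Prog.forUp, Prog.ModVar] at hz
        simp only [Store.setVar_var]
        rw [if_neg (by tauto)]
        exact hS₁.1 z (by tauto)
      · simp only [Prog.forUp, Prog.ModArr] at hA
        exact hS₁.2 A (by tauto)
    · simp [Term.cost]
    · rintro s' ⟨⟨hle, hy', hI, hS⟩, he⟩
      have : s'.var x = N := by
        by_contra hc
        have h1 : 1 < W := by omega
        simp [Term.eval, Op.apply, hy', show s'.var x < N by omega, Nat.mod_eq_of_lt h1] at he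
      exact this ▸ hI
  refine key.mono ?_ fun _ => id
  nlinarith

/-- Repeat the sweep `for x < y do p` as long as the variable `c` is set by `p`. -/
def Prog.sweep (c x y : ℕ) (p : Prog) : Prog :=
  .seq (.assign c (.lit 1)) (.loop (.var c) (.seq (.assign c (.lit 0)) (p.forUp x y)))

/-- A sweep repeated until nothing changes keeps the invariant `Φ` of the data `f` held in the
arrays, and ends when no index is active any more: in each iteration, either the index is not
active and nothing changes, or the measure `μ` decreases and the change is recorded in `c`. -/
theorem Runs.sweep {α : Type*} {W c x y N : ℕ} {p : Prog} {s : Store} {T : ℕ}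
    (f : (ℕ → ℕ → ℕ) → α) (Φ : α → Prop) (act : α → ℕ → Prop) (μ : α → ℕ)
    (hN : s.var y = N) (hW : N < W) (hW1 : 1 < W) (hxy : x ≠ y) (hcy : c ≠ y) (hcx : c ≠ x)
    (hx : ¬ p.ModVar x) (hy : ¬ p.ModVar y) (h₀ : Φ (f s.arr))
    (hstep : ∀ k s', k < N → s'.var x = k → Same (p.sweep c x y) s s' → Φ (f s'.arr) →
      Runs W p s' T (fun s'' =>
        (f s''.arr = f s'.arr ∧ ¬ act (f s'.arr) k ∧ s''.var c = s'.var c) ∨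
        (Φ (f s''.arr) ∧ μ (f s''.arr) < μ (f s'.arr) ∧ s''.var c = 1))) :
    Runs W (p.sweep c x y) s ((μ (f s.arr) + 3) * ((N + 1) * (T + 10) + 4))
      (fun s' => Φ (f s'.arr) ∧ (∀ k < N, ¬ act (f s'.arr) k) ∧ Same (p.sweep c x y) s s') := by
  have hmv : ∀ z, (p.sweep c x y).ModVar z ↔ z = c ∨ z = x ∨ p.ModVar z := by
    intro z
    simp only [Prog.sweep, Prog.forUp, Prog.ModVar]
    tauto
  have hma : ∀ z, (p.sweep c x y).ModArr z ↔ p.ModArr z := by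
    intro z
    simp only [Prog.sweep, Prog.forUp, Prog.ModArr]
    tauto
  have hma' : ∀ z, (p.forUp x y).ModArr z ↔ p.ModArr z := by
    intro z
    simp only [Prog.forUp, Prog.ModArr]
    tauto
  have hmv' : ∀ z, (p.forUp x y).ModVar z ↔ z = x ∨ p.ModVar z := by
    intro z
    simp only [Prog.forUp, Prog.ModVar]
    tauto
  have hset : ∀ s' v, Same (p.sweep c x y) s s' → Same (p.sweep c x y) s (s'.setVar c v) := by
    intro s' v h
    refine h.trans ⟨fun z hz => ?_, fun _ _ => rfl⟩
    rw [hmv] at hz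
    simp only [Store.setVar_var]
    rw [if_neg (by tauto)]
  have hone : 1 % W = 1 := Nat.mod_eq_of_lt hW1
  have key : Runs W (p.sweep c x y) s
      (2 + (μ (f s.arr) + 1 + 1) * ((2 + (N + 1) * (T + 10)) + 1 + 1))
      (fun s' => Φ (f s'.arr) ∧ (∀ k < N, ¬ act (f s'.arr) k)) := by
    refine Runs.seq (R := fun s' => s' = s.setVar c 1) ⟨2, _, .assign _ _ _, le_rfl, ?_⟩ ?_
    · simp [Term.eval, hone]
    rintro _ rfl -
    refine (Runs.loop (T := 2 + (N + 1) * (T + 10))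
      (fun s' => Φ (f s'.arr) ∧ (s'.var c = 0 → ∀ k < N, ¬ act (f s'.arr) k) ∧
        Same (p.sweep c x y) s s')
      (fun s' => μ (f s'.arr) + s'.var c) ?_ ?_).mono ?_ ?_
    · exact ⟨h₀, by simp, hset _ _ (Same.refl _ _)⟩
    · rintro s' - ⟨hΦ, -, hS⟩ he
      have hc0 : s'.var c ≠ 0 := he
      refine Runs.seq (R := fun s₁ => s₁ = s'.setVar c 0) ⟨2, _, .assign _ _ _, le_rfl, ?_⟩ ?_
      · simp [Term.eval]
      rintro _ rfl -
      have hS₀ := hset s' 0 hS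
      refine (Runs.forUp (N := N) (T := T) (fun k s₂ => Φ (f s₂.arr) ∧
        ((s₂.var c = 0 ∧ f s₂.arr = f s'.arr ∧ ∀ j < k, ¬ act (f s'.arr) j) ∨
          (s₂.var c = 1 ∧ μ (f s₂.arr) < μ (f s'.arr)))) ?_ hW hxy hx hy ?_ ?_ ?_).mono le_rfl ?_
      · rw [hS₀.1 y (by rw [hmv]; tauto), hN]
      · exact ⟨hΦ, Or.inl ⟨by simp, rfl, by simp⟩⟩
      · intro k s₂ v h
        simpa [hcx] using h
      · rintro k s₂ hk hxk hS₂ ⟨hΦ₂, hcase⟩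
        have hS₂' : Same (p.sweep c x y) s s₂ :=
          hS₀.trans (hS₂.mono (fun z => by rw [hmv, hmv']; tauto)
            fun z => by rw [hma, hma']; tauto)
        refine (hstep k s₂ hk hxk hS₂' hΦ₂).mono le_rfl ?_
        rintro s₃ (⟨h1, h2, h3⟩ | ⟨h1, h2, h3⟩)
        · rw [h1, h3]
          refine ⟨hΦ₂, hcase.imp ?_ id⟩
          rintro ⟨g1, g2, g3⟩
          refine ⟨g1, g2, fun j hj => ?_⟩
          rcases Nat.lt_succ_iff_lt_or_eq.1 hj with hj | rfl
          · exact g3 j hj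
          · rwa [g2] at h2
        · refine ⟨h1, Or.inr ⟨h3, ?_⟩⟩
          rcases hcase with ⟨_, g2, _⟩ | ⟨_, g2⟩
          · rwa [g2] at h2
          · omega
      · rintro s₂ ⟨⟨hΦ₂, hcase⟩, hS₂⟩
        have hS₂' : Same (p.sweep c x y) s s₂ :=
          hS₀.trans (hS₂.mono (fun z => by rw [hmv, hmv']; tauto)
            fun z => by rw [hma, hma']; tauto)
        rcases hcase with ⟨g1, g2, g3⟩ | ⟨g1, g2⟩
        · exact ⟨⟨hΦ₂, fun _ => g2 ▸ g3, hS₂'⟩, by rw [g1, g2]; omega⟩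
        · exact ⟨⟨hΦ₂, fun h => by omega, hS₂'⟩, by rw [g1]; omega⟩
    · simp [Term.cost]
    · rintro s' ⟨⟨h1, h2, -⟩, h3⟩
      exact ⟨h1, h2 h3⟩
  refine key.same.mono ?_ fun s' h => ⟨h.1.1, h.1.2, h.2⟩
  nlinarith

/-! ### Relations and sets stored in arrays -/

section Counting

open Classical in
/-- The number of `w ∈ S` with `R v w`. -/
noncomputable def outCount {n : ℕ} (R : Fin n → Fin n → Prop) (S : Finset (Fin n)) (v : Fin n) : ℕ :=
  (S.filter fun w => R v w).card

open Classical in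
/-- The number of `w ∈ S` with `R w v`. -/
noncomputable def inCount {n : ℕ} (R : Fin n → Fin n → Prop) (S : Finset (Fin n)) (v : Fin n) : ℕ :=
  (S.filter fun w => R w v).card

/-- The number of arcs of the relation `R`, in either direction, between `v` and `S`. -/
noncomputable def arcCount {n : ℕ} (R : Fin n → Fin n → Prop) (S : Finset (Fin n)) (v : Fin n) : ℕ :=
  outCount R S v + inCount R S v

theorem outCount_le {n : ℕ} (R : Fin n → Fin n → Prop) (S : Finset (Fin n)) (v : Fin n) :
    outCount R S v ≤ n :=
  (Finset.card_le_univ _).trans (by simp)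

theorem inCount_le {n : ℕ} (R : Fin n → Fin n → Prop) (S : Finset (Fin n)) (v : Fin n) :
    inCount R S v ≤ n :=
  (Finset.card_le_univ _).trans (by simp)

theorem arcCount_le {n : ℕ} (R : Fin n → Fin n → Prop) (S : Finset (Fin n)) (v : Fin n) :
    arcCount R S v ≤ 2 * n := by
  have := outCount_le R S v
  have := inCount_le R S v
  unfold arcCount
  omega

end Counting

/-- The relation on `Fin n` whose matrix is stored row by row in an array. -/
def matOf (n : ℕ) (a : ℕ → ℕ) (u v : Fin n) : Prop := a (u * n + v) ≠ 0

/-- The subset of `Fin n` whose indicator function is stored in an array. -/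
def setOf (n : ℕ) (a : ℕ → ℕ) : Finset (Fin n) := Finset.univ.filter fun v => a v ≠ 0

@[simp] theorem mem_setOf {n : ℕ} {a : ℕ → ℕ} {v : Fin n} : v ∈ setOf n a ↔ a v ≠ 0 := by
  simp [setOf]

theorem index_lt {n u v : ℕ} (hu : u < n) (hv : v < n) : u * n + v < n * n := by
  nlinarith

theorem index_inj {n u v u' v' : ℕ} (hv : v < n) (hv' : v' < n) :
    u * n + v = u' * n + v' ↔ u = u' ∧ v = v' := by
  constructor
  · intro h
    have hn : 0 < n := by omega
    have h1 : (v + n * u) / n = (v' + n * u') / n := by congr 1; linarith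
    rw [Nat.add_mul_div_left _ _ hn, Nat.add_mul_div_left _ _ hn, Nat.div_eq_of_lt hv,
      Nat.div_eq_of_lt hv'] at h1
    have h2 : u = u' := by omega
    subst h2
    exact ⟨rfl, by omega⟩
  · rintro ⟨rfl, rfl⟩
    rfl

theorem matOf_update {n : ℕ} (a : ℕ → ℕ) (u v u' v' : Fin n) (x : ℕ) :
    matOf n (Function.update a (u * n + v) x) u' v' ↔
      if u' = u ∧ v' = v then x ≠ 0 else matOf n a u' v' := by
  unfold matOf
  simp only [Function.update_apply, index_inj v'.2 v.2, Fin.ext_iff]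
  split_ifs <;> rfl

theorem setOf_update {n : ℕ} (a : ℕ → ℕ) (v w : Fin n) (x : ℕ) :
    w ∈ setOf n (Function.update a v x) ↔ if w = v then x ≠ 0 else w ∈ setOf n a := by
  rw [mem_setOf, Function.update_apply]
  simp only [Fin.ext_iff, mem_setOf]
  split_ifs <;> rfl

/-! ### Counting arcs -/

/-- For the pair `(u, w)` held in variables `10`, `11`: put the matrix index of `(u, w)` into
variable `12` and the index of `(w, u)` into variable `13`. -/
def setIdx : Prog :=
  .seq (.assign 12 (.op .add (.op .mul (.var 10) (.var 0)) (.var 11)))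
    (.assign 13 (.op .add (.op .mul (.var 11) (.var 0)) (.var 10)))

/-- Increment a variable. -/
def incr (x : ℕ) : Prog := .assign x (.op .add (.var x) (.lit 1))

/-- Variable `14` becomes the number of arcs, in the matrix stored in array `R`, between the vertex
in variable `10` and the vertices `w` (in variable `11`) that satisfy the test `e`. -/
def countArcs (R : ℕ) (e : Term) : Prog :=
  .seq (.assign 14 (.lit 0)) (Prog.forUp 11 0 (.cond e (.seq setIdx
    (.seq (.cond (.cell R (.var 12)) (incr 14) .skip) (.cond (.cell R (.var 13)) (incr 14) .skip)))
    .skip))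

theorem arcCount_eq_sum {n : ℕ} (R : Fin n → Fin n → Prop) (S : Finset (Fin n)) (v : Fin n)
    (g : ℕ → ℕ) (hg : ∀ w : Fin n, g w = by
      classical exact if w ∈ S then (if R v w then 1 else 0) + (if R w v then 1 else 0) else 0) :
    ∑ j ∈ Finset.range n, g j = arcCount R S v := by
  classical
  rw [Finset.sum_range]
  simp only [hg]
  rw [← Finset.sum_filter, Finset.sum_add_distrib, ← Finset.sum_filter, ← Finset.sum_filter]
  simp only [Finset.filter_mem_eq_inter, Finset.univ_inter, Finset.sum_const, smul_eq_mul, mul_one]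
  unfold arcCount outCount inCount
  congr!

theorem countArcs_runs {W n R : ℕ} {e : Term} {s : Store} (S : Finset (Fin n)) (v : Fin n)
    (hW : 1000 * (n * n + 1) ≤ W) (h0 : s.var 0 = n) (hv : s.var 10 = (v : ℕ))
    (he : ∀ s' (w : Fin n), s'.var 11 = (w : ℕ) → s'.arr = s.arr → (e.eval W s' ≠ 0 ↔ w ∈ S)) :
    Runs W (countArcs R e) s ((n + 1) * (e.cost + 50))
      (fun s' => s'.var 14 = arcCount (matOf n (s.arr R)) S v) := by
  classical
  have hn : 0 < n := v.pos
  have hnn : n ≤ n * n := Nat.le_mul_self n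
  let g : ℕ → ℕ := fun j => if h : j < n then
    if (⟨j, h⟩ : Fin n) ∈ S then (if matOf n (s.arr R) v ⟨j, h⟩ then 1 else 0) +
      (if matOf n (s.arr R) ⟨j, h⟩ v then 1 else 0) else 0 else 0
  have hg2 : ∀ j, g j ≤ 2 := by
    intro j
    simp only [g]
    split_ifs <;> omega
  have hsum : ∀ k, ∑ j ∈ Finset.range k, g j ≤ k * 2 := fun k =>
    (Finset.sum_le_card_nsmul _ _ 2 fun j _ => hg2 j).trans (by simp)
  have hmain : Runs W (countArcs R e) s (2 + (n + 1) * ((1 + e.cost + 34) + 10))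
      (fun s' => s'.var 14 = arcCount (matOf n (s.arr R)) S v) := by
    refine Runs.seq (R := fun s' => s' = s.setVar 14 0) ⟨2, _, .assign _ _ _, le_rfl, ?_⟩ ?_
    · simp [Term.eval]
    rintro _ rfl -
    refine (Runs.forUp (N := n) (T := 1 + e.cost + 34)
      (fun k s' => s'.var 14 = ∑ j ∈ Finset.range k, g j) (by simp [h0]) (by omega) (by decide)
      (by simp [Prog.ModVar, setIdx, incr]) (by simp [Prog.ModVar, setIdx, incr])
      (by simp) (by simp) ?_).mono le_rfl ?_
    · intro k s' hk hxk hS hI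
      have ha : s'.arr = s.arr := funext fun A => hS.2 A (by simp [Prog.forUp, Prog.ModArr, setIdx, incr])
      have hv' : s'.var 10 = v := by
        rw [hS.1 10 (by simp [Prog.forUp, Prog.ModVar, setIdx, incr])]
        simpa using hv
      have h0' : s'.var 0 = n := by
        rw [hS.1 0 (by simp [Prog.forUp, Prog.ModVar, setIdx, incr])]
        simpa using h0
      have i1 := index_lt v.2 hk
      have i2 := index_lt hk v.2
      have m1 : v * n < W := by omega
      have m2 : k * n < W := by omega
      have hs := hsum k
      refine Runs.cond (T := 34) (fun h => ?_) (fun h => ?_)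
      · rw [he s' ⟨k, hk⟩ hxk ha] at h
        refine (Runs.of_wp (Q := fun s'' => s''.var 14 = ∑ j ∈ Finset.range (k + 1), g j) ?_).mono
          (by simp [Prog.time, setIdx, incr, Term.cost]) fun _ => id
        rw [Finset.sum_range_succ]
        have hgk : g k = (if s.arr R (v * n + k) ≠ 0 then 1 else 0) +
            (if s.arr R (k * n + v) ≠ 0 then 1 else 0) := by
          by_cases c1 : s.arr R (v * n + k) = 0 <;> by_cases c2 : s.arr R (k * n + v) = 0 <;>
            simp [g, hk, h, matOf, c1, c2]
        rw [hgk]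
        have hrange : ∑ j ∈ Finset.range k, g j + 2 < W := by omega
        by_cases c1 : s.arr R (v * n + k) = 0 <;> by_cases c2 : s.arr R (k * n + v) = 0 <;>
          simp (disch := omega) [setIdx, incr, wp, Term.eval, Op.apply, hv', h0', hxk, ha, hI,
            Nat.mod_eq_of_lt, c1, c2]
      · have h' : (⟨k, hk⟩ : Fin n) ∉ S := fun hc => (he s' ⟨k, hk⟩ hxk ha).2 hc h
        refine ⟨1, _, .skip _, by omega, ?_⟩
        simp [Finset.sum_range_succ, hI, g, hk, h']
    · rintro s' ⟨h, -⟩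
      rw [h]
      refine arcCount_eq_sum _ _ _ _ fun w => ?_
      simp [g]
  refine hmain.mono ?_ fun _ => id
  nlinarith

/-! ### Computing the set of congested vertices -/

/-- The set `C` of congested vertices is closed under marking: no vertex outside `C` is incident
to more than `d / 50` arcs of `U`, or joined to `C` by more than `d / 50` arcs of `E`. -/
def IsClosedUnder {n : ℕ} (E U : Fin n → Fin n → Prop) (d : ℕ) (C : Finset (Fin n)) : Prop :=
  ∀ v ∉ C, 50 * arcCount U Finset.univ v ≤ d ∧ 50 * arcCount E C v ≤ d

theorem outCount_mono {n : ℕ} (R : Fin n → Fin n → Prop) {S T : Finset (Fin n)} (h : S ⊆ T)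
    (v : Fin n) : outCount R S v ≤ outCount R T v := by
  classical exact Finset.card_le_card (Finset.filter_subset_filter _ h)

theorem inCount_mono {n : ℕ} (R : Fin n → Fin n → Prop) {S T : Finset (Fin n)} (h : S ⊆ T)
    (v : Fin n) : inCount R S v ≤ inCount R T v := by
  classical exact Finset.card_le_card (Finset.filter_subset_filter _ h)

theorem arcCount_mono {n : ℕ} (R : Fin n → Fin n → Prop) {S T : Finset (Fin n)} (h : S ⊆ T)
    (v : Fin n) : arcCount R S v ≤ arcCount R T v :=
  add_le_add (outCount_mono R h v) (inCount_mono R h v)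

/-- Put the vertex in variable `10` into the set in array `8`, and record the change. -/
def mark : Prog := .seq (.write 8 (.var 10) (.lit 1)) (.assign 16 (.lit 1))

/-- The test whether `c` times variable `14` exceeds the degree. -/
def exceeds (c : ℕ) : Term := .op .lt (.var 1) (.op .mul (.lit c) (.var 14))

theorem exceeds_eval {W c d : ℕ} {s : Store} (hd : s.var 1 = d) (hW : 1 < W) (hc : c < W)
    (h : c * s.var 14 < W) : (exceeds c).eval W s ≠ 0 ↔ d < c * s.var 14 := by
  by_cases hlt : d < c * s.var 14 <;>
    simp (disch := omega) [exceeds, Term.eval, Op.apply, Nat.mod_eq_of_lt, hd, hlt]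

/-- Mark the vertex in variable `10` if it meets too many arcs that are in use or that lead to
marked vertices. -/
def closureStep : Prog :=
  .cond (.cell 8 (.var 10)) .skip
    (.seq (countArcs 4 (.lit 1)) (.cond (exceeds 50) mark
      (.seq (countArcs 3 (.cell 8 (.var 11))) (.cond (exceeds 50) mark .skip))))

/-- Compute in array `8` the least set that is closed under marking, for the arcs in array `3` and
the used arcs in array `4`. -/
def computeClosure : Prog :=
  .seq (Prog.forUp 10 0 (.write 8 (.var 10) (.lit 0))) (closureStep.sweep 16 10 0)

/-- Marking starts from the empty set, so it stays inside every closed set `C`. -/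
theorem computeClosure_runs {W n d : ℕ} {s : Store} (hW : 1000 * (n * n + 1) ≤ W)
    (h0 : s.var 0 = n) (h1 : s.var 1 = d) (C : Finset (Fin n))
    (hC : IsClosedUnder (matOf n (s.arr 3)) (matOf n (s.arr 4)) d C) :
    Runs W computeClosure s (1000 * (n + 3) ^ 3) (fun s' => setOf n (s'.arr 8) ⊆ C ∧
      IsClosedUnder (matOf n (s.arr 3)) (matOf n (s.arr 4)) d (setOf n (s'.arr 8))) := by
  have hnn : n ≤ n * n := Nat.le_mul_self n
  have hW1 : 1 < W := by omega
  set E := matOf n (s.arr 3) with hE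
  set U := matOf n (s.arr 4) with hU
  have hmain : Runs W computeClosure s ((n + 1) * (3 + 10) +
      ((n + 3) * ((n + 1) * ((120 * (n + 1) + 60) + 10) + 4))) (fun s' => setOf n (s'.arr 8) ⊆ C ∧
      IsClosedUnder E U d (setOf n (s'.arr 8))) := by
    refine Runs.seq (Runs.forUp (T := 3) (fun k s' => ∀ j < k, s'.arr 8 j = 0) h0 (by omega)
      (by decide) (by simp [Prog.ModVar]) (by simp [Prog.ModVar]) (by simp)
      (fun _ _ _ h => h) ?_) ?_
    · intro k s' _ hk _ hI
      refine (Runs.of_wp ?_).mono (T := _) (T' := 3) (by simp [Prog.time, Term.cost]) fun _ => id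
      simp only [wp, Term.eval, hk, Store.setCell_arr, if_true, Nat.zero_mod]
      intro j hj
      rcases Nat.lt_succ_iff_lt_or_eq.1 hj with h | rfl
      · rw [Function.update_apply, hI j h, ite_self]
      · simp
    rintro s₁ ⟨hz, -⟩ hS
    have e1 : ∀ A, A ≠ 8 → s₁.arr A = s.arr A := fun A hA =>
      hS.2 A (by simpa [Prog.forUp, Prog.ModArr] using hA)
    have h0' : s₁.var 0 = n := by rw [hS.1 0 (by simp [Prog.forUp, Prog.ModVar]), h0]
    have h1' : s₁.var 1 = d := by rw [hS.1 1 (by simp [Prog.forUp, Prog.ModVar]), h1]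
    have hempty : setOf n (s₁.arr 8) = ∅ := by
      ext v
      simp [hz v v.2]
    let act : (ℕ → ℕ) → ℕ → Prop := fun a k => ∃ h : k < n, (⟨k, h⟩ : Fin n) ∉ setOf n a ∧
      (d < 50 * arcCount U Finset.univ ⟨k, h⟩ ∨ d < 50 * arcCount E (setOf n a) ⟨k, h⟩)
    refine ((Runs.sweep (W := W) (N := n) (T := 120 * (n + 1) + 60) (fun a => a 8)
      (fun a => setOf n a ⊆ C) act (fun a => n - (setOf n a).card) h0' (by omega) hW1 (by decide)
      (by decide) (by decide) ?_ ?_ ?_ ?_)).mono ?_ ?_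
    · simp [closureStep, countArcs, Prog.forUp, setIdx, incr, mark, Prog.ModVar]
    · simp [closureStep, countArcs, Prog.forUp, setIdx, incr, mark, Prog.ModVar]
    · simp [hempty]
    · intro k s₂ hk hxk hS₂ hΦ
      have hv0 : s₂.var 0 = n := by
        rw [hS₂.1 0 (by simp [Prog.sweep, closureStep, countArcs, Prog.forUp, setIdx, incr, mark,
          Prog.ModVar]), h0']
      have hv1 : s₂.var 1 = d := by
        rw [hS₂.1 1 (by simp [Prog.sweep, closureStep, countArcs, Prog.forUp, setIdx, incr, mark,
          Prog.ModVar]), h1']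
      have ha : ∀ A, A ≠ 8 → s₂.arr A = s.arr A := fun A hA => by
        rw [hS₂.2 A (by simpa [Prog.sweep, closureStep, countArcs, Prog.forUp, setIdx, incr, mark,
          Prog.ModArr] using hA), e1 A hA]
      let v : Fin n := ⟨k, hk⟩
      -- the effect of marking, for a vertex that may be marked
      have hmark : ∀ s₃ : Store, s₃.var 10 = k → s₃.arr = s₂.arr → v ∉ setOf n (s₂.arr 8) →
          (d < 50 * arcCount U Finset.univ v ∨ d < 50 * arcCount E (setOf n (s₂.arr 8)) v) →
          Runs W mark s₃ 5 (fun s'' => (s''.arr 8 = s₂.arr 8 ∧ ¬ act (s₂.arr 8) k ∧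
              s''.var 16 = s₂.var 16) ∨ (setOf n (s''.arr 8) ⊆ C ∧
              n - (setOf n (s''.arr 8)).card < n - (setOf n (s₂.arr 8)).card ∧
              s''.var 16 = 1)) := by
        intro s₃ hk₃ ha₃ hv hact
        refine (Runs.of_wp ?_).mono (T := _) (T' := 5) (by simp [mark, Prog.time, Term.cost])
          fun _ => id
        simp only [mark, wp, Term.eval, Nat.mod_eq_of_lt hW1, hk₃]
        right
        have hnew : setOf n (((s₃.setCell 8 k 1).setVar 16 1).arr 8) =
            insert v (setOf n (s₂.arr 8)) := by
          ext w
          simp only [Store.setVar_arr, Store.setCell_arr, if_true, ha₃]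
          rw [show k = (v : ℕ) from rfl, setOf_update, Finset.mem_insert]
          split_ifs with hw <;> simp [hw]
        rw [hnew]
        have hsub : insert v (setOf n (s₂.arr 8)) ⊆ C := by
          refine Finset.insert_subset ?_ hΦ
          by_contra hvC
          obtain ⟨g1, g2⟩ := hC v hvC
          have g3 := arcCount_mono E hΦ v
          omega
        have hcard : (insert v (setOf n (s₂.arr 8))).card ≤ n :=
          (Finset.card_le_univ _).trans (by simp)
        rw [Finset.card_insert_of_notMem hv] at hcard ⊢
        exact ⟨hsub, by omega, by simp⟩
      have hmem : v ∈ setOf n (s₂.arr 8) ↔ s₂.arr 8 k ≠ 0 := by simp [v]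
      refine (Runs.cond (T := (n + 1) * 51 + (6 + ((n + 1) * 52 + (6 + 5)))) (fun h => ?_)
        (fun h => ?_)).mono (by simp [Term.cost]; omega) fun _ => id
      · refine ⟨1, _, .skip _, by omega, Or.inl ⟨rfl, ?_, rfl⟩⟩
        rintro ⟨_, h', -⟩
        exact h' (hmem.2 (by simpa [Term.eval, hxk] using h))
      have hv : v ∉ setOf n (s₂.arr 8) := by
        rw [hmem]
        simpa [Term.eval, hxk] using h
      refine Runs.seq ((countArcs_runs (R := 4) (e := .lit 1) Finset.univ v hW hv0 (by simp [hxk, v])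
        ?_).mono (by simp [Term.cost]) fun _ => id) ?_
      · intro s' w _ _
        simp [Term.eval, Nat.mod_eq_of_lt hW1]
      intro s₃ hcnt hS₃
      rw [ha 4 (by decide), ← hU] at hcnt
      have ha₃ : s₃.arr = s₂.arr := funext fun A => hS₃.2 A (by
        simp [countArcs, Prog.forUp, setIdx, incr, Prog.ModArr])
      have hu₃ : ∀ x, x ≠ 11 → x ≠ 12 → x ≠ 13 → x ≠ 14 → s₃.var x = s₂.var x := fun x _ _ _ _ =>
        hS₃.1 x (by simp [countArcs, Prog.forUp, setIdx, incr, Prog.ModVar]; tauto)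
      have hle₃ := arcCount_le U Finset.univ v
      have hex₃ : (exceeds 50).eval W s₃ ≠ 0 ↔ d < 50 * arcCount U Finset.univ v := by
        rw [← hcnt]
        exact exceeds_eval (by rw [hu₃ 1 (by decide) (by decide) (by decide) (by decide), hv1])
          (by omega) (by omega) (by omega)
      refine (Runs.cond (T := (n + 1) * 52 + (6 + 5)) (fun h => ?_) (fun h => ?_)).mono
        (by simp [exceeds, Term.cost]) fun _ => id
      · exact (hmark s₃ (by rw [hu₃ 10 (by decide) (by decide) (by decide) (by decide), hxk]) ha₃ hv
          (Or.inl (hex₃.1 h))).mono (by omega) fun _ => id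
      refine Runs.seq ((countArcs_runs (R := 3) (e := .cell 8 (.var 11)) (setOf n (s₂.arr 8)) v hW
        (by rw [hu₃ 0 (by decide) (by decide) (by decide) (by decide), hv0])
        (by rw [hu₃ 10 (by decide) (by decide) (by decide) (by decide), hxk])
        ?_).mono (by simp [Term.cost]) fun _ => id) ?_
      · intro s' w hw hs'
        simp [Term.eval, hw, hs', ha₃]
      intro s₄ hcnt₄ hS₄
      rw [ha₃, ha 3 (by decide), ← hE] at hcnt₄
      have ha₄ : s₄.arr = s₂.arr := (funext fun A => hS₄.2 A (by
        simp [countArcs, Prog.forUp, setIdx, incr, Prog.ModArr])).trans ha₃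
      have hu₄ : ∀ x, x ≠ 11 → x ≠ 12 → x ≠ 13 → x ≠ 14 → s₄.var x = s₂.var x :=
        fun x q1 q2 q3 q4 => (hS₄.1 x (by
          simp [countArcs, Prog.forUp, setIdx, incr, Prog.ModVar]; tauto)).trans (hu₃ x q1 q2 q3 q4)
      have hle₄ := arcCount_le E (setOf n (s₂.arr 8)) v
      have hex₄ : (exceeds 50).eval W s₄ ≠ 0 ↔ d < 50 * arcCount E (setOf n (s₂.arr 8)) v := by
        rw [← hcnt₄]
        exact exceeds_eval (by rw [hu₄ 1 (by decide) (by decide) (by decide) (by decide), hv1])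
          (by omega) (by omega) (by omega)
      refine (Runs.cond (T := 5) (fun h => ?_) (fun h => ?_)).mono
        (by simp [exceeds, Term.cost]) fun _ => id
      · exact hmark s₄ (by rw [hu₄ 10 (by decide) (by decide) (by decide) (by decide), hxk]) ha₄ hv
          (Or.inr (hex₄.1 h))
      · refine ⟨1, _, .skip _, by omega, Or.inl ⟨by rw [ha₄], ?_,
          hu₄ 16 (by decide) (by decide) (by decide) (by decide)⟩⟩
        rintro ⟨_, -, h' | h'⟩
        · exact hex₃.2 h' ‹_›
        · exact hex₄.2 h' h
    · have : n - (setOf n (s₁.arr 8)).card ≤ n := Nat.sub_le _ _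
      exact Nat.mul_le_mul_right _ (by omega)
    · rintro s₂ ⟨hΦ, hact, -⟩
      refine ⟨hΦ, fun v hv => ?_⟩
      have := hact v v.2
      simp only [act, not_exists, not_and, not_or, not_lt] at this
      exact this v.2 hv
  refine hmain.mono ?_ fun _ => id
  ring_nf
  nlinarith [Nat.zero_le (n ^ 2), Nat.zero_le (n ^ 3)]

/-! ### Reserving edges -/

/-- The result of reserving for `v` the unused out-arcs `(v, w)` with `w` outside `T`. -/
def reserveOut {n : ℕ} (E U : Fin n → Fin n → Prop) (T : Finset (Fin n)) (v : Fin n)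
    (O : Fin n → Fin n → Prop) (u w : Fin n) : Prop :=
  O u w ∨ (u = v ∧ w ∉ T ∧ ¬ U v w ∧ E v w)

/-- The result of reserving for `v` the unused in-arcs `(w, v)` with `w` outside `T`. -/
def reserveIn {n : ℕ} (E U : Fin n → Fin n → Prop) (T : Finset (Fin n)) (v : Fin n)
    (J : Fin n → Fin n → Prop) (w u : Fin n) : Prop :=
  J w u ∨ (u = v ∧ w ∉ T ∧ ¬ U w v ∧ E w v)

/-- Restrict the set `X` (array `7`) and the reservations (arrays `5`, `6`) to the set in array `8`,
whose other elements are put into array `9`. -/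
def prepare : Prog :=
  Prog.forUp 10 0 (.cond (.cell 8 (.var 10))
    (.cond (.cell 7 (.var 10)) (.write 9 (.var 10) (.lit 0)) (.write 9 (.var 10) (.lit 1)))
    (.seq (.seq (.write 7 (.var 10) (.lit 0)) (.write 9 (.var 10) (.lit 0)))
      (Prog.forUp 11 0 (.seq setIdx
        (.seq (.write 5 (.var 12) (.lit 0)) (.write 6 (.var 13) (.lit 0)))))))

/-- The effect of `prepare` when the vertices below `k` have been treated. -/
structure Prepared (n k : ℕ) (a b : ℕ → ℕ → ℕ) : Prop where
  set7 : ∀ v : Fin n, v ∈ setOf n (b 7) ↔ v ∈ setOf n (a 7) ∧ ((v : ℕ) < k → v ∈ setOf n (a 8))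
  set9 : ∀ v : Fin n, (v : ℕ) < k →
    (v ∈ setOf n (b 9) ↔ v ∈ setOf n (a 8) ∧ v ∉ setOf n (a 7))
  mat5 : ∀ u v : Fin n, matOf n (b 5) u v ↔
    matOf n (a 5) u v ∧ ((u : ℕ) < k → u ∈ setOf n (a 8))
  mat6 : ∀ u v : Fin n, matOf n (b 6) u v ↔
    matOf n (a 6) u v ∧ ((v : ℕ) < k → v ∈ setOf n (a 8))

theorem prepare_runs {W n : ℕ} {s : Store} (hW : 1000 * (n * n + 1) ≤ W) (h0 : s.var 0 = n) :
    Runs W prepare s (1000 * (n + 3) ^ 3) (fun s' => Prepared n n s.arr s'.arr) := by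
  have hnn : n ≤ n * n := Nat.le_mul_self n
  have hW1 : 1 < W := by omega
  refine (Runs.forUp (N := n) (T := 50 * (n + 1) + 50)
    (fun k s' => Prepared n k s.arr s'.arr) h0 (by omega) (by decide)
    (by simp [Prog.forUp, Prog.ModVar, setIdx]) (by simp [Prog.forUp, Prog.ModVar, setIdx])
    ?_ (fun _ _ _ h => h) ?_).mono ?_ fun _ h => h.1
  · exact ⟨by simp, by simp, by simp, by simp⟩
  · intro k s₁ hk hxk hS hI
    let v : Fin n := ⟨k, hk⟩
    have ha8 : s₁.arr 8 = s.arr 8 := hS.2 8 (by simp [Prog.forUp, Prog.ModArr, setIdx])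
    have h0' : s₁.var 0 = n := by
      rw [hS.1 0 (by simp [Prog.forUp, Prog.ModVar, setIdx]), h0]
    have hlt : ∀ w : Fin n, (w : ℕ) < k + 1 ↔ (w : ℕ) < k ∨ w = v := by
      intro w
      simp only [v, Fin.ext_iff]
      omega
    have hvk : ¬ (v : ℕ) < k := by simp [v]
    have h7 := hI.set7 v
    simp only [hvk, false_imp_iff, and_true] at h7
    refine (Runs.cond (T := 50 * (n + 1) + 40) (fun h => ?_) (fun h => ?_)).mono
      (by simp only [Term.cost]; omega) fun _ => id
    · have h8 : v ∈ setOf n (s.arr 8) := by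
        simpa [Term.eval, hxk, ha8] using h
      refine (Runs.of_wp ?_).mono (T := _) (T' := 50 * (n + 1) + 40)
        (by simp [Prog.time, Term.cost]) fun _ => id
      have key : ∀ x, (x ≠ 0 ↔ v ∉ setOf n (s.arr 7)) → Prepared n (k + 1) s.arr
          (s₁.setCell 9 k x).arr := by
        intro x hx
        constructor
        · intro w
          rw [show (s₁.setCell 9 k x).arr 7 = s₁.arr 7 by simp, hI.set7, hlt]
          by_cases hw : w = v
          · simp only [hw, hvk, h8, imp_true_iff]
          · simp only [hw, or_false]
        · intro w hw
          simp only [Store.setCell_arr, if_true]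
          rw [show k = (v : ℕ) from rfl, setOf_update]
          split_ifs with hwv
          · rw [hwv, hx]
            tauto
          · exact hI.set9 w (((hlt w).1 hw).resolve_right hwv)
        · intro u w
          rw [show (s₁.setCell 9 k x).arr 5 = s₁.arr 5 by simp, hI.mat5, hlt]
          by_cases hw : u = v
          · simp only [hw, hvk, h8, imp_true_iff]
          · simp only [hw, or_false]
        · intro u w
          rw [show (s₁.setCell 9 k x).arr 6 = s₁.arr 6 by simp, hI.mat6, hlt]
          by_cases hw : w = v
          · simp only [hw, hvk, h8, imp_true_iff]
          · simp only [hw, or_false]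
      simp only [wp, Term.eval, hxk, Nat.mod_eq_of_lt hW1, Nat.zero_mod]
      refine ⟨fun h => key 0 ?_, fun h => key 1 ?_⟩
      · rw [← h7]
        simpa [v] using h
      · rw [← h7]
        simpa [v] using h
    · have h8 : v ∉ setOf n (s.arr 8) := by
        simpa [Term.eval, hxk, ha8] using h
      refine (Runs.seq (T₁ := 6) (R := fun s₂ => s₂ = (s₁.setCell 7 k 0).setCell 9 k 0)
        ((Runs.of_wp ?_).mono (by simp [Prog.time, Term.cost]) fun _ => id) ?_).mono
        (T := 6 + (n + 1) * (24 + 10)) (by omega) fun _ => id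
      · simp [wp, Term.eval, hxk]
      rintro s₂ rfl -
      refine (Runs.forUp (N := n) (T := 24) (fun j s' =>
        (∀ u w : Fin n, matOf n (s'.arr 5) u w ↔ matOf n (s₁.arr 5) u w ∧
          ¬ (u = v ∧ (w : ℕ) < j)) ∧
        (∀ u w : Fin n, matOf n (s'.arr 6) u w ↔ matOf n (s₁.arr 6) u w ∧
          ¬ (w = v ∧ (u : ℕ) < j))) (by simpa using h0') (by omega) (by decide)
        (by simp [Prog.ModVar, setIdx]) (by simp [Prog.ModVar, setIdx])
        (by simp) (fun _ _ _ h => h) ?_).mono le_rfl ?_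
      · rintro j s₃ hj hxj hS₃ ⟨i1, i2⟩
        have h0₃ : s₃.var 0 = n := by
          rw [hS₃.1 0 (by simp [Prog.forUp, Prog.ModVar, setIdx])]
          simpa using h0'
        have hk₃ : s₃.var 10 = k := by
          rw [hS₃.1 10 (by simp [Prog.forUp, Prog.ModVar, setIdx])]
          simpa using hxk
        have b1 := index_lt hk hj
        have b2 := index_lt hj hk
        refine (Runs.of_wp ?_).mono (T := _) (T' := 24)
          (by simp [Prog.time, Term.cost, setIdx]) fun _ => id
        let w₀ : Fin n := ⟨j, hj⟩
        have hlt' : ∀ w : Fin n, (w : ℕ) < j + 1 ↔ (w : ℕ) < j ∨ w = w₀ := by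
          intro w
          simp only [w₀, Fin.ext_iff]
          omega
        simp (disch := omega) only [wp, setIdx, Term.eval, Op.apply, h0₃, hk₃, hxj,
          Nat.mod_eq_of_lt, Store.setVar_var, Store.setVar_arr, Store.setCell_var,
          Store.setCell_arr, Nat.reduceEqDiff, if_true, if_false]
        constructor
        · intro u w
          rw [show k * n + j = (v : ℕ) * n + (w₀ : ℕ) from rfl, matOf_update, i1, hlt']
          split_ifs with hc
          · simp [hc]
          · by_cases hw : w = w₀
            · have hu : u ≠ v := fun hu => hc ⟨hu, hw⟩
              simp only [hu, false_and]
            · simp only [hw, or_false]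
        · intro u w
          rw [show j * n + k = (w₀ : ℕ) * n + (v : ℕ) from rfl, matOf_update, i2, hlt']
          split_ifs with hc
          · simp [hc]
          · by_cases hw : u = w₀
            · have hu : w ≠ v := fun hu => hc ⟨hw, hu⟩
              simp only [hu, false_and]
            · simp only [hw, or_false]
      · rintro s₃ ⟨⟨i1, i2⟩, hS₃⟩
        have e7 : s₃.arr 7 = Function.update (s₁.arr 7) k 0 := by
          rw [hS₃.2 7 (by simp [Prog.forUp, Prog.ModArr, setIdx])]
          simp
        have e9 : s₃.arr 9 = Function.update (s₁.arr 9) k 0 := by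
          rw [hS₃.2 9 (by simp [Prog.forUp, Prog.ModArr, setIdx])]
          simp
        constructor
        · intro w
          rw [e7, show k = (v : ℕ) from rfl, setOf_update, hlt, hI.set7]
          split_ifs with hwv
          · simp [hwv, h8]
          · simp [hwv, v]
        · intro w hw
          rw [e9, show k = (v : ℕ) from rfl, setOf_update]
          split_ifs with hwv
          · simp [hwv, h8]
          · exact hI.set9 w (((hlt w).1 hw).resolve_right hwv)
        · intro u w
          rw [i1, hI.mat5, hlt]
          by_cases hu : u = v
          · simp [hu, h8]
          · simp [hu]
        · intro u w
          rw [i2, hI.mat6, hlt]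
          by_cases hu : w = v
          · simp [hu, h8]
          · simp [hu]
  · ring_nf
    nlinarith [Nat.zero_le (n ^ 2), Nat.zero_le (n ^ 3)]

/-- Reserve for the vertex in variable `10` its unused arcs to and from the vertices outside the
sets in arrays `7` and `9`. -/
def reserve : Prog :=
  Prog.forUp 11 0 (.cond (.cell 7 (.var 11)) .skip (.cond (.cell 9 (.var 11)) .skip
    (.seq setIdx (.seq
      (.cond (.cell 4 (.var 12)) .skip
        (.cond (.cell 3 (.var 12)) (.write 5 (.var 12) (.lit 1)) .skip))
      (.cond (.cell 4 (.var 13)) .skip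
        (.cond (.cell 3 (.var 13)) (.write 6 (.var 13) (.lit 1)) .skip))))))

theorem reserve_runs {W n : ℕ} {s : Store} (v : Fin n) (hW : 1000 * (n * n + 1) ≤ W)
    (h0 : s.var 0 = n) (hv : s.var 10 = (v : ℕ)) :
    Runs W reserve s (60 * (n + 1)) (fun s' =>
      matOf n (s'.arr 5) = reserveOut (matOf n (s.arr 3)) (matOf n (s.arr 4))
        (setOf n (s.arr 7) ∪ setOf n (s.arr 9)) v (matOf n (s.arr 5)) ∧
      matOf n (s'.arr 6) = reserveIn (matOf n (s.arr 3)) (matOf n (s.arr 4))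
        (setOf n (s.arr 7) ∪ setOf n (s.arr 9)) v (matOf n (s.arr 6))) := by
  have hnn : n ≤ n * n := Nat.le_mul_self n
  have hW1 : 1 < W := by omega
  set T := setOf n (s.arr 7) ∪ setOf n (s.arr 9) with hT
  set E := matOf n (s.arr 3) with hE
  set U := matOf n (s.arr 4) with hU
  refine (Runs.forUp (N := n) (T := 50) (fun j s' =>
    (∀ u w : Fin n, matOf n (s'.arr 5) u w ↔ matOf n (s.arr 5) u w ∨
      (u = v ∧ (w : ℕ) < j ∧ w ∉ T ∧ ¬ U v w ∧ E v w)) ∧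
    (∀ w u : Fin n, matOf n (s'.arr 6) w u ↔ matOf n (s.arr 6) w u ∨
      (u = v ∧ (w : ℕ) < j ∧ w ∉ T ∧ ¬ U w v ∧ E w v))) h0 (by omega) (by decide)
    (by simp [Prog.ModVar, setIdx]) (by simp [Prog.ModVar, setIdx])
    (by simp) (fun _ _ _ h => h) ?_).mono (by omega) ?_
  · rintro j s₃ hj hxj hS₃ ⟨i1, i2⟩
    have h0₃ : s₃.var 0 = n := by
      rw [hS₃.1 0 (by simp [Prog.forUp, Prog.ModVar, setIdx]), h0]
    have hk₃ : s₃.var 10 = (v : ℕ) := by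
      rw [hS₃.1 10 (by simp [Prog.forUp, Prog.ModVar, setIdx]), hv]
    have ha : ∀ A, A ≠ 5 → A ≠ 6 → s₃.arr A = s.arr A := fun A g1 g2 =>
      hS₃.2 A (by simp [Prog.forUp, Prog.ModArr, setIdx]; tauto)
    have b1 := index_lt v.2 hj
    have b2 := index_lt hj v.2
    refine (Runs.of_wp ?_).mono (T := _) (T' := 50)
      (by simp [Prog.time, Term.cost, setIdx]) fun _ => id
    let w₀ : Fin n := ⟨j, hj⟩
    have hlt' : ∀ w : Fin n, (w : ℕ) < j + 1 ↔ (w : ℕ) < j ∨ w = w₀ := by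
      intro w
      simp only [w₀, Fin.ext_iff]
      omega
    have hw₀ : (w₀ : ℕ) = j := rfl
    have hT₀ : w₀ ∉ T ↔ s.arr 7 j = 0 ∧ s.arr 9 j = 0 := by
      simp [hT, w₀]
    have hU5 : U v w₀ ↔ s.arr 4 (v * n + j) ≠ 0 := Iff.rfl
    have hU6 : U w₀ v ↔ s.arr 4 (j * n + v) ≠ 0 := Iff.rfl
    have hE5 : E v w₀ ↔ s.arr 3 (v * n + j) ≠ 0 := Iff.rfl
    have hE6 : E w₀ v ↔ s.arr 3 (j * n + v) ≠ 0 := Iff.rfl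
    clear_value w₀ T U E
    have keep5 : (s.arr 7 j ≠ 0 ∨ s.arr 9 j ≠ 0 ∨ s.arr 4 (v * n + j) ≠ 0 ∨ s.arr 3 (v * n + j) = 0) →
        ∀ u w : Fin n, matOf n (s₃.arr 5) u w ↔ matOf n (s.arr 5) u w ∨
          (u = v ∧ (w : ℕ) < j + 1 ∧ w ∉ T ∧ ¬ U v w ∧ E v w) := by
      intro hn u w
      rw [i1, hlt']
      by_cases hw : w = w₀
      · subst hw
        have h1 : ¬ (w : ℕ) < j := by simp [hw₀]
        have h2 : ¬ (w ∉ T ∧ ¬ U v w ∧ E v w) := by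
          rintro ⟨g1, g2, g3⟩
          rw [hT₀] at g1
          rw [hU5] at g2
          rw [hE5] at g3
          rcases hn with h | h | h | h
          exacts [h g1.1, h g1.2, g2 h, g3 h]
        simp only [h1, h2, and_false]
      · simp only [hw, or_false]
    have new5 : s.arr 7 j = 0 → s.arr 9 j = 0 → s.arr 4 (v * n + j) = 0 → s.arr 3 (v * n + j) ≠ 0 →
        ∀ u w : Fin n, matOf n (Function.update (s₃.arr 5) (v * n + j) 1) u w ↔
          matOf n (s.arr 5) u w ∨
          (u = v ∧ (w : ℕ) < j + 1 ∧ w ∉ T ∧ ¬ U v w ∧ E v w) := by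
      intro g1 g2 g3 g4 u w
      rw [show v * n + j = (v : ℕ) * n + (w₀ : ℕ) by rw [hw₀], matOf_update, i1, hlt']
      split_ifs with hc
      · rw [hc.1, hc.2]
        exact ⟨fun _ => Or.inr ⟨rfl, Or.inr rfl, hT₀.2 ⟨g1, g2⟩, fun h => hU5.1 h g3, hE5.2 g4⟩,
          fun _ => one_ne_zero⟩
      · by_cases hw : w = w₀
        · have hu : u ≠ v := fun hu => hc ⟨hu, hw⟩
          simp only [hu, false_and]
        · simp only [hw, or_false]
    have keep6 : (s.arr 7 j ≠ 0 ∨ s.arr 9 j ≠ 0 ∨ s.arr 4 (j * n + v) ≠ 0 ∨ s.arr 3 (j * n + v) = 0) →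
        ∀ w u : Fin n, matOf n (s₃.arr 6) w u ↔ matOf n (s.arr 6) w u ∨
          (u = v ∧ (w : ℕ) < j + 1 ∧ w ∉ T ∧ ¬ U w v ∧ E w v) := by
      intro hn w u
      rw [i2, hlt']
      by_cases hw : w = w₀
      · subst hw
        have h1 : ¬ (w : ℕ) < j := by simp [hw₀]
        have h2 : ¬ (w ∉ T ∧ ¬ U w v ∧ E w v) := by
          rintro ⟨g1, g2, g3⟩
          rw [hT₀] at g1
          rw [hU6] at g2
          rw [hE6] at g3
          rcases hn with h | h | h | h
          exacts [h g1.1, h g1.2, g2 h, g3 h]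
        simp only [h1, h2, and_false]
      · simp only [hw, or_false]
    have new6 : s.arr 7 j = 0 → s.arr 9 j = 0 → s.arr 4 (j * n + v) = 0 → s.arr 3 (j * n + v) ≠ 0 →
        ∀ w u : Fin n, matOf n (Function.update (s₃.arr 6) (j * n + v) 1) w u ↔
          matOf n (s.arr 6) w u ∨
          (u = v ∧ (w : ℕ) < j + 1 ∧ w ∉ T ∧ ¬ U w v ∧ E w v) := by
      intro g1 g2 g3 g4 w u
      rw [show j * n + v = (w₀ : ℕ) * n + (v : ℕ) by rw [hw₀], matOf_update, i2, hlt']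
      split_ifs with hc
      · rw [hc.1, hc.2]
        exact ⟨fun _ => Or.inr ⟨rfl, Or.inr rfl, hT₀.2 ⟨g1, g2⟩, fun h => hU6.1 h g3, hE6.2 g4⟩,
          fun _ => one_ne_zero⟩
      · by_cases hw : w = w₀
        · have hu : u ≠ v := fun hu => hc ⟨hw, hu⟩
          simp only [hu, false_and]
        · simp only [hw, or_false]
    simp (disch := omega) only [wp, setIdx, Term.eval, Op.apply, h0₃, hk₃, hxj,
      Nat.mod_eq_of_lt, Store.setVar_var, Store.setVar_arr, Store.setCell_var,
      Store.setCell_arr, Nat.reduceEqDiff, if_true, if_false,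
      ha 7 (by decide) (by decide), ha 9 (by decide) (by decide),
      ha 3 (by decide) (by decide), ha 4 (by decide) (by decide)]
    refine ⟨fun h => ⟨keep5 (.inl h), keep6 (.inl h)⟩, fun h7 =>
      ⟨fun h => ⟨keep5 (.inr (.inl h)), keep6 (.inr (.inl h))⟩, fun h9 =>
      ⟨fun h => ⟨fun h' => ⟨keep5 (.inr (.inr (.inl h))), keep6 (.inr (.inr (.inl h')))⟩, fun h' =>
        ⟨fun h'' => ⟨keep5 (.inr (.inr (.inl h))), new6 h7 h9 h' h''⟩,
          fun h'' => ⟨keep5 (.inr (.inr (.inl h))), keep6 (.inr (.inr (.inr h'')))⟩⟩⟩, fun hu =>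
      ⟨fun he => ⟨fun h => ⟨new5 h7 h9 hu he, keep6 (.inr (.inr (.inl h)))⟩, fun h' =>
        ⟨fun h => ⟨new5 h7 h9 hu he, new6 h7 h9 h' h⟩,
          fun h => ⟨new5 h7 h9 hu he, keep6 (.inr (.inr (.inr h)))⟩⟩⟩,
      fun he => ⟨fun h => ⟨keep5 (.inr (.inr (.inr he))), keep6 (.inr (.inr (.inl h)))⟩, fun h' =>
        ⟨fun h => ⟨keep5 (.inr (.inr (.inr he))), new6 h7 h9 h' h⟩,
          fun h => ⟨keep5 (.inr (.inr (.inr he))), keep6 (.inr (.inr (.inr h)))⟩⟩⟩⟩⟩⟩⟩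
  · rintro s' ⟨⟨i1, i2⟩, -⟩
    constructor
    · funext u w
      refine propext ((i1 u w).trans ?_)
      simp [reserveOut]
    · funext w u
      refine propext ((i2 w u).trans ?_)
      simp [reserveIn]

/-- Let the vertex in variable `10` reserve its arcs, if it belongs to the set in array `9` and
meets few arcs inside that set; then take it out of the set, and record the change. -/
def peelStep : Prog :=
  .cond (.cell 9 (.var 10))
    (.seq (countArcs 3 (.cell 9 (.var 11))) (.cond (exceeds 250) .skip
      (.seq reserve (.seq (.write 9 (.var 10) (.lit 0)) (.assign 16 (.lit 1)))))) .skip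

/-- The peeling procedure preserves every property `Φ` of the pending set and the reservations that
is preserved by letting one vertex with few arcs inside the pending set make its reservations. -/
theorem peel_runs {W n d : ℕ} {s : Store} (hW : 1000 * (n * n + 1) ≤ W)
    (h0 : s.var 0 = n) (h1 : s.var 1 = d)
    (Φ : Finset (Fin n) → (Fin n → Fin n → Prop) → (Fin n → Fin n → Prop) → Prop)
    (hΦ : ∀ Z O J v, Φ Z O J → v ∈ Z → 250 * arcCount (matOf n (s.arr 3)) Z v ≤ d →
      Φ (Z.erase v)
        (reserveOut (matOf n (s.arr 3)) (matOf n (s.arr 4)) (setOf n (s.arr 7) ∪ Z) v O)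
        (reserveIn (matOf n (s.arr 3)) (matOf n (s.arr 4)) (setOf n (s.arr 7) ∪ Z) v J))
    (h₀ : Φ (setOf n (s.arr 9)) (matOf n (s.arr 5)) (matOf n (s.arr 6))) :
    Runs W (peelStep.sweep 16 10 0) s (1000 * (n + 3) ^ 3) (fun s' =>
      Φ (setOf n (s'.arr 9)) (matOf n (s'.arr 5)) (matOf n (s'.arr 6)) ∧
      ∀ v ∈ setOf n (s'.arr 9), d < 250 * arcCount (matOf n (s.arr 3)) (setOf n (s'.arr 9)) v) := by
  have hnn : n ≤ n * n := Nat.le_mul_self n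
  have hW1 : 1 < W := by omega
  set E := matOf n (s.arr 3) with hE
  set U := matOf n (s.arr 4) with hU
  set X := setOf n (s.arr 7) with hX
  let act : (ℕ → ℕ → ℕ) → ℕ → Prop := fun a k => ∃ h : k < n, (⟨k, h⟩ : Fin n) ∈ setOf n (a 9) ∧
    250 * arcCount E (setOf n (a 9)) ⟨k, h⟩ ≤ d
  have hmain := Runs.sweep (W := W) (N := n) (c := 16) (x := 10) (y := 0) (p := peelStep) (s := s)
    (T := 112 * (n + 1) + 40) (fun a => a)
    (fun a => Φ (setOf n (a 9)) (matOf n (a 5)) (matOf n (a 6))) act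
    (fun a => (setOf n (a 9)).card) h0 (by omega) hW1 (by decide)
    (by decide) (by decide)
    (by simp [peelStep, reserve, countArcs, Prog.forUp, setIdx, incr, Prog.ModVar])
    (by simp [peelStep, reserve, countArcs, Prog.forUp, setIdx, incr, Prog.ModVar]) h₀ ?_
  · refine hmain.mono ?_ ?_
    · have : (setOf n (s.arr 9)).card ≤ n := (Finset.card_le_univ _).trans (by simp)
      refine (Nat.mul_le_mul_right _ (Nat.add_le_add_right this 3)).trans ?_
      ring_nf
      nlinarith [Nat.zero_le (n ^ 2), Nat.zero_le (n ^ 3)]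
    · rintro s₂ ⟨hΦ, hact, -⟩
      refine ⟨hΦ, fun v hv => ?_⟩
      have := hact v v.2
      simp only [act, not_exists, not_and, not_le] at this
      exact this v.2 hv
  intro k s₂ hk hxk hS₂ hI
  let v : Fin n := ⟨k, hk⟩
  have hv0 : s₂.var 0 = n := by
    rw [hS₂.1 0 (by simp [Prog.sweep, peelStep, reserve, countArcs, Prog.forUp, setIdx, incr,
      Prog.ModVar]), h0]
  have hv1 : s₂.var 1 = d := by
    rw [hS₂.1 1 (by simp [Prog.sweep, peelStep, reserve, countArcs, Prog.forUp, setIdx, incr,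
      Prog.ModVar]), h1]
  have ha : ∀ A, A ≠ 9 → A ≠ 5 → A ≠ 6 → s₂.arr A = s.arr A := fun A q1 q2 q3 => by
    refine hS₂.2 A ?_
    simp [Prog.sweep, peelStep, reserve, countArcs, Prog.forUp, setIdx, incr, Prog.ModArr]
    tauto
  have hmem : v ∈ setOf n (s₂.arr 9) ↔ s₂.arr 9 k ≠ 0 := by simp [v]
  refine (Runs.cond (T := (n + 1) * 52 + (6 + (60 * (n + 1) + 5))) (fun h => ?_)
    (fun h => ?_)).mono (by simp only [Term.cost]; omega) fun _ => id
  · have hv : v ∈ setOf n (s₂.arr 9) := by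
      rw [hmem]
      simpa [Term.eval, hxk] using h
    refine Runs.seq ((countArcs_runs (R := 3) (e := .cell 9 (.var 11)) (setOf n (s₂.arr 9)) v hW
      hv0 (by rw [hxk]) ?_).mono (by simp [Term.cost]) fun _ => id) ?_
    · intro s' w hw hs'
      simp [Term.eval, hw, hs']
    intro s₃ hcnt hS₃
    rw [ha 3 (by decide) (by decide) (by decide), ← hE] at hcnt
    have ha₃ : s₃.arr = s₂.arr := funext fun A => hS₃.2 A (by
      simp [countArcs, Prog.forUp, setIdx, incr, Prog.ModArr])
    have hu₃ : ∀ x, x ≠ 11 → x ≠ 12 → x ≠ 13 → x ≠ 14 → s₃.var x = s₂.var x := fun x _ _ _ _ =>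
      hS₃.1 x (by simp [countArcs, Prog.forUp, setIdx, incr, Prog.ModVar]; tauto)
    have hle₃ := arcCount_le E (setOf n (s₂.arr 9)) v
    have hex₃ : (exceeds 250).eval W s₃ ≠ 0 ↔ d < 250 * arcCount E (setOf n (s₂.arr 9)) v := by
      rw [← hcnt]
      exact exceeds_eval (by rw [hu₃ 1 (by decide) (by decide) (by decide) (by decide), hv1])
        (by omega) (by omega) (by omega)
    refine (Runs.cond (T := 60 * (n + 1) + 5) (fun h => ?_) (fun h => ?_)).mono
      (by simp [exceeds, Term.cost]) fun _ => id
    · refine ⟨1, _, .skip _, by omega, Or.inl ⟨ha₃, ?_,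
        hu₃ 16 (by decide) (by decide) (by decide) (by decide)⟩⟩
      rintro ⟨_, _, h'⟩
      exact absurd (hex₃.1 h) (not_lt.2 h')
    · have hle : 250 * arcCount E (setOf n (s₂.arr 9)) v ≤ d := by
        by_contra hc
        exact hex₃.2 (not_le.1 hc) h
      refine Runs.seq (reserve_runs v hW
        (by rw [hu₃ 0 (by decide) (by decide) (by decide) (by decide), hv0])
        (by rw [hu₃ 10 (by decide) (by decide) (by decide) (by decide), hxk])) ?_
      rintro s₄ ⟨r5, r6⟩ hS₄
      simp only [ha₃, ha 3 (by decide) (by decide) (by decide), ← hE, ← hU, ← hX,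
        ha 4 (by decide) (by decide) (by decide), ha 7 (by decide) (by decide) (by decide)] at r5 r6
      have h9 : s₄.arr 9 = s₂.arr 9 := by
        rw [hS₄.2 9 (by simp [reserve, Prog.forUp, setIdx, Prog.ModArr]), ha₃]
      have h10 : s₄.var 10 = k := by
        rw [hS₄.1 10 (by simp [reserve, Prog.forUp, setIdx, Prog.ModVar]),
          hu₃ 10 (by decide) (by decide) (by decide) (by decide), hxk]
      refine (Runs.of_wp ?_).mono (T := _) (T' := 5) (by simp [Prog.time, Term.cost])
        fun _ => id
      simp only [wp, Term.eval, Nat.mod_eq_of_lt hW1, h10, Nat.zero_mod]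
      right
      have hnew : setOf n (((s₄.setCell 9 k 0).setVar 16 1).arr 9) =
          (setOf n (s₂.arr 9)).erase v := by
        ext w
        simp only [Store.setVar_arr, Store.setCell_arr, if_true, h9]
        rw [show k = (v : ℕ) from rfl, setOf_update, Finset.mem_erase]
        split_ifs with hw <;> simp [hw]
      rw [hnew]
      refine ⟨?_, Finset.card_erase_lt_of_mem hv, by simp⟩
      have := hΦ _ _ _ v hI hv hle
      rw [← r5, ← r6] at this
      simpa using this
  · refine ⟨1, _, .skip _, by omega, Or.inl ⟨rfl, ?_, rfl⟩⟩
    rintro ⟨_, h', -⟩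
    exact (hmem.1 h') (by simpa [Term.eval, hxk] using h)

/-- Replace the set in array `7` by the set in array `8`. -/
def copySet : Prog := Prog.forUp 10 0 (.write 7 (.var 10) (.cell 8 (.var 10)))

theorem copySet_runs {W n : ℕ} {s : Store} (hW : 1000 * (n * n + 1) ≤ W) (h0 : s.var 0 = n) :
    Runs W copySet s (20 * (n + 1)) (fun s' => setOf n (s'.arr 7) = setOf n (s.arr 8)) := by
  have hnn : n ≤ n * n := Nat.le_mul_self n
  refine (Runs.forUp (N := n) (T := 4) (fun k s' => ∀ j < k, s'.arr 7 j = s.arr 8 j) h0 (by omega)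
    (by decide) (by simp [Prog.ModVar]) (by simp [Prog.ModVar]) (by simp)
    (fun _ _ _ h => h) ?_).mono (by omega) ?_
  · intro k s' _ hk hS hI
    refine (Runs.of_wp ?_).mono (T := _) (T' := 4) (by simp [Prog.time, Term.cost]) fun _ => id
    have h8 : s'.arr 8 = s.arr 8 := hS.2 8 (by simp [Prog.forUp, Prog.ModArr])
    simp only [wp, Term.eval, hk, Store.setCell_arr, if_true, h8]
    intro j hj
    rw [Function.update_apply]
    split_ifs with h
    · rw [h]
    · exact hI j (by omega)
  · rintro s' ⟨h, -⟩
    ext v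
    simp [h v v.2]

/-- Build the adjacency matrix in array `3`. -/
def buildMatrix : Prog :=
  Prog.forUp 10 0 (Prog.forUp 11 1 (.write 3 (.op .add (.op .mul (.var 10) (.var 0))
    (.cell 0 (.op .add (.op .mul (.var 10) (.var 1)) (.var 11)))) (.lit 1)))

theorem buildMatrix_runs {W n d : ℕ} {s : Store} (hW : 1000 * (n * n + 1) ≤ W) (h0 : s.var 0 = n)
    (h1 : s.var 1 = d) (hd : d < n) (E : Fin n → Fin n → Prop) (N : Fin n → Fin d → Fin n)
    (hN : ∀ v w, E v w ↔ ∃ i, N v i = w)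
    (hs : ∀ (v : Fin n) (i : Fin d), s.arr 0 (v * d + i) = N v i)
    (hE : ∀ u v, matOf n (s.arr 3) u v → E u v) :
    Runs W buildMatrix s (100 * (n + 1) ^ 2) (fun s' => matOf n (s'.arr 3) = E) := by
  have hnn : n ≤ n * n := Nat.le_mul_self n
  have hW1 : 1 < W := by omega
  refine (Runs.forUp (N := n) (T := 40 * (n + 1)) (fun k s' => ∀ u w, matOf n (s'.arr 3) u w ↔
    matOf n (s.arr 3) u w ∨ ((u : ℕ) < k ∧ E u w)) h0 (by omega)
    (by decide) (by simp [Prog.forUp, Prog.ModVar]) (by simp [Prog.forUp, Prog.ModVar]) (by simp)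
    (fun _ _ _ h => h) ?_).mono (by nlinarith) ?_
  · intro k s₁ hk hxk hS hI
    let v : Fin n := ⟨k, hk⟩
    have h0' : s₁.var 0 = n := by rw [hS.1 0 (by simp [Prog.forUp, Prog.ModVar]), h0]
    have h1' : s₁.var 1 = d := by rw [hS.1 1 (by simp [Prog.forUp, Prog.ModVar]), h1]
    refine (Runs.forUp (N := d) (T := 20) (fun k s' => ∀ u w, matOf n (s'.arr 3) u w ↔
      matOf n (s₁.arr 3) u w ∨ (u = v ∧ ∃ i : Fin d, (i : ℕ) < k ∧ N v i = w)) h1' (by omega)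
      (by decide) (by simp [Prog.ModVar]) (by simp [Prog.ModVar]) (by simp)
      (fun _ _ _ h => h) ?_).mono (by nlinarith) ?_
    · intro j s₂ hj hxj hS₂ hI₂
      let i₀ : Fin d := ⟨j, hj⟩
      have h0₂ : s₂.var 0 = n := by rw [hS₂.1 0 (by simp [Prog.forUp, Prog.ModVar]), h0']
      have h1₂ : s₂.var 1 = d := by rw [hS₂.1 1 (by simp [Prog.forUp, Prog.ModVar]), h1']
      have h10 : s₂.var 10 = k := by rw [hS₂.1 10 (by simp [Prog.forUp, Prog.ModVar]), hxk]
      have harr : s₂.arr 0 = s.arr 0 := by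
        rw [hS₂.2 0 (by simp [Prog.forUp, Prog.ModArr]), hS.2 0 (by simp [Prog.forUp, Prog.ModArr])]
      have hval : s.arr 0 (k * d + j) = N v i₀ := hs v i₀
      have hb := index_lt hk (N v i₀).2
      have hb' : k * d + j < n * n := by nlinarith
      refine (Runs.of_wp ?_).mono (T := _) (T' := 20) (by simp [Prog.time, Term.cost]) fun _ => id
      simp (disch := omega) only [wp, Term.eval, Op.apply, h0₂, h1₂, h10, hxj, harr,
        Nat.mod_eq_of_lt, hval, Store.setCell_arr, if_true]
      intro u w
      rw [show k = (v : ℕ) from rfl, matOf_update, hI₂]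
      split_ifs with hc
      · simp only [ne_eq, one_ne_zero, not_false_eq_true, true_iff]
        exact Or.inr ⟨hc.1, i₀, by simp [i₀], hc.2.symm⟩
      · refine or_congr Iff.rfl (and_congr_right fun hu => ?_)
        constructor
        · rintro ⟨i, hi, h⟩
          exact ⟨i, by omega, h⟩
        · rintro ⟨i, hi, h⟩
          refine ⟨i, ?_, h⟩
          rcases Nat.lt_succ_iff_lt_or_eq.1 hi with h' | h'
          · exact h'
          · have : i = i₀ := Fin.ext h'
            exact absurd ⟨hu, by rw [← h, this]⟩ hc
    · rintro s₂ ⟨h, -⟩ u w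
      rw [h, hI]
      constructor
      · rintro ((h | h) | ⟨rfl, i, -, h⟩)
        · exact Or.inl h
        · exact Or.inr ⟨by omega, h.2⟩
        · exact Or.inr ⟨by simp [v], (hN _ _).2 ⟨i, h⟩⟩
      · rintro (h | ⟨h, h'⟩)
        · exact Or.inl (Or.inl h)
        · rcases Nat.lt_succ_iff_lt_or_eq.1 h with h | h
          · exact Or.inl (Or.inr ⟨h, h'⟩)
          · have : u = v := Fin.ext h
            obtain ⟨i, hi⟩ := (hN _ _).1 h'
            exact Or.inr ⟨this, i, i.2, this ▸ hi⟩
  · rintro s' ⟨h, -⟩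
    funext u w
    refine propext ((h u w).trans ?_)
    constructor
    · rintro (h | h)
      · exact hE _ _ h
      · exact h.2
    · exact fun h => Or.inr ⟨u.2, h⟩

/-! ### Breadth-first search -/

/-- The array index of a search state: a vertex together with a phase. -/
def stateIdx {n : ℕ} (x : Fin n × Bool) : ℕ := x.1 + if x.2 then n else 0

theorem stateIdx_lt {n : ℕ} (x : Fin n × Bool) : stateIdx x < 2 * n := by
  unfold stateIdx
  have := x.1.2
  split_ifs <;> omega

theorem stateIdx_inj {n : ℕ} {x y : Fin n × Bool} : stateIdx x = stateIdx y ↔ x = y := by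
  refine ⟨fun h => ?_, fun h => by rw [h]⟩
  obtain ⟨u, p⟩ := x
  obtain ⟨v, q⟩ := y
  have hu := u.2
  have hv := v.2
  unfold stateIdx at h
  cases p <;> cases q <;> simp [Prod.ext_iff, Fin.ext_iff] at h ⊢ <;> omega

/-- The function on states stored in an array. -/
def fnOf (n : ℕ) (a : ℕ → ℕ) (x : Fin n × Bool) : ℕ := a (stateIdx x)

theorem fnOf_update {n : ℕ} (a : ℕ → ℕ) (x y : Fin n × Bool) (c : ℕ) :
    fnOf n (Function.update a (stateIdx x) c) y = if y = x then c else fnOf n a y := by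
  simp [fnOf, Function.update_apply, stateIdx_inj]

/-- The transitions of the search. A move into phase `true` uses an arc of `L₁`, a move within
phase `false` uses an arc of `L₀`, and phase `true` is never left. -/
def Trans {n : ℕ} (L₀ L₁ : Fin n → Fin n → Prop) (x y : Fin n × Bool) : Prop :=
  if y.2 then L₁ x.1 y.1 else x.2 = false ∧ L₀ x.1 y.1

/-- The invariant of a backward search from `b` along the transitions `T`, in round `k`. The label
`D x` is one more than the number of transitions from `x` to `b`, or `0` if it is not known yet, and
`F x` is the index of the next state. Between rounds `m = 0`; during a round `m = 1`, as labels
`k + 1` are given out, and `P` holds for the transitions already looked at. -/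
structure SearchInv {n : ℕ} (T : Fin n × Bool → Fin n × Bool → Prop) (b : Fin n) (k m : ℕ)
    (P : Fin n × Bool → Fin n × Bool → Prop) (D F : Fin n × Bool → ℕ) : Prop where
  le : ∀ x, D x ≤ k + m
  one : ∀ x, D x = 1 ↔ x.1 = b
  next : ∀ x j, D x = j + 2 → ∃ y, F x = stateIdx y ∧ T x y ∧ D y = j + 1
  pred : ∀ x y, T x y → D y ≠ 0 → (D y < k ∨ (D y = k ∧ P x y)) → D x ≠ 0 ∧ D x ≤ D y + 1

theorem SearchInv.anti {n : ℕ} {T : Fin n × Bool → Fin n × Bool → Prop} {b : Fin n} {k m : ℕ}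
    {P Q : Fin n × Bool → Fin n × Bool → Prop} {D F : Fin n × Bool → ℕ}
    (h : SearchInv T b k m P D F) (hQ : ∀ x y, T x y → Q x y → P x y) :
    SearchInv T b k m Q D F :=
  ⟨h.le, h.one, h.next, fun x y hT hy hc =>
    h.pred x y hT hy (hc.imp id fun hc => ⟨hc.1, hQ _ _ hT hc.2⟩)⟩

theorem SearchInv.start {n : ℕ} {T : Fin n × Bool → Fin n × Bool → Prop} {b : Fin n} {k : ℕ}
    {P : Fin n × Bool → Fin n × Bool → Prop} {D F : Fin n × Bool → ℕ}
    (h : SearchInv T b k 0 P D F) : SearchInv T b k 1 P D F :=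
  ⟨fun x => (h.le x).trans (by omega), h.one, h.next, h.pred⟩

theorem SearchInv.finish {n : ℕ} {T : Fin n × Bool → Fin n × Bool → Prop} {b : Fin n} {k : ℕ}
    {D F : Fin n × Bool → ℕ} (h : SearchInv T b k 1 (fun _ _ => True) D F) :
    SearchInv T b (k + 1) 0 (fun _ _ => False) D F :=
  ⟨fun x => h.le x, h.one, h.next, fun x y hT hy hc => by
    refine h.pred x y hT hy ?_
    rcases hc with hc | hc
    · rcases Nat.lt_succ_iff_lt_or_eq.1 hc with h' | h'
      · exact Or.inl h'
      · exact Or.inr ⟨h', trivial⟩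
    · exact hc.2.elim⟩

/-- Looking at a transition `x → y` for which nothing has to be done. -/
theorem SearchInv.skip {n : ℕ} {T : Fin n × Bool → Fin n × Bool → Prop} {b : Fin n} {k : ℕ}
    {P : Fin n × Bool → Fin n × Bool → Prop} {D F : Fin n × Bool → ℕ}
    (h : SearchInv T b k 1 P D F) (x y : Fin n × Bool) (hxy : T x y → D x ≠ 0 ∨ D y ≠ k) :
    SearchInv T b k 1 (fun z w => P z w ∨ (z = x ∧ w = y)) D F := by
  refine ⟨h.le, h.one, h.next, fun z w hT hw hc => ?_⟩
  rcases hc with hc | ⟨hc, hP | ⟨rfl, rfl⟩⟩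
  · exact h.pred z w hT hw (Or.inl hc)
  · exact h.pred z w hT hw (Or.inr ⟨hc, hP⟩)
  · rcases hxy hT with h' | h'
    · exact ⟨h', by rw [hc]; exact h.le z⟩
    · exact absurd hc h'

/-- Looking at a transition `x → y` that reaches a new state `x`. -/
theorem SearchInv.set {n : ℕ} {T : Fin n × Bool → Fin n × Bool → Prop} {b : Fin n} {k : ℕ}
    {P : Fin n × Bool → Fin n × Bool → Prop} {D F : Fin n × Bool → ℕ}
    (h : SearchInv T b k 1 P D F) (hk : 1 ≤ k) (x y : Fin n × Bool) (hT : T x y) (hx : D x = 0)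
    (hy : D y = k) :
    SearchInv T b k 1 (fun z w => P z w ∨ (z = x ∧ w = y))
      (fun z => if z = x then k + 1 else D z) (fun z => if z = x then stateIdx y else F z) := by
  have hyx : y ≠ x := by
    rintro rfl
    omega
  refine ⟨fun z => ?_, fun z => ?_, fun z j hz => ?_, fun z w hzw hw hc => ?_⟩
  · split_ifs
    · exact le_rfl
    · exact h.le z
  · split_ifs with hz
    · subst hz
      have := h.one z
      constructor
      · omega
      · intro hb
        have := this.2 hb
        omega
    · exact h.one z
  · split_ifs at hz ⊢ with hzx
    · subst hzx
      exact ⟨y, rfl, hT, by rw [if_neg hyx]; omega⟩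
    · obtain ⟨w, h1, h2, h3⟩ := h.next z j hz
      refine ⟨w, h1, h2, ?_⟩
      rw [if_neg, h3]
      rintro rfl
      omega
  · by_cases hwx : w = x
    · rw [if_pos hwx] at hc
      omega
    · rw [if_neg hwx] at hw hc ⊢
      by_cases hzx : z = x
      · rw [if_pos hzx]
        refine ⟨by omega, ?_⟩
        rcases hc with hc | ⟨hc, -⟩
        · subst hzx
          exact absurd hx (h.pred z w hzw hw (Or.inl hc)).1
        · omega
      · rw [if_neg hzx]
        refine h.pred z w hzw hw (hc.imp id fun hc => ⟨hc.1, hc.2.resolve_right fun h' => ?_⟩)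
        exact hzx h'.1

/-- If the state whose index is in variable `x` has no label yet and the one whose index is in
variable `y` was labelled in the previous round, then label the former. -/
def tryStep (x y : ℕ) : Prog :=
  .cond (.cell 10 (.var x)) .skip (.cond (.op .eq (.cell 10 (.var y)) (.var 17))
    (.seq (.write 10 (.var x) (.op .add (.var 17) (.lit 1))) (.write 11 (.var x) (.var y))) .skip)

theorem tryStep_runs {W n k x y : ℕ} {s : Store} {T : Fin n × Bool → Fin n × Bool → Prop}
    {b : Fin n} {P : Fin n × Bool → Fin n × Bool → Prop} (X Y : Fin n × Bool)
    (hW : k + 1 < W) (hk : 1 ≤ k) (h17 : s.var 17 = k) (hx : s.var x = stateIdx X)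
    (hy : s.var y = stateIdx Y) (hT : T X Y)
    (hI : SearchInv T b k 1 P (fnOf n (s.arr 10)) (fnOf n (s.arr 11))) :
    Runs W (tryStep x y) s 20 (fun s' => SearchInv T b k 1 (fun z w => P z w ∨ (z = X ∧ w = Y))
      (fnOf n (s'.arr 10)) (fnOf n (s'.arr 11))) := by
  refine (Runs.of_wp ?_).mono (T := _) (T' := 20) (by simp [tryStep, Prog.time, Term.cost])
    fun _ => id
  have d1 : s.arr 10 (stateIdx X) = fnOf n (s.arr 10) X := rfl
  have d2 : s.arr 10 (stateIdx Y) = fnOf n (s.arr 10) Y := rfl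
  simp (disch := omega) only [tryStep, wp, Term.eval, Op.apply, hx, hy, h17, d1, d2,
    Nat.mod_eq_of_lt, Store.setCell_var, Store.setCell_arr, Nat.reduceEqDiff, if_true, if_false]
  refine ⟨fun h => hI.skip X Y fun _ => Or.inl h, fun h => ⟨fun h' => ?_, fun h' =>
    hI.skip X Y fun _ => Or.inr ?_⟩⟩
  · have h'' : fnOf n (s.arr 10) Y = k := by
      by_contra hc
      simp [hc] at h'
    have := hI.set hk X Y hT h h''
    have e1 : fnOf n (Function.update (s.arr 10) (stateIdx X) (k + 1)) =
        fun z => if z = X then k + 1 else fnOf n (s.arr 10) z := funext fun z => fnOf_update _ _ _ _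
    have e2 : fnOf n (Function.update (s.arr 11) (stateIdx X) (stateIdx Y)) =
        fun z => if z = X then stateIdx Y else fnOf n (s.arr 11) z :=
      funext fun z => fnOf_update _ _ _ _
    rw [e1, e2]
    exact this
  · rintro h''
    rw [if_pos h'', Nat.mod_eq_of_lt (by omega)] at h'
    exact one_ne_zero h'

/-- Look at the transitions from the vertex in variable `10` to the vertex in variable `11`. -/
def relax : Prog :=
  .seq setIdx (.seq (.assign 18 (.op .add (.var 10) (.var 0)))
    (.seq (.assign 19 (.op .add (.var 11) (.var 0)))
    (.cond (.cell 4 (.var 12)) .skip (.seq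
      (.cond (.cell 5 (.var 12)) (tryStep 10 11)
        (.cond (.cell 3 (.var 12))
          (.cond (.cell 7 (.var 10)) .skip (.cond (.cell 7 (.var 11)) .skip (tryStep 10 11))) .skip))
      (.cond (.cell 6 (.var 12)) (.seq (tryStep 10 19) (tryStep 18 19)) .skip)))))

/-- The arcs that the search uses in phase `false`: unused arcs that are reserved by their tail, or
that avoid the congested set `X`. -/
def forwardArc {n : ℕ} (E U O : Fin n → Fin n → Prop) (X : Finset (Fin n)) (u v : Fin n) : Prop :=
  ¬ U u v ∧ (O u v ∨ (E u v ∧ u ∉ X ∧ v ∉ X))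

/-- The arcs that the search uses to enter phase `true` or move within it: unused arcs that are
reserved by their head. -/
def backwardArc {n : ℕ} (U J : Fin n → Fin n → Prop) (u v : Fin n) : Prop := ¬ U u v ∧ J u v

/-- The transitions of the search that are allowed by the contents of the memory. -/
def storeTrans (n : ℕ) (a : ℕ → ℕ → ℕ) : Fin n × Bool → Fin n × Bool → Prop :=
  Trans (forwardArc (matOf n (a 3)) (matOf n (a 4)) (matOf n (a 5)) (setOf n (a 7)))
    (backwardArc (matOf n (a 4)) (matOf n (a 6)))

theorem relax_runs {W n k : ℕ} {s : Store} {b : Fin n}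
    {P : Fin n × Bool → Fin n × Bool → Prop} (u v : Fin n) (hW : 1000 * (n * n + 1) ≤ W)
    (hkW : k + 1 < W) (hk : 1 ≤ k) (h0 : s.var 0 = n) (h17 : s.var 17 = k)
    (h10 : s.var 10 = (u : ℕ)) (h11 : s.var 11 = (v : ℕ))
    (hI : SearchInv (storeTrans n s.arr) b k 1 P (fnOf n (s.arr 10)) (fnOf n (s.arr 11))) :
    Runs W relax s 120 (fun s' => SearchInv (storeTrans n s.arr) b k 1
      (fun z w => P z w ∨ (z.1 = u ∧ w.1 = v)) (fnOf n (s'.arr 10)) (fnOf n (s'.arr 11))) := by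
  have hnn : n ≤ n * n := Nat.le_mul_self n
  have hu := u.2
  have hv := v.2
  have b1 := index_lt hu hv
  have b2 := index_lt hv hu
  set T := storeTrans n s.arr with hT
  -- the three transitions along the arc `(u, v)`
  have hall : ∀ z w : Fin n × Bool, z.1 = u → w.1 = v → T z w →
      (z = (u, false) ∧ w = (v, false)) ∨ (z = (u, false) ∧ w = (v, true)) ∨
        (z = (u, true) ∧ w = (v, true)) := by
    rintro ⟨z, p⟩ ⟨w, q⟩ rfl rfl h
    cases p <;> cases q <;> simp_all [T, storeTrans, Trans]
  let s₁ : Store := (((s.setVar 12 (u * n + v)).setVar 13 (v * n + u)).setVar 18 (u + n)).setVar 19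
    (v + n)
  refine (Runs.seq (T₁ := 12) (R := fun s' => s' = ((s.setVar 12 (u * n + v)).setVar 13 (v * n + u)))
    ((Runs.of_wp ?_).mono (by simp [Prog.time, setIdx, Term.cost]) fun _ => id) ?_).mono
    (T := 12 + (4 + (4 + 100))) le_rfl fun _ => id
  · simp (disch := omega) [wp, setIdx, Term.eval, Op.apply, h0, h10, h11, Nat.mod_eq_of_lt]
  rintro _ rfl -
  refine Runs.seq (R := fun s' => s' =
    (((s.setVar 12 (u * n + v)).setVar 13 (v * n + u)).setVar 18 (u + n)))
    ⟨4, _, .assign _ _ _, le_rfl, ?_⟩ ?_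
  · simp (disch := omega) [Term.eval, Op.apply, h0, h10, Nat.mod_eq_of_lt]
  rintro _ rfl -
  refine Runs.seq (R := fun s' => s' = s₁) ⟨4, _, .assign _ _ _, le_rfl, ?_⟩ ?_
  · simp (disch := omega) [Term.eval, Op.apply, h0, h11, Nat.mod_eq_of_lt, s₁]
  rintro _ rfl -
  have ha : s₁.arr = s.arr := rfl
  have g10 : s₁.var 10 = stateIdx (u, false) := by simp [s₁, h10, stateIdx]
  have g11 : s₁.var 11 = stateIdx (v, false) := by simp [s₁, h11, stateIdx]
  have g18 : s₁.var 18 = stateIdx (u, true) := by simp [s₁, stateIdx]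
  have g19 : s₁.var 19 = stateIdx (v, true) := by simp [s₁, stateIdx]
  have g12 : s₁.var 12 = u * n + v := by simp [s₁]
  have g17 : s₁.var 17 = k := by simp [s₁, h17]
  have j10 : s₁.var 10 = u := by simp [s₁, h10]
  have j11 : s₁.var 11 = v := by simp [s₁, h11]
  have c4 : (Term.cell 4 (.var 12)).eval W s₁ ≠ 0 ↔ matOf n (s.arr 4) u v := by
    simp only [Term.eval, g12, ha, matOf]
  have c5 : ∀ s₂ : Store, s₂.var 12 = u * n + v → s₂.arr 5 = s.arr 5 →
      ((Term.cell 5 (.var 12)).eval W s₂ ≠ 0 ↔ matOf n (s.arr 5) u v) := by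
    intro s₂ q1 q2
    simp only [Term.eval, q1, q2, matOf]
  have c6 : ∀ s₂ : Store, s₂.var 12 = u * n + v → s₂.arr 6 = s.arr 6 →
      ((Term.cell 6 (.var 12)).eval W s₂ ≠ 0 ↔ matOf n (s.arr 6) u v) := by
    intro s₂ q1 q2
    simp only [Term.eval, q1, q2, matOf]
  have c3 : (Term.cell 3 (.var 12)).eval W s₁ ≠ 0 ↔ matOf n (s.arr 3) u v := by
    simp only [Term.eval, g12, ha, matOf]
  have c7 : (Term.cell 7 (.var 10)).eval W s₁ ≠ 0 ↔ u ∈ setOf n (s.arr 7) := by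
    simp only [Term.eval, j10, ha, mem_setOf]
  have c7' : (Term.cell 7 (.var 11)).eval W s₁ ≠ 0 ↔ v ∈ setOf n (s.arr 7) := by
    simp only [Term.eval, j11, ha, mem_setOf]
  have t0 : T (u, false) (v, false) ↔ ¬ matOf n (s.arr 4) u v ∧ (matOf n (s.arr 5) u v ∨
      (matOf n (s.arr 3) u v ∧ u ∉ setOf n (s.arr 7) ∧ v ∉ setOf n (s.arr 7))) := by
    simp [T, storeTrans, Trans, forwardArc]
  have t1 : ∀ p, T (u, p) (v, true) ↔ ¬ matOf n (s.arr 4) u v ∧ matOf n (s.arr 6) u v := by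
    simp [T, storeTrans, Trans, backwardArc]
  clear_value s₁ T
  have hI' : SearchInv T b k 1 P (fnOf n (s₁.arr 10)) (fnOf n (s₁.arr 11)) := by rwa [ha]
  refine (Runs.cond (T := 32 + (3 + 40)) (fun h => ?_) (fun h => ?_)).mono
    (by simp [Term.cost]) fun _ => id
  · rw [c4] at h
    refine ⟨1, _, .skip _, by omega, ?_⟩
    have s1 := (hI'.skip (u, false) (v, false) fun h' => absurd h (t0.1 h').1)
    have s2 := (s1.skip (u, false) (v, true) fun h' => absurd h ((t1 _).1 h').1)
    have s3 := (s2.skip (u, true) (v, true) fun h' => absurd h ((t1 _).1 h').1)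
    refine s3.anti fun z w hzw hc => ?_
    rcases hc with hc | ⟨hc1, hc2⟩
    · exact Or.inl (Or.inl (Or.inl hc))
    · rcases hall z w hc1 hc2 hzw with q | q | q
      · exact Or.inl (Or.inl (Or.inr q))
      · exact Or.inl (Or.inr q)
      · exact Or.inr q
  · have h4 : ¬ matOf n (s.arr 4) u v := fun hc => (c4.2 hc) h
    refine Runs.seq (R := fun s₂ => SearchInv T b k 1 (fun z w => P z w ∨
        (z = (u, false) ∧ w = (v, false))) (fnOf n (s₂.arr 10)) (fnOf n (s₂.arr 11))) ?_ ?_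
    · refine (Runs.cond (T := 29) (fun h => ?_) (fun h => ?_)).mono
        (by simp [Term.cost]) fun _ => id
      · rw [c5 _ g12 (by rw [ha])] at h
        exact (tryStep_runs _ _ hkW hk g17 g10 g11 (t0.2 ⟨h4, Or.inl h⟩) hI').mono (by omega)
          fun _ => id
      have h5 : ¬ matOf n (s.arr 5) u v := fun hc => ((c5 _ g12 (by rw [ha])).2 hc) h
      refine (Runs.cond (T := 26) (fun h => ?_) (fun h => ?_)).mono
        (by simp [Term.cost]) fun _ => id
      · rw [c3] at h
        refine (Runs.cond (T := 23) (fun h' => ?_) (fun h' => ?_)).mono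
          (by simp [Term.cost]) fun _ => id
        · rw [c7] at h'
          exact ⟨1, _, .skip _, by omega, hI'.skip _ _ fun ht =>
            ((t0.1 ht).2.elim h5 fun q => q.2.1 h').elim⟩
        have h7 : u ∉ setOf n (s.arr 7) := fun hc => (c7.2 hc) h'
        refine (Runs.cond (T := 20) (fun h' => ?_) (fun h' => ?_)).mono
          (by simp [Term.cost]) fun _ => id
        · rw [c7'] at h'
          exact ⟨1, _, .skip _, by omega, hI'.skip _ _ fun ht =>
            ((t0.1 ht).2.elim h5 fun q => q.2.2 h').elim⟩
        have h7' : v ∉ setOf n (s.arr 7) := fun hc => (c7'.2 hc) h'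
        exact (tryStep_runs _ _ hkW hk g17 g10 g11 (t0.2 ⟨h4, Or.inr ⟨h, h7, h7'⟩⟩) hI')
      · have h3 : ¬ matOf n (s.arr 3) u v := fun hc => (c3.2 hc) h
        exact ⟨1, _, .skip _, by omega, hI'.skip _ _ fun ht =>
            ((t0.1 ht).2.elim h5 fun q => h3 q.1).elim⟩
    · intro s₂ hI₂ hS₂
      have k12 : s₂.var 12 = u * n + v := by
        rw [hS₂.1 12 (by simp [tryStep, Prog.ModVar]), g12]
      have k6 : s₂.arr 6 = s.arr 6 := by
        rw [hS₂.2 6 (by simp [tryStep, Prog.ModArr]), ha]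
      refine (Runs.cond (T := 40) (fun h => ?_) (fun h => ?_)).mono
        (by simp [Term.cost]) fun _ => id
      · rw [c6 _ k12 k6] at h
        refine Runs.seq (T₁ := 20) (T₂ := 20) (tryStep_runs _ _ hkW hk
          (by rw [hS₂.1 17 (by simp [tryStep, Prog.ModVar]), g17])
          (by rw [hS₂.1 10 (by simp [tryStep, Prog.ModVar]), g10])
          (by rw [hS₂.1 19 (by simp [tryStep, Prog.ModVar]), g19]) ((t1 _).2 ⟨h4, h⟩) hI₂) ?_
        intro s₃ hI₃ hS₃
        refine (tryStep_runs _ _ hkW hk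
          (by rw [hS₃.1 17 (by simp [tryStep, Prog.ModVar]),
            hS₂.1 17 (by simp [tryStep, Prog.ModVar]), g17])
          (by rw [hS₃.1 18 (by simp [tryStep, Prog.ModVar]),
            hS₂.1 18 (by simp [tryStep, Prog.ModVar]), g18])
          (by rw [hS₃.1 19 (by simp [tryStep, Prog.ModVar]),
            hS₂.1 19 (by simp [tryStep, Prog.ModVar]), g19]) ((t1 _).2 ⟨h4, h⟩) hI₃).mono le_rfl
          fun s₄ hI₄ => hI₄.anti fun z w hzw hc => ?_
        rcases hc with hc | ⟨hc1, hc2⟩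
        · exact Or.inl (Or.inl (Or.inl hc))
        · rcases hall z w hc1 hc2 hzw with q | q | q
          · exact Or.inl (Or.inl (Or.inr q))
          · exact Or.inl (Or.inr q)
          · exact Or.inr q
      · have h6 : ¬ matOf n (s.arr 6) u v := fun hc => ((c6 _ k12 k6).2 hc) h
        refine ⟨1, _, .skip _, by omega, ?_⟩
        have s2 := (hI₂.skip (u, false) (v, true) fun h' => absurd ((t1 _).1 h').2 h6)
        have s3 := (s2.skip (u, true) (v, true) fun h' => absurd ((t1 _).1 h').2 h6)
        refine s3.anti fun z w hzw hc => ?_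
        rcases hc with hc | ⟨hc1, hc2⟩
        · exact Or.inl (Or.inl (Or.inl hc))
        · rcases hall z w hc1 hc2 hzw with q | q | q
          · exact Or.inl (Or.inl (Or.inr q))
          · exact Or.inl (Or.inr q)
          · exact Or.inr q

/-- `b` can be reached from the state `x` by exactly `j` transitions. -/
def Reaches {n : ℕ} (T : Fin n × Bool → Fin n × Bool → Prop) (b : Fin n) :
    ℕ → Fin n × Bool → Prop
  | 0, x => x.1 = b
  | j + 1, x => ∃ y, T x y ∧ Reaches T b j y

theorem SearchInv.reaches {n : ℕ} {T : Fin n × Bool → Fin n × Bool → Prop} {b : Fin n} {k m : ℕ}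
    {P : Fin n × Bool → Fin n × Bool → Prop} {D F : Fin n × Bool → ℕ}
    (h : SearchInv T b k m P D F) : ∀ j < k, ∀ x, Reaches T b j x → D x ≠ 0 ∧ D x ≤ j + 1 := by
  intro j
  induction j with
  | zero =>
    intro _ x hx
    rw [(h.one x).2 hx]
    simp
  | succ j ih =>
    rintro hj x ⟨y, hT, hy⟩
    obtain ⟨h1, h2⟩ := ih (by omega) y hy
    obtain ⟨h3, h4⟩ := h.pred x y hT h1 (Or.inl (by omega))
    exact ⟨h3, by omega⟩

/-- Following the pointers of a search gives a path without repeated vertices. That no state is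
repeated is clear from the labels; if a vertex occurred in both phases, the walk could be shortened,
against the minimality of the labels. -/
theorem SearchInv.exists_path {n : ℕ} {L₀ L₁ : Fin n → Fin n → Prop} {b : Fin n} {k : ℕ}
    {P : Fin n × Bool → Fin n × Bool → Prop} {D F : Fin n × Bool → ℕ}
    (h : SearchInv (Trans L₀ L₁) b k 0 P D F) {l : ℕ} {x : Fin n × Bool} (hx : D x = l + 1) :
    ∃ f : ℕ → Fin n × Bool, f 0 = x ∧
      (∀ i < l, Trans L₀ L₁ (f i) (f (i + 1)) ∧ F (f i) = stateIdx (f (i + 1))) ∧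
      (∀ i ≤ l, D (f i) = l + 1 - i) ∧
      (∀ i ≤ l, ∀ j ≤ l, (f i).1 = (f j).1 → i = j) := by
  have hex : ∃ f : ℕ → Fin n × Bool, f 0 = x ∧
      (∀ i < l, Trans L₀ L₁ (f i) (f (i + 1)) ∧ F (f i) = stateIdx (f (i + 1))) ∧
      (∀ i ≤ l, D (f i) = l + 1 - i) := by
    induction l generalizing x with
    | zero => exact ⟨fun _ => x, rfl, by simp, by simpa using hx⟩
    | succ l ih =>
      obtain ⟨y, hF, hT, hy⟩ := h.next x l hx
      obtain ⟨f, f0, f1, f2⟩ := ih hy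
      refine ⟨fun i => if i = 0 then x else f (i - 1), by simp, ?_, ?_⟩
      · rintro (_ | i) hi
        · simpa [f0] using ⟨hT, hF⟩
        · simpa using f1 i (by omega)
      · rintro (_ | i) hi
        · simpa using hx
        · simpa using f2 i (by omega)
  obtain ⟨f, f0, f1, f2⟩ := hex
  refine ⟨f, f0, f1, f2, ?_⟩
  have hphase : ∀ i j, i ≤ j → j ≤ l → (f j).2 = false → (f i).2 = false := by
    intro i j hij
    induction j, hij using Nat.le_induction with
    | base => exact fun _ h => h
    | succ j hij ih =>
      intro hj hf
      refine ih (by omega) ?_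
      have := (f1 j (by omega)).1
      rw [Trans, hf] at this
      simpa using this.1
  suffices H : ∀ i j, i < j → j ≤ l → (f i).1 ≠ (f j).1 by
    intro i hi j hj hij
    rcases lt_trichotomy i j with h' | h' | h'
    · exact absurd hij (H i j h' hj)
    · exact h'
    · exact absurd hij.symm (H j i h' hi)
  intro i j hij hj heq
  have hDi := f2 i (by omega)
  have hDj := f2 j hj
  by_cases hpj : (f j).2 = false
  · have hpi := hphase i j hij.le hj hpj
    have : f i = f j := Prod.ext heq (by rw [hpi, hpj])
    rw [this] at hDi
    omega
  by_cases hpi : (f i).2 = false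
  · -- a move that is possible in phase `true` is possible in phase `false` as well
    have hle : D (f i) ≤ D (f j) := by
      rcases Nat.eq_or_lt_of_le hj with rfl | hlt
      · have h1 : D (f j) = 1 := by omega
        have h2 := (h.one _).1 h1
        rw [← heq] at h2
        rw [(h.one _).2 h2, h1]
      · have hT := (f1 j hlt).1
        have hD := f2 (j + 1) hlt
        have hT' : Trans L₀ L₁ (f i) (f (j + 1)) := by
          unfold Trans at hT ⊢
          rw [heq]
          split_ifs at hT ⊢ with hc
          · exact hT
          · exact absurd hT.1 hpj
        have hk := h.le (f j)
        have := (h.pred _ _ hT' (by omega) (Or.inl (by omega))).2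
        omega
    omega
  · have : f i = f j := Prod.ext heq (by simp at hpi hpj; rw [hpi, hpj])
    rw [this] at hDi
    omega

theorem fnOf_update_false {n : ℕ} (a : ℕ → ℕ) (v : Fin n) (y : Fin n × Bool) (c : ℕ) :
    fnOf n (Function.update a v c) y = if y = (v, false) then c else fnOf n a y := by
  simpa [stateIdx] using fnOf_update a (v, false) y c

theorem fnOf_update_true {n : ℕ} (a : ℕ → ℕ) (v : Fin n) (y : Fin n × Bool) (c : ℕ) :
    fnOf n (Function.update a (v + n) c) y = if y = (v, true) then c else fnOf n a y := by
  simpa [stateIdx] using fnOf_update a (v, true) y c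

/-- Label the target, the vertex in variable `5`, and nothing else. -/
def initSearch : Prog :=
  .seq (Prog.forUp 10 0 (.seq (.write 10 (.var 10) (.lit 0))
      (.write 10 (.op .add (.var 10) (.var 0)) (.lit 0))))
    (.seq (.seq (.write 10 (.var 5) (.lit 1)) (.write 10 (.op .add (.var 5) (.var 0)) (.lit 1)))
      (.assign 17 (.lit 1)))

/-- Breadth-first search backwards from the vertex in variable `5` until the vertex in variable
`4` is reached. -/
def search : Prog :=
  .seq initSearch (.loop (.op .eq (.cell 10 (.var 4)) (.lit 0))
    (.seq (Prog.forUp 10 0 (Prog.forUp 11 0 relax)) (incr 17)))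

theorem initSearch_runs {W n : ℕ} {s : Store} (hW : 1000 * (n * n + 1) ≤ W) (h0 : s.var 0 = n)
    (b : Fin n) (h5 : s.var 5 = (b : ℕ)) (T : Fin n × Bool → Fin n × Bool → Prop) :
    Runs W initSearch s (30 * (n + 1) + 20) (fun s' => s'.var 17 = 1 ∧
      SearchInv T b 1 0 (fun _ _ => False) (fnOf n (s'.arr 10)) (fnOf n (s'.arr 11))) := by
  have hnn : n ≤ n * n := Nat.le_mul_self n
  have hb := b.2
  refine (Runs.seq (Runs.forUp (N := n) (T := 10) (fun k s' => ∀ x : Fin n × Bool, (x.1 : ℕ) < k →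
    fnOf n (s'.arr 10) x = 0) h0 (by omega) (by decide) (by simp [Prog.ModVar])
    (by simp [Prog.ModVar]) (by simp) (fun _ _ _ h => h) ?_) (T₂ := 20) ?_).mono (by omega)
    fun _ => id
  · intro k s' hk hxk hS hI
    have h0' : s'.var 0 = n := by rw [hS.1 0 (by simp [Prog.forUp, Prog.ModVar]), h0]
    refine (Runs.of_wp ?_).mono (T := _) (T' := 10) (by simp [Prog.time, Term.cost]) fun _ => id
    simp (disch := omega) only [wp, Term.eval, Op.apply, h0', hxk, Nat.mod_eq_of_lt,
      Store.setCell_var, Store.setCell_arr, if_true]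
    intro x hx
    obtain ⟨v, rfl⟩ : ∃ v : Fin n, (v : ℕ) = k := ⟨⟨k, hk⟩, rfl⟩
    rw [fnOf_update_true, fnOf_update_false]
    split_ifs with h1 h2
    · rfl
    · rfl
    · refine hI x ?_
      rcases Nat.lt_succ_iff_lt_or_eq.1 hx with h | h
      · exact h
      · exfalso
        obtain ⟨u, p⟩ := x
        have hu : u = v := Fin.ext h
        cases p <;> simp_all
  · rintro s₁ ⟨hz, -⟩ hS
    have h0' : s₁.var 0 = n := by rw [hS.1 0 (by simp [Prog.forUp, Prog.ModVar]), h0]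
    have h5' : s₁.var 5 = b := by rw [hS.1 5 (by simp [Prog.forUp, Prog.ModVar]), h5]
    refine (Runs.of_wp ?_).mono (T := _) (T' := 20) (by simp [Prog.time, Term.cost]) fun _ => id
    simp (disch := omega) only [wp, Term.eval, Op.apply, h0', h5', Nat.mod_eq_of_lt,
      Store.setCell_var, Store.setCell_arr, Store.setVar_var, Store.setVar_arr, if_true]
    refine ⟨trivial, ?_⟩
    have hval : fnOf n (Function.update (Function.update (s₁.arr 10) b 1) (b + n) 1) =
        fun x => if x.1 = b then 1 else 0 := by
      funext x
      rw [fnOf_update_true, fnOf_update_false, hz x x.1.2]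
      obtain ⟨u, p⟩ := x
      cases p <;> by_cases hu : u = b <;> simp [hu]
    rw [hval]
    refine ⟨fun x => ?_, fun x => ?_, fun x j hx => ?_, fun x y _ hy hc => ?_⟩
    · split_ifs <;> simp
    · simp
    · split_ifs at hx
      omega
    · rcases hc with hc | hc
      · omega
      · exact hc.2.elim

/-- The number `k` of rounds is bounded by the distance, which is why the answers are short. -/
theorem search_runs {W n L : ℕ} {s : Store} (hW : 1000 * (n * n + 1) ≤ W) (h0 : s.var 0 = n)
    (a b : Fin n) (h4 : s.var 4 = (a : ℕ)) (h5 : s.var 5 = (b : ℕ)) (hL : L ≤ n)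
    (hreach : Reaches (storeTrans n s.arr) b L (a, false)) :
    Runs W search s (1000 * (n + 3) ^ 3) (fun s' => ∃ k ≤ L + 1,
      SearchInv (storeTrans n s.arr) b k 0 (fun _ _ => False) (fnOf n (s'.arr 10))
        (fnOf n (s'.arr 11)) ∧ fnOf n (s'.arr 10) (a, false) ≠ 0) := by
  have hnn : n ≤ n * n := Nat.le_mul_self n
  have hW1 : 1 < W := by omega
  have hmain : Runs W search s ((30 * (n + 1) + 20) +
      (L + 1) * (((n + 1) * ((n + 1) * 130 + 10) + 4) + 1 + 4))
      (fun s' => ∃ k ≤ L + 1,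
      SearchInv (storeTrans n s.arr) b k 0 (fun _ _ => False) (fnOf n (s'.arr 10))
        (fnOf n (s'.arr 11)) ∧ fnOf n (s'.arr 10) (a, false) ≠ 0) := by
    refine Runs.seq (initSearch_runs hW h0 b h5 (storeTrans n s.arr)) ?_
    rintro s₁ ⟨h17, hI₁⟩ hS₁
    refine (Runs.loop (T := ((n + 1) * ((n + 1) * 130 + 10) + 4)) (fun s' => ∃ k ≤ L + 1,
      1 ≤ k ∧ s'.var 17 = k ∧ SearchInv (storeTrans n s.arr) b k 0 (fun _ _ => False)
        (fnOf n (s'.arr 10)) (fnOf n (s'.arr 11))) (fun s' => L + 1 - s'.var 17)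
      ⟨1, by omega, le_rfl, h17, hI₁⟩ ?_).same.mono ?_ ?_
    · rintro s₂ hS₂ ⟨k, hkL, hk, h17₂, hI₂⟩ he
      have hu₂ : ∀ x, ¬ search.ModVar x → s₂.var x = s.var x := fun x hx => by
        simp only [search, Prog.ModVar] at hx
        rw [hS₂.1 x (by simp only [Prog.ModVar]; tauto), hS₁.1 x (by tauto)]
      have h4₂ : s₂.var 4 = a := by
        rw [hu₂ 4 (by simp [search, initSearch, relax, tryStep, setIdx, incr, Prog.forUp,
          Prog.ModVar]), h4]
      have h0₂ : s₂.var 0 = n := by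
        rw [hu₂ 0 (by simp [search, initSearch, relax, tryStep, setIdx, incr, Prog.forUp,
          Prog.ModVar]), h0]
      have ha₂ : ∀ A, A ≠ 10 → A ≠ 11 → s₂.arr A = s.arr A := fun A q1 q2 => by
        rw [hS₂.2 A (by
            simp [relax, tryStep, setIdx, incr, Prog.forUp, Prog.ModArr]; tauto),
          hS₁.2 A (by simp [initSearch, Prog.forUp, Prog.ModArr]; tauto)]
      have hz : fnOf n (s₂.arr 10) (a, false) = 0 := by
        by_contra hc
        apply he
        have : s₂.arr 10 a ≠ 0 := by simpa [fnOf, stateIdx] using hc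
        simp [Term.eval, Op.apply, h4₂, this]
      have hkL' : k ≤ L := by
        by_contra hc
        exact (hI₂.reaches L (by omega) _ hreach).1 hz
      have htr : ∀ s' : Store, (∀ A, A ≠ 10 → A ≠ 11 → s'.arr A = s.arr A) →
          storeTrans n s'.arr = storeTrans n s.arr := by
        intro s' h
        unfold storeTrans
        rw [h 3 (by decide) (by decide), h 4 (by decide) (by decide), h 5 (by decide) (by decide),
          h 6 (by decide) (by decide), h 7 (by decide) (by decide)]
      refine Runs.seq (Runs.forUp (N := n) (T := (n + 1) * 130) (fun i s' =>
        SearchInv (storeTrans n s.arr) b k 1 (fun z _ => (z.1 : ℕ) < i)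
          (fnOf n (s'.arr 10)) (fnOf n (s'.arr 11))) h0₂ (by omega) (by decide)
        (by simp [relax, tryStep, setIdx, Prog.forUp, Prog.ModVar])
        (by simp [relax, tryStep, setIdx, Prog.forUp, Prog.ModVar])
        (hI₂.start.anti (by simp)) (fun _ _ _ h => h) ?_) ?_
      · intro i s₃ hi hxi hS₃ hI₃
        have h0₃ : s₃.var 0 = n := by
          rw [hS₃.1 0 (by simp [relax, tryStep, setIdx, Prog.forUp, Prog.ModVar]), h0₂]
        have h17₃ : s₃.var 17 = k := by
          rw [hS₃.1 17 (by simp [relax, tryStep, setIdx, Prog.forUp, Prog.ModVar]), h17₂]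
        have ha₃ : ∀ A, A ≠ 10 → A ≠ 11 → s₃.arr A = s.arr A := fun A q1 q2 => by
          rw [hS₃.2 A (by simp [relax, tryStep, setIdx, Prog.forUp, Prog.ModArr]; tauto),
            ha₂ A q1 q2]
        refine (Runs.forUp (N := n) (T := 120) (fun j s' =>
          SearchInv (storeTrans n s.arr) b k 1
            (fun z w => (z.1 : ℕ) < i ∨ ((z.1 : ℕ) = i ∧ (w.1 : ℕ) < j))
            (fnOf n (s'.arr 10)) (fnOf n (s'.arr 11))) h0₃ (by omega) (by decide)
          (by simp [relax, tryStep, setIdx, Prog.ModVar])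
          (by simp [relax, tryStep, setIdx, Prog.ModVar])
          (hI₃.anti (by simp)) (fun _ _ _ h => h) ?_).mono le_rfl ?_
        · intro j s₄ hj hxj hS₄ hI₄
          have ha₄ : ∀ A, A ≠ 10 → A ≠ 11 → s₄.arr A = s.arr A := fun A q1 q2 => by
            rw [hS₄.2 A (by simp [relax, tryStep, setIdx, Prog.forUp, Prog.ModArr]; tauto),
              ha₃ A q1 q2]
          have := relax_runs (s := s₄) (k := k) (b := b) (⟨i, hi⟩ : Fin n) ⟨j, hj⟩ hW (by omega) hk
            (by rw [hS₄.1 0 (by simp [relax, tryStep, setIdx, Prog.forUp, Prog.ModVar]), h0₃])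
            (by rw [hS₄.1 17 (by simp [relax, tryStep, setIdx, Prog.forUp, Prog.ModVar]), h17₃])
            (by rw [hS₄.1 10 (by simp [relax, tryStep, setIdx, Prog.forUp, Prog.ModVar]), hxi])
            hxj (by rw [htr s₄ ha₄]; exact hI₄)
          rw [htr s₄ ha₄] at this
          refine this.mono le_rfl fun s₅ h => h.anti fun z w _ hc => ?_
          simp only [Fin.ext_iff]
          omega
        · rintro s₄ ⟨h, -⟩
          refine h.anti fun z w _ hc => ?_
          have := w.1.2
          omega
      · rintro s₃ ⟨hI₃, -⟩ hS₃
        have h17₃ : s₃.var 17 = k := by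
          rw [hS₃.1 17 (by simp [relax, tryStep, setIdx, Prog.forUp, Prog.ModVar]), h17₂]
        refine ⟨4, _, .assign _ _ _, le_rfl, ?_⟩
        simp (disch := omega) only [Term.eval, Op.apply, h17₃, h17₂, Nat.mod_eq_of_lt,
          Store.setVar_var, Store.setVar_arr, if_true]
        exact ⟨⟨k + 1, by omega, by omega, rfl,
          (hI₃.anti fun z _ _ _ => z.1.2).finish⟩, by omega⟩
    · rw [h17]
      simp only [Term.cost]
      exact Nat.mul_le_mul (by omega) (by omega)
    · rintro s₂ ⟨⟨⟨k, hkL, hk, h17₂, hI₂⟩, he⟩, hS₂⟩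
      refine ⟨k, hkL, hI₂, fun hz => ?_⟩
      have h4₂ : s₂.var 4 = a := by
        rw [hS₂.1 4 (by simp [relax, tryStep, setIdx, incr, Prog.forUp, Prog.ModVar]),
          hS₁.1 4 (by simp [initSearch, Prog.forUp, Prog.ModVar]), h4]
      have hz' : s₂.arr 10 a = 0 := by simpa [fnOf, stateIdx] using hz
      simp [Term.eval, Op.apply, h4₂, hz', Nat.mod_eq_of_lt hW1] at he
  refine hmain.mono ?_ fun _ => id
  have h1 : (L + 1) * (((n + 1) * ((n + 1) * 130 + 10) + 4) + 1 + 4) ≤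
      (n + 1) * (((n + 1) * ((n + 1) * 130 + 10) + 4) + 1 + 4) :=
    Nat.mul_le_mul_right _ (by omega)
  refine (Nat.add_le_add_left h1 _).trans ?_
  ring_nf
  nlinarith [Nat.zero_le (n ^ 2), Nat.zero_le (n ^ 3)]

/-! ### Marking the edges of a path -/

/-- The pairs that are marked when the pair `(p, q)` is traversed: in an undirected graph (flag
`0`) also the reversed pair. -/
def Marks {n : ℕ} (flag : ℕ) (p q u v : Fin n) : Prop :=
  (u = p ∧ v = q) ∨ (flag = 0 ∧ u = q ∧ v = p)

/-- Write `c` into the cells of the matrix in array `4` that belong to the edge between the vertices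
in variables `10` and `11`. -/
def markEdge (c : ℕ) : Prog :=
  .seq setIdx (.seq (.write 4 (.var 12) (.lit c))
    (.cond (.var 2) .skip (.write 4 (.var 13) (.lit c))))

theorem markEdge_wp {W n flag c : ℕ} {s : Store} (hW : 1000 * (n * n + 1) ≤ W)
    (p q : Fin n) (h0 : s.var 0 = n) (h2 : s.var 2 = flag) (hp : s.var 10 = (p : ℕ))
    (hq : s.var 11 = (q : ℕ)) (hc : c ≤ 1) (Q : Store → Prop)
    (hQ : ∀ s', (∀ u v : Fin n, matOf n (s'.arr 4) u v ↔
      (Marks flag p q u v ∧ c ≠ 0) ∨ (¬ Marks flag p q u v ∧ matOf n (s.arr 4) u v)) →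
      (∀ A, A ≠ 4 → s'.arr A = s.arr A) → (∀ x, x ≠ 12 → x ≠ 13 → s'.var x = s.var x) → Q s') :
    wp W (markEdge c) Q s := by
  classical
  have hnn : n ≤ n * n := Nat.le_mul_self n
  have b1 := index_lt p.2 q.2
  have b2 := index_lt q.2 p.2
  simp (disch := omega) only [markEdge, setIdx, wp, Term.eval, Op.apply, h0, h2, hp, hq,
    Nat.mod_eq_of_lt, Store.setVar_var, Store.setCell_var, Nat.reduceEqDiff, if_true, if_false]
  refine ⟨fun hf => hQ _ (fun u v => ?_) (fun A hA => by simp [hA]) fun x h1 h2 => by simp [h1, h2],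
    fun hf => hQ _ (fun u v => ?_) (fun A hA => by simp [hA]) fun x h1 h2 => by simp [h1, h2]⟩
  · have hm : Marks flag p q u v ↔ u = p ∧ v = q := by simp [Marks, hf]
    simp only [Store.setCell_arr, if_true, Store.setVar_arr]
    rw [matOf_update, hm]
    split_ifs with h <;> simp [h]
  · have hm : Marks flag p q u v ↔ (u = p ∧ v = q) ∨ (u = q ∧ v = p) := by simp [Marks, hf]
    simp only [Store.setCell_arr, if_true, Store.setVar_arr]
    rw [matOf_update, matOf_update, hm]
    split_ifs with h h'
    · simp [h]
    · simp [h']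
    · simp only [h, h', or_self, false_and, not_false_eq_true, true_and, false_or]

/-- Follow the pointers found by the search: write the path into array `2`, its number of vertices
into variable `6`, and mark its edges as used. Reducing the index of a state modulo `n` gives its
vertex. -/
def traceback : Prog :=
  .seq (.seq (.assign 18 (.var 4)) (.seq (.write 2 (.lit 0) (.var 4)) (.assign 20 (.lit 1))))
    (.seq (.loop (.op .lt (.lit 1) (.cell 10 (.var 18)))
      (.seq (.assign 19 (.cell 11 (.var 18)))
        (.seq (.assign 10 (.op .mod (.var 18) (.var 0))) (.seq (.assign 11 (.op .mod (.var 19) (.var 0)))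
          (.seq (markEdge 1) (.seq (.write 2 (.var 20) (.var 11)) (.seq (incr 20)
            (.assign 18 (.var 19)))))))))
      (.assign 6 (.var 20)))

theorem stateIdx_mod {n : ℕ} (x : Fin n × Bool) : stateIdx x % n = x.1 := by
  unfold stateIdx
  split_ifs
  · rw [Nat.add_mod_right, Nat.mod_eq_of_lt x.1.2]
  · rw [Nat.add_zero, Nat.mod_eq_of_lt x.1.2]

theorem traceback_runs {W n flag l : ℕ} {s : Store} (hW : 1000 * (n * n + 1) ≤ W)
    (h0 : s.var 0 = n) (h2 : s.var 2 = flag) (f : ℕ → Fin n × Bool)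
    (h4 : s.var 4 = stateIdx (f 0)) (hf0 : (f 0).2 = false) (hl : l ≤ n)
    (hF : ∀ i < l, fnOf n (s.arr 11) (f i) = stateIdx (f (i + 1)))
    (hD : ∀ i ≤ l, fnOf n (s.arr 10) (f i) = l + 1 - i) :
    Runs W traceback s (200 * (n + 1)) (fun s' => s'.var 6 = l + 1 ∧
      (∀ i ≤ l, s'.arr 2 i = (f i).1) ∧
      ∀ u v, matOf n (s'.arr 4) u v ↔ matOf n (s.arr 4) u v ∨
        ∃ i < l, Marks flag (f i).1 (f (i + 1)).1 u v) := by
  have hnn : n ≤ n * n := Nat.le_mul_self n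
  have hn : 0 < n := (f 0).1.pos
  have hW1 : 1 < W := by omega
  refine (Runs.seq (T₁ := 10) (T₂ := (l + 1) * (60 + 1 + 4) + 2) (R := fun s' =>
      (∃ i ≤ l, s'.var 20 = i + 1 ∧ s'.var 18 = stateIdx (f i) ∧ (∀ j ≤ i, s'.arr 2 j = (f j).1) ∧
        ∀ u v, matOf n (s'.arr 4) u v ↔ matOf n (s.arr 4) u v ∨
          ∃ j < i, Marks flag (f j).1 (f (j + 1)).1 u v) ∧ s'.var 20 = 1) ?_ ?_).mono ?_ fun _ => id
  · refine (Runs.of_wp ?_).mono (T := _) (T' := 10) (by simp [Prog.time, Term.cost]) fun _ => id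
    simp only [wp, Term.eval, Store.setVar_var, Store.setVar_arr, Store.setCell_var,
      Store.setCell_arr, Nat.mod_eq_of_lt hW1, Nat.zero_mod, if_true]
    refine ⟨⟨0, by omega, by simp, by simp [h4], ?_, by simp⟩, by simp⟩
    intro j hj
    have : j = 0 := by omega
    subst this
    simp [h4, stateIdx, hf0]
  · rintro s₁ ⟨hI₁, h20⟩ hS₁
    refine Runs.seq (R := fun s' => s'.var 20 = l + 1 ∧ (∀ j ≤ l, s'.arr 2 j = (f j).1) ∧
        ∀ u v, matOf n (s'.arr 4) u v ↔ matOf n (s.arr 4) u v ∨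
          ∃ j < l, Marks flag (f j).1 (f (j + 1)).1 u v) ?_ ?_
    · refine (Runs.loop (T := 60) (fun s' =>
        (∃ i ≤ l, s'.var 20 = i + 1 ∧ s'.var 18 = stateIdx (f i) ∧
          (∀ j ≤ i, s'.arr 2 j = (f j).1) ∧
          ∀ u v, matOf n (s'.arr 4) u v ↔ matOf n (s.arr 4) u v ∨
            ∃ j < i, Marks flag (f j).1 (f (j + 1)).1 u v)) (fun s' => l + 1 - s'.var 20)
        hI₁ ?_).same.mono ?_ ?_
      · rintro s₂ hS₂ ⟨i, hi, q20, q18, q2, q4⟩ he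
        have ha₂ : ∀ A, A = 10 ∨ A = 11 → s₂.arr A = s.arr A := fun A q => by
          rw [hS₂.2 A (by simp [markEdge, setIdx, incr, Prog.ModArr]; omega),
            hS₁.2 A (by simp [Prog.ModArr]; omega)]
        have h0₂ : s₂.var 0 = n := by
          rw [hS₂.1 0 (by simp [markEdge, setIdx, incr, Prog.ModVar]),
            hS₁.1 0 (by simp [Prog.ModVar]), h0]
        have h2₂ : s₂.var 2 = flag := by
          rw [hS₂.1 2 (by simp [markEdge, setIdx, incr, Prog.ModVar]),
            hS₁.1 2 (by simp [Prog.ModVar]), h2]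
        have hDi : s₂.arr 10 (stateIdx (f i)) = l + 1 - i := by
          rw [ha₂ 10 (Or.inl rfl)]
          exact hD i hi
        have hil : i < l := by
          by_contra hc
          apply he
          have : l + 1 - i = 1 := by omega
          simp [Term.eval, Op.apply, q18, hDi, this, Nat.mod_eq_of_lt hW1]
        have hFi : s₂.arr 11 (stateIdx (f i)) = stateIdx (f (i + 1)) := by
          rw [ha₂ 11 (Or.inr rfl)]
          exact hF i hil
        have i1 := stateIdx_lt (f i)
        have i2 := stateIdx_lt (f (i + 1))
        have m1 := stateIdx_mod (f i)
        have m2 := stateIdx_mod (f (i + 1))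
        have v1 := (f i).1.2
        have v2 := (f (i + 1)).1.2
        refine (Runs.of_wp ?_).mono (T := _) (T' := 60)
          (by simp [markEdge, setIdx, incr, Prog.time, Term.cost]) fun _ => id
        simp (disch := omega) only [wp, incr, Term.eval, Op.apply, q18, h0₂, hFi, m1, m2,
          Nat.mod_eq_of_lt, Store.setVar_var, Nat.reduceEqDiff, if_true, if_false]
        refine markEdge_wp hW (f i).1 (f (i + 1)).1 (flag := flag) (by simp [h0₂]) (by simp [h2₂])
          (by simp) (by simp) le_rfl _ ?_
        intro s₃ r4 rA rv
        have w20 : s₃.var 20 = i + 1 := by rw [rv 20 (by decide) (by decide)]; simp [q20]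
        have w11 : s₃.var 11 = (f (i + 1)).1 := by rw [rv 11 (by decide) (by decide)]; simp
        have w19 : s₃.var 19 = stateIdx (f (i + 1)) := by
          rw [rv 19 (by decide) (by decide)]; simp
        simp (disch := omega) only [w20, w11, w19, Nat.mod_eq_of_lt, Store.setVar_arr,
          Store.setCell_var, Store.setCell_arr, Nat.reduceEqDiff, if_true,
          if_false]
        refine ⟨⟨i + 1, hil, rfl, rfl, ?_, ?_⟩, by rw [q20]; omega⟩
        · intro j hj
          rw [Function.update_apply, rA 2 (by decide)]
          split_ifs with hji
          · rw [hji]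
          · exact q2 j (by omega)
        · intro u v
          rw [r4]
          simp only [Store.setVar_arr, q4]
          constructor
          · rintro (⟨h, -⟩ | ⟨-, h | ⟨j, hj, h⟩⟩)
            · exact Or.inr ⟨i, by omega, h⟩
            · exact Or.inl h
            · exact Or.inr ⟨j, by omega, h⟩
          · rintro (h | ⟨j, hj, h⟩)
            · by_cases hm : Marks flag (f i).1 (f (i + 1)).1 u v
              · exact Or.inl ⟨hm, one_ne_zero⟩
              · exact Or.inr ⟨hm, Or.inl h⟩
            · by_cases hm : Marks flag (f i).1 (f (i + 1)).1 u v
              · exact Or.inl ⟨hm, one_ne_zero⟩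
              · refine Or.inr ⟨hm, Or.inr ⟨j, ?_, h⟩⟩
                rcases Nat.lt_succ_iff_lt_or_eq.1 hj with h' | rfl
                · exact h'
                · exact absurd h hm
      · simp only [h20, Term.cost]
        exact Nat.mul_le_mul (by omega) (by omega)
      · rintro s₂ ⟨⟨⟨i, hi, q20, q18, q2, q4⟩, he⟩, hS₂⟩
        have hDi : s₂.arr 10 (stateIdx (f i)) = l + 1 - i := by
          rw [hS₂.2 10 (by simp [markEdge, setIdx, incr, Prog.ModArr]),
            hS₁.2 10 (by simp [Prog.ModArr])]
          exact hD i hi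
        have : i = l := by
          by_contra hc
          have : 1 < l + 1 - i := by omega
          simp [Term.eval, Op.apply, q18, hDi, Nat.mod_eq_of_lt hW1, this] at he
        subst this
        exact ⟨q20, q2, q4⟩
    · rintro s₂ ⟨q20, q2, q4⟩ -
      refine ⟨2, _, .assign _ _ _, le_rfl, ?_⟩
      simp only [Term.eval, Store.setVar_var, Store.setVar_arr, if_true]
      exact ⟨q20, q2, q4⟩
  · have : l * 65 ≤ n * 65 := Nat.mul_le_mul_right _ hl
    ring_nf
    omega

/-- Unmark the edges of the path in array `1`, whose number of vertices is in variable `4`. -/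
def unmarkPath : Prog :=
  .seq (.assign 20 (.lit 1)) (.loop (.op .lt (.var 20) (.var 4))
    (.seq (.assign 10 (.cell 1 (.op .sub (.var 20) (.lit 1)))) (.seq (.assign 11 (.cell 1 (.var 20)))
      (.seq (markEdge 0) (incr 20)))))

theorem unmarkPath_runs {W n flag : ℕ} {s : Store} (hW : 1000 * (n * n + 1) ≤ W)
    (h0 : s.var 0 = n) (h2 : s.var 2 = flag) (P : List (Fin n)) (hPn : P.length ≤ n)
    (h4 : s.var 4 = P.length) (h1 : ∀ (k : ℕ) (h : k < P.length), s.arr 1 k = P[k]) :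
    Runs W unmarkPath s (200 * (n + 1)) (fun s' => ∀ u v, matOf n (s'.arr 4) u v ↔
      matOf n (s.arr 4) u v ∧ ¬ ∃ (i : ℕ) (h : i + 1 < P.length), Marks flag P[i] P[i + 1] u v) := by
  have hnn : n ≤ n * n := Nat.le_mul_self n
  have hW1 : 1 < W := by omega
  refine (Runs.seq (T₁ := 2) (T₂ := (P.length + 1) * (60 + 1 + 3)) (R := fun s' =>
      s' = s.setVar 20 1) ⟨2, _, .assign _ _ _, le_rfl, ?_⟩ ?_).mono (by nlinarith) fun _ => id
  · simp [Term.eval, Nat.mod_eq_of_lt hW1]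
  rintro _ rfl -
  refine (Runs.loop (T := 60) (fun s' => ∃ j, s'.var 20 = j + 1 ∧ (j = 0 ∨ j + 1 ≤ P.length) ∧
      ∀ u v, matOf n (s'.arr 4) u v ↔ matOf n (s.arr 4) u v ∧
        ¬ ∃ (i : ℕ) (h : i + 1 < P.length), i < j ∧ Marks flag P[i] P[i + 1] u v)
      (fun s' => P.length - s'.var 20) ⟨0, by simp, Or.inl rfl, by simp⟩ ?_).same.mono ?_ ?_
  · rintro s₂ hS₂ ⟨j, q20, hj, q4⟩ he
    have hv : ∀ x, x = 0 ∨ x = 2 ∨ x = 4 → s₂.var x = s.var x := fun x hx => by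
      rw [hS₂.1 x (by simp [markEdge, setIdx, incr, Prog.ModVar]; omega)]
      simp
      omega
    have h0₂ : s₂.var 0 = n := by rw [hv 0 (by simp), h0]
    have h2₂ : s₂.var 2 = flag := by rw [hv 2 (by simp), h2]
    have h4₂ : s₂.var 4 = P.length := by rw [hv 4 (by simp), h4]
    have h1₂ : s₂.arr 1 = s.arr 1 := by
      rw [hS₂.2 1 (by simp [markEdge, setIdx, incr, Prog.ModArr])]
      simp
    have hjl : j + 1 < P.length := by
      by_contra hc
      apply he
      simp [Term.eval, Op.apply, q20, h4₂, hc]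
    have e1 := h1 j (by omega)
    have e2 := h1 (j + 1) hjl
    refine (Runs.of_wp ?_).mono (T := _) (T' := 60)
      (by simp [markEdge, setIdx, incr, Prog.time, Term.cost]) fun _ => id
    simp (disch := omega) only [wp, incr, Term.eval, Op.apply, q20, h1₂, Nat.mod_eq_of_lt,
      Store.setVar_var, Store.setVar_arr, Nat.reduceEqDiff, if_true, if_false, Nat.add_sub_cancel,
      e1, e2]
    refine markEdge_wp hW P[j] P[j + 1] (flag := flag) (by simp [h0₂]) (by simp [h2₂])
      (by simp) (by simp) (by omega) _ ?_
    intro s₃ r4 rA rv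
    have w20 : s₃.var 20 = j + 1 := by rw [rv 20 (by decide) (by decide)]; simp [q20]
    simp (disch := omega) only [w20, Nat.mod_eq_of_lt]
    refine ⟨⟨j + 1, rfl, Or.inr hjl, ?_⟩, by omega⟩
    intro u v
    rw [r4]
    simp only [Store.setVar_arr, q4]
    constructor
    · rintro (⟨-, h⟩ | ⟨hm, h, h'⟩)
      · exact absurd rfl h
      · refine ⟨h, ?_⟩
        rintro ⟨i, hi, hij, hm'⟩
        rcases Nat.lt_succ_iff_lt_or_eq.1 hij with h'' | rfl
        · exact h' ⟨i, hi, h'', hm'⟩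
        · exact hm hm'
    · rintro ⟨h, h'⟩
      exact Or.inr ⟨fun hm => h' ⟨j, hjl, by omega, hm⟩, h, fun ⟨i, hi, hij, hm⟩ =>
        h' ⟨i, hi, by omega, hm⟩⟩
  · simp only [Term.cost]
    exact Nat.mul_le_mul (by omega) (by omega)
  · rintro s₂ ⟨⟨⟨j, q20, hj, q4⟩, he⟩, hS₂⟩
    have h4₂ : s₂.var 4 = P.length := by
      rw [hS₂.1 4 (by simp [markEdge, setIdx, incr, Prog.ModVar])]
      simp [h4]
    have hjl : ¬ j + 1 < P.length := by
      intro hc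
      simp [Term.eval, Op.apply, q20, h4₂, hc, Nat.mod_eq_of_lt hW1] at he
    intro u v
    rw [q4]
    refine and_congr_right fun _ => not_congr ?_
    constructor
    · rintro ⟨i, hi, -, h⟩
      exact ⟨i, hi, h⟩
    · rintro ⟨i, hi, h⟩
      exact ⟨i, hi, by omega, h⟩

/-! ### Sparse and expanding relations -/

section Counting

variable {n : ℕ}

theorem sum_outCount (R : Fin n → Fin n → Prop) (S T : Finset (Fin n)) :
    ∑ v ∈ S, outCount R T v = ∑ w ∈ T, inCount R S w := by
  classical
  simp only [outCount, inCount, Finset.card_filter]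
  exact Finset.sum_comm

theorem outCount_union_le (R : Fin n → Fin n → Prop) (S T : Finset (Fin n)) (v : Fin n) :
    outCount R (S ∪ T) v ≤ outCount R S v + outCount R T v := by
  classical
  simp only [outCount, Finset.filter_union]
  exact Finset.card_union_le _ _

theorem inCount_union_le (R : Fin n → Fin n → Prop) (S T : Finset (Fin n)) (v : Fin n) :
    inCount R (S ∪ T) v ≤ inCount R S v + inCount R T v := by
  classical
  simp only [inCount, Finset.filter_union]
  exact Finset.card_union_le _ _

theorem arcCount_union_le (R : Fin n → Fin n → Prop) (S T : Finset (Fin n)) (v : Fin n) :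
    arcCount R (S ∪ T) v ≤ arcCount R S v + arcCount R T v := by
  have := outCount_union_le R S T v
  have := inCount_union_le R S T v
  unfold arcCount
  omega

/-- The number of pairs of the relation inside `S`. -/
noncomputable def innerCount (R : Fin n → Fin n → Prop) (S : Finset (Fin n)) : ℕ :=
  ∑ v ∈ S, outCount R S v

theorem sum_arcCount (R : Fin n → Fin n → Prop) (S : Finset (Fin n)) :
    ∑ v ∈ S, arcCount R S v = 2 * innerCount R S := by
  simp only [arcCount, Finset.sum_add_distrib, ← sum_outCount, innerCount]
  ring

theorem innerCount_insert (R : Fin n → Fin n → Prop) {S : Finset (Fin n)} {v : Fin n}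
    (hv : v ∉ S) : innerCount R S + arcCount R S v ≤ innerCount R (insert v S) := by
  classical
  have h1 : ∀ u, outCount R (insert v S) u = outCount R S u + if R u v then 1 else 0 := by
    intro u
    simp only [outCount, Finset.filter_insert]
    split_ifs
    · rw [Finset.card_insert_of_notMem (by simp [hv])]
    · simp
  have h2 : ∑ u ∈ S, (if R u v then 1 else 0) = inCount R S v := by
    rw [inCount, Finset.card_filter]
  unfold innerCount arcCount
  rw [Finset.sum_insert hv, Finset.sum_congr rfl fun u _ => h1 u, Finset.sum_add_distrib, h2, h1]
  omega

/-- A `d`-regular directed graph in which sets of at most `m` vertices span few arcs, and sets of at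
most half of the vertices do not span too many. -/
structure Expanding (E : Fin n → Fin n → Prop) (d m : ℕ) : Prop where
  out_eq : ∀ v, outCount E Finset.univ v = d
  in_eq : ∀ v, inCount E Finset.univ v = d
  sparse : ∀ S : Finset (Fin n), S.card ≤ m → 500 * innerCount E S ≤ d * S.card
  expand : ∀ S : Finset (Fin n), 2 * S.card ≤ n → 3 * innerCount E S ≤ 2 * d * S.card

/-- If few arcs are used, then some small set is closed. Starting from the vertices that meet many
used arcs, every vertex added has `d / 50` arcs to the set, and small sets do not span that many. -/
theorem Expanding.exists_isClosedUnder {E U : Fin n → Fin n → Prop} {d m h : ℕ}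
    (hE : Expanding E d m) (hd : 0 < d)
    (hU : 50 * ∑ v, arcCount U Finset.univ v ≤ d * h) (hm : 2 * h + 1 ≤ m) :
    ∃ C, IsClosedUnder E U d C ∧ C.card ≤ m := by
  classical
  let H : Finset (Fin n) := Finset.univ.filter fun v => d < 50 * arcCount U Finset.univ v
  have hH : H.card ≤ h := by
    have h1 : H.card * d ≤ ∑ v ∈ H, 50 * arcCount U Finset.univ v := by
      rw [← smul_eq_mul]
      exact Finset.card_nsmul_le_sum _ _ _ fun v hv => (Finset.mem_filter.1 hv).2.le
    have h2 : ∑ v ∈ H, 50 * arcCount U Finset.univ v ≤ ∑ v, 50 * arcCount U Finset.univ v :=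
      Finset.sum_le_sum_of_subset (Finset.subset_univ _)
    have h3 := Finset.mul_sum Finset.univ (fun v => arcCount U Finset.univ v) 50
    exact Nat.le_of_mul_le_mul_left (by linarith [mul_comm d H.card]) hd
  -- a largest small set in which every vertex outside `H` accounts for `d / 50` arcs is closed
  let P : Finset (Finset (Fin n)) := Finset.univ.filter fun C =>
    H ⊆ C ∧ d * C.card ≤ 50 * innerCount E C + d * H.card ∧ C.card ≤ m
  have hHP : H ∈ P := by
    simp only [P, Finset.mem_filter, Finset.mem_univ, true_and]
    exact ⟨Finset.Subset.refl _, by omega, by omega⟩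
  obtain ⟨C, hC, hmax⟩ := Finset.exists_max_image P Finset.card ⟨H, hHP⟩
  simp only [P, Finset.mem_filter, Finset.mem_univ, true_and] at hC hmax
  obtain ⟨hHC, hinner, hcard⟩ := hC
  refine ⟨C, fun v hv => ?_, hcard⟩
  have h1 : 50 * arcCount U Finset.univ v ≤ d := by
    by_contra hc
    exact hv (hHC (by simpa [H] using hc))
  refine ⟨h1, ?_⟩
  by_contra hc
  have hs := hE.sparse C hcard
  have h3 : 9 * C.card ≤ 10 * H.card := by
    refine Nat.le_of_mul_le_mul_left (c := d) ?_ hd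
    nlinarith
  have h4 := innerCount_insert E hv
  have h5 := Finset.card_insert_of_notMem hv
  have := hmax (insert v C) ⟨hHC.trans (Finset.subset_insert _ _), by rw [h5]; nlinarith,
    by rw [h5]; omega⟩
  omega

/-- A nonempty set of at most `m` vertices has a vertex that meets few arcs inside the set. -/
theorem Expanding.eq_empty {E : Fin n → Fin n → Prop} {d m : ℕ} (hE : Expanding E d m)
    {Z : Finset (Fin n)} (hZ : Z.card ≤ m) (h : ∀ v ∈ Z, d < 250 * arcCount E Z v) : Z = ∅ := by
  by_contra hne
  have h1 : ∑ v ∈ Z, d < ∑ v ∈ Z, 250 * arcCount E Z v :=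
    Finset.sum_lt_sum_of_nonempty (Finset.nonempty_iff_ne_empty.2 hne) h
  rw [← Finset.mul_sum, sum_arcCount, Finset.sum_const, smul_eq_mul] at h1
  have := hE.sparse Z hZ
  nlinarith

end Counting

/-! ### Edges used by paths -/

section Paths

variable {n : ℕ}

/-- The path `P` uses the edge that is traversed from `u` to `v`. In an undirected graph the
direction does not matter. -/
def Uses (G : Network n) (P : List (Fin n)) (u v : Fin n) : Prop :=
  ∃ e ∈ Network.steps P, G.SameEdge e (u, v)

/-- `v` is the first or the last vertex of `P`. -/
def IsEnd (P : List (Fin n)) (v : Fin n) : Prop := P.head? = some v ∨ P.getLast? = some v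

/-- `u` is followed by `v` on `P`. -/
def Follows (P : List (Fin n)) (u v : Fin n) : Prop := (u, v) ∈ Network.steps P

theorem mem_steps {P : List (Fin n)} {e : Fin n × Fin n} :
    e ∈ Network.steps P ↔ ∃ (i : ℕ) (h : i + 1 < P.length), e = (P[i], P[i + 1]) := by
  unfold Network.steps
  rw [List.mem_iff_getElem]
  constructor
  · rintro ⟨i, hi, rfl⟩
    rw [List.length_zip, List.length_tail] at hi
    exact ⟨i, by omega, by simp⟩
  · rintro ⟨i, hi, rfl⟩
    have hi' : i < (P.zip P.tail).length := by
      rw [List.length_zip, List.length_tail]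
      omega
    exact ⟨i, hi', by simp⟩

theorem Network.SameEdge.symm {G : Network n} {e f : Fin n × Fin n} (h : G.SameEdge e f) :
    G.SameEdge f e := by
  cases G <;> exact Eq.symm h

theorem Network.SameEdge.trans {G : Network n} {e f g : Fin n × Fin n} (h : G.SameEdge e f)
    (h' : G.SameEdge f g) : G.SameEdge e g := by
  cases G <;> exact Eq.trans h h'

theorem Uses.cases {G : Network n} {P : List (Fin n)} {u v : Fin n} (h : Uses G P u v) :
    Follows P u v ∨ Follows P v u := by
  obtain ⟨⟨p, q⟩, he, hs⟩ := h
  cases G with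
  | undirected G =>
    rcases Sym2.eq_iff.1 hs with ⟨h1, h2⟩ | ⟨h1, h2⟩
    · subst h1 h2
      exact Or.inl he
    · subst h1 h2
      exact Or.inr he
  | directed D _ =>
    rw [show (p, q) = (u, v) from hs] at he
    exact Or.inl he

theorem uses_iff {G : Network n} {P : List (Fin n)} {u v : Fin n} :
    Uses G P u v ↔ ∃ (i : ℕ) (h : i + 1 < P.length), Marks G.flag P[i] P[i + 1] u v := by
  unfold Uses
  constructor
  · rintro ⟨e, he, hs⟩
    obtain ⟨i, hi, rfl⟩ := mem_steps.1 he
    refine ⟨i, hi, ?_⟩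
    cases G with
    | undirected G =>
      rcases Sym2.eq_iff.1 hs with ⟨h1, h2⟩ | ⟨h1, h2⟩
      · exact Or.inl ⟨h1.symm, h2.symm⟩
      · exact Or.inr ⟨rfl, h2.symm, h1.symm⟩
    | directed D _ =>
      have hs' : (P[i], P[i + 1]) = (u, v) := hs
      rw [Prod.mk.injEq] at hs'
      exact Or.inl ⟨hs'.1.symm, hs'.2.symm⟩
  · rintro ⟨i, hi, h⟩
    refine ⟨_, mem_steps.2 ⟨i, hi, rfl⟩, ?_⟩
    rcases h with ⟨rfl, rfl⟩ | ⟨hf, rfl, rfl⟩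
    · cases G <;> rfl
    · cases G with
      | undirected G => exact Sym2.eq_swap
      | directed D _ => exact absurd hf one_ne_zero

theorem outCount_steps_le {P : List (Fin n)} (hP : P.Nodup) (v : Fin n) :
    outCount (Follows P) Finset.univ v ≤ 1 := by
  classical
  refine Finset.card_le_one.2 fun a ha b hb => ?_
  rw [Finset.mem_filter, Follows, mem_steps] at ha hb
  obtain ⟨-, i, hi, h⟩ := ha
  obtain ⟨-, j, hj, h'⟩ := hb
  rw [Prod.mk.injEq] at h h'
  have hij : i = j := (List.Nodup.getElem_inj_iff hP).1 (h.1.symm.trans h'.1)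
  subst hij
  rw [h.2, h'.2]

theorem inCount_steps_le {P : List (Fin n)} (hP : P.Nodup) (v : Fin n) :
    inCount (Follows P) Finset.univ v ≤ 1 := by
  classical
  refine Finset.card_le_one.2 fun a ha b hb => ?_
  rw [Finset.mem_filter, Follows, mem_steps] at ha hb
  obtain ⟨-, i, hi, h⟩ := ha
  obtain ⟨-, j, hj, h'⟩ := hb
  rw [Prod.mk.injEq] at h h'
  have hij : i + 1 = j + 1 := (List.Nodup.getElem_inj_iff hP).1 (h.2.symm.trans h'.2)
  have hij : i = j := by omega
  subst hij
  rw [h.1, h'.1]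

theorem outCount_or_le (R R' : Fin n → Fin n → Prop) (S : Finset (Fin n)) (v : Fin n) :
    outCount (fun u w => R u w ∨ R' u w) S v ≤ outCount R S v + outCount R' S v := by
  classical
  simp only [outCount, Finset.filter_or]
  exact Finset.card_union_le _ _

theorem inCount_or_le (R R' : Fin n → Fin n → Prop) (S : Finset (Fin n)) (v : Fin n) :
    inCount (fun u w => R u w ∨ R' u w) S v ≤ inCount R S v + inCount R' S v := by
  classical
  simp only [inCount, Finset.filter_or]
  exact Finset.card_union_le _ _

theorem outCount_imp {R R' : Fin n → Fin n → Prop} (S : Finset (Fin n)) (v : Fin n)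
    (h : ∀ w, R v w → R' v w) : outCount R S v ≤ outCount R' S v := by
  classical
  exact Finset.card_le_card (Finset.monotone_filter_right _ fun w _ => h w)

theorem inCount_imp {R R' : Fin n → Fin n → Prop} (S : Finset (Fin n)) (v : Fin n)
    (h : ∀ w, R w v → R' w v) : inCount R S v ≤ inCount R' S v := by
  classical
  exact Finset.card_le_card (Finset.monotone_filter_right _ fun w _ => h w)

theorem outCount_uses_le {G : Network n} {P : List (Fin n)} (hP : P.Nodup) (v : Fin n) :
    outCount (Uses G P) Finset.univ v ≤ 2 := by
  refine (outCount_imp (R' := fun u w => Follows P u w ∨ Follows P w u) _ _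
    fun w h => h.cases).trans ((outCount_or_le _ (fun u w => Follows P w u) _ _).trans ?_)
  exact add_le_add (outCount_steps_le hP v) (inCount_steps_le hP v)

theorem inCount_uses_le {G : Network n} {P : List (Fin n)} (hP : P.Nodup) (v : Fin n) :
    inCount (Uses G P) Finset.univ v ≤ 2 := by
  refine (inCount_imp (R' := fun u w => Follows P u w ∨ Follows P w u) _ _
    fun w h => h.cases).trans ((inCount_or_le _ (fun u w => Follows P w u) _ _).trans ?_)
  exact add_le_add (inCount_steps_le hP v) (outCount_steps_le hP v)

theorem sum_outCount_steps_le (P : List (Fin n)) :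
    ∑ v, outCount (Follows P) Finset.univ v ≤
      (Network.steps P).length := by
  classical
  refine le_trans (le_of_eq ?_) (List.toFinset_card_le (Network.steps P))
  simp only [outCount, Finset.card_filter]
  rw [← Finset.sum_product', Finset.univ_product_univ, ← Finset.card_filter]
  congr 1
  ext e
  simp [Follows]

/-- A property that no two members of a list share holds for at most one of them. -/
theorem countP_le_one {α : Type*} (p : α → Bool) (l : List α)
    (h : l.Pairwise fun a b => ¬ (p a = true ∧ p b = true)) : l.countP p ≤ 1 := by
  induction l with
  | nil => simp
  | cons a l ih =>
    rw [List.pairwise_cons] at h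
    rw [List.countP_cons]
    split_ifs with ha
    · have : l.countP p = 0 := List.countP_eq_zero.2 fun b hb hpb => h.1 b hb ⟨ha, hpb⟩
      omega
    · exact ih h.2

/-- The edges used by a family of paths. -/
def UsedBy (G : Network n) (l : List (List (Fin n))) (u v : Fin n) : Prop :=
  ∃ P ∈ l, Uses G P u v

/-- The total number of used arcs is controlled by the total length of the paths. -/
theorem sum_arcCount_usedBy_le (G : Network n) (l : List (List (Fin n))) (L : ℕ)
    (hL : ∀ P ∈ l, (Network.steps P).length ≤ L) :
    ∑ v, arcCount (UsedBy G l) Finset.univ v ≤ 4 * (l.length * L) := by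
  have key : ∑ v, outCount (UsedBy G l) Finset.univ v ≤ 2 * (l.length * L) := by
    induction l with
    | nil =>
      classical
      simp [outCount, UsedBy]
    | cons P l ih =>
      have ih' := ih fun Q hQ => hL Q (List.mem_cons_of_mem _ hQ)
      have h1 : ∀ v, outCount (UsedBy G (P :: l)) Finset.univ v ≤
          (outCount (Follows P) Finset.univ v +
            inCount (Follows P) Finset.univ v) +
              outCount (UsedBy G l) Finset.univ v := by
        intro v
        refine le_trans (outCount_imp _ _ ?_)
          ((outCount_or_le (Uses G P) (UsedBy G l) _ _).trans (Nat.add_le_add_right ?_ _))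
        · rintro w ⟨Q, hQ, h⟩
          rcases List.mem_cons.1 hQ with rfl | hQ
          · exact Or.inl h
          · exact Or.inr ⟨Q, hQ, h⟩
        · exact (outCount_imp (R' := fun u w => Follows P u w ∨ Follows P w u) _ _
            fun w h => h.cases).trans (outCount_or_le _ (fun u w => Follows P w u) _ _)
      refine (Finset.sum_le_sum fun v _ => h1 v).trans ?_
      rw [Finset.sum_add_distrib, Finset.sum_add_distrib]
      have h2 := sum_outCount_steps_le P
      have h3 := sum_outCount (Follows P) Finset.univ Finset.univ
      have h4 := hL P List.mem_cons_self
      rw [List.length_cons]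
      linarith
  have h := sum_outCount (UsedBy G l) Finset.univ Finset.univ
  simp only [arcCount, Finset.sum_add_distrib, ← h]
  omega

end Paths

/-! ### Reserved arcs -/

section Reservations

variable {n : ℕ}

/-- Every vertex `v` of `S` owns at least `9 d / 10` out-arcs (the arcs `O v w`) and as many
in-arcs (the arcs `J w v`) of `E`, and the arcs of others that a path can use to arrive at `v` or
to leave it lie in a small set `I v`. -/
structure Reserved (E : Fin n → Fin n → Prop) (d : ℕ) (S : Finset (Fin n))
    (O J : Fin n → Fin n → Prop) (I : Fin n → Finset (Fin n × Fin n)) : Prop where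
  out_imp : ∀ u v, O u v → E u v ∧ u ∈ S
  in_imp : ∀ u v, J u v → E u v ∧ v ∈ S
  outBig : ∀ v ∈ S, 9 * d ≤ 10 * outCount O Finset.univ v
  inBig : ∀ v ∈ S, 9 * d ≤ 10 * inCount J Finset.univ v
  land : ∀ v ∈ S, ∀ u, O u v → (u, v) ∈ I v
  leave : ∀ v ∈ S, ∀ u, J v u → (v, u) ∈ I v
  few : ∀ v ∈ S, 40 * (I v).card ≤ d

/-- `P` starts or ends at `v` or uses an arc of the set `I`. -/
def Pays (G : Network n) (P : List (Fin n)) (I : Finset (Fin n × Fin n)) (v : Fin n) : Prop :=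
  IsEnd P v ∨ ∃ e ∈ I, Uses G P e.1 e.2

/-- A path uses an arc that is owned by `v` only if it starts or ends at `v` or uses one of the few
arcs of `I v`. As paths are edge-disjoint, there are few such paths. -/
def Guarded (G : Network n) (l : List (List (Fin n))) (O J : Fin n → Fin n → Prop)
    (I : Fin n → Finset (Fin n × Fin n)) : Prop :=
  ∀ P ∈ l, ∀ v w, (O v w ∧ Uses G P v w) ∨ (J w v ∧ Uses G P w v) → Pays G P (I v) v

open Classical in
/-- The arcs of `E` between `v` and `T`, in both directions. -/
noncomputable def arcsAt (E : Fin n → Fin n → Prop) (T : Finset (Fin n)) (v : Fin n) :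
    Finset (Fin n × Fin n) :=
  (T.filter fun w => E v w).image (fun w => (v, w)) ∪
    (T.filter fun w => E w v).image (fun w => (w, v))

theorem card_arcsAt_le (E : Fin n → Fin n → Prop) (T : Finset (Fin n)) (v : Fin n) :
    (arcsAt E T v).card ≤ arcCount E T v := by
  classical
  refine (Finset.card_union_le _ _).trans (add_le_add ?_ ?_) <;> exact Finset.card_image_le

theorem out_mem_arcsAt {E : Fin n → Fin n → Prop} {T : Finset (Fin n)} {v w : Fin n} (hw : w ∈ T)
    (h : E v w) : (v, w) ∈ arcsAt E T v := by
  classical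
  exact Finset.mem_union_left _ (Finset.mem_image_of_mem _ (Finset.mem_filter.2 ⟨hw, h⟩))

theorem in_mem_arcsAt {E : Fin n → Fin n → Prop} {T : Finset (Fin n)} {v w : Fin n} (hw : w ∈ T)
    (h : E w v) : (w, v) ∈ arcsAt E T v := by
  classical
  exact Finset.mem_union_right _
    (Finset.mem_image.2 ⟨w, Finset.mem_filter.2 ⟨hw, h⟩, rfl⟩)

/-- The state of the peeling procedure: the vertices of `Y` outside `Z` own their arcs, among them
those of `X`, which owned them from the start. The arcs owned by others at a pending vertex `z ∈ Z`
belong to vertices of `X`, and the arcs that `z` may still reserve at a vertex `v` that is done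
belong to `I v`. -/
structure Peeling (G : Network n) (l : List (List (Fin n))) (E : Fin n → Fin n → Prop) (d : ℕ)
    (X Y Z : Finset (Fin n)) (O J : Fin n → Fin n → Prop)
    (I : Fin n → Finset (Fin n × Fin n)) : Prop where
  subset : Z ⊆ Y
  disjoint : ∀ v ∈ Z, v ∉ X
  reserved : Reserved E d (Y \ Z) O J I
  guarded : Guarded G l O J I
  pendOut : ∀ v ∈ Z, ∀ u, O u v → u ∈ X
  pendIn : ∀ v ∈ Z, ∀ u, J v u → u ∈ X
  futIn : ∀ v ∈ Y \ Z, v ∉ X → ∀ z ∈ Z, E z v → (z, v) ∈ I v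
  futOut : ∀ v ∈ Y \ Z, v ∉ X → ∀ z ∈ Z, E v z → (v, z) ∈ I v

theorem outCount_le_reserveOut (E U O : Fin n → Fin n → Prop) (T : Finset (Fin n)) (v : Fin n) :
    outCount E Finset.univ v ≤ outCount (reserveOut E U T v O) Finset.univ v +
      (outCount E T v + outCount U Finset.univ v) := by
  classical
  simp only [outCount]
  refine le_trans (Finset.card_le_card ?_) ((Finset.card_union_le _ _).trans
    (Nat.add_le_add_left (Finset.card_union_le _ _) _))
  intro w hw
  simp only [Finset.mem_union, Finset.mem_filter, Finset.mem_univ, true_and, reserveOut] at hw ⊢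
  tauto

theorem inCount_le_reserveIn (E U J : Fin n → Fin n → Prop) (T : Finset (Fin n)) (v : Fin n) :
    inCount E Finset.univ v ≤ inCount (reserveIn E U T v J) Finset.univ v +
      (inCount E T v + inCount U Finset.univ v) := by
  classical
  simp only [inCount]
  refine le_trans (Finset.card_le_card ?_) ((Finset.card_union_le _ _).trans
    (Nat.add_le_add_left (Finset.card_union_le _ _) _))
  intro w hw
  simp only [Finset.mem_union, Finset.mem_filter, Finset.mem_univ, true_and, reserveIn] at hw ⊢
  tauto

/-- A vertex with few arcs inside the pending set `Z` can make its reservations: it takes its unused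
arcs that avoid `X` and `Z`, and the few remaining arcs become the set that guards it. -/
theorem Peeling.step {G : Network n} {l : List (List (Fin n))} {E : Fin n → Fin n → Prop} {d : ℕ}
    {X Y Z : Finset (Fin n)} {O J : Fin n → Fin n → Prop} {I : Fin n → Finset (Fin n × Fin n)}
    (h : Peeling G l E d X Y Z O J I) (hd : 200 ≤ d) {v : Fin n} (hv : v ∈ Z)
    (hout : outCount E Finset.univ v = d) (hin : inCount E Finset.univ v = d)
    (hX : 50 * arcCount E X v ≤ d) (hU : 50 * arcCount (UsedBy G l) Finset.univ v ≤ d + 200)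
    (hZ : 250 * arcCount E Z v ≤ d) :
    Peeling G l E d X Y (Z.erase v) (reserveOut E (UsedBy G l) (X ∪ Z) v O)
      (reserveIn E (UsedBy G l) (X ∪ Z) v J) (Function.update I v (arcsAt E (X ∪ Z) v)) := by
  classical
  have hT := arcCount_union_le E X Z v
  have hS : ∀ u, u ∈ Y \ Z.erase v ↔ u = v ∨ u ∈ Y \ Z := by
    intro u
    simp only [Finset.mem_sdiff, Finset.mem_erase]
    have : u = v → u ∈ Y := by rintro rfl; exact h.subset hv
    tauto
  have hvS : v ∉ Y \ Z := by simp [hv]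
  have hne : ∀ u ∈ Y \ Z, u ≠ v := by
    rintro u hu rfl
    exact hvS hu
  constructor
  · exact (Finset.erase_subset _ _).trans h.subset
  · exact fun u hu => h.disjoint u (Finset.mem_of_mem_erase hu)
  · constructor
    · rintro u w (h' | ⟨rfl, -, -, h'⟩)
      · exact ⟨(h.reserved.out_imp u w h').1, (hS u).2 (Or.inr (h.reserved.out_imp u w h').2)⟩
      · exact ⟨h', (hS u).2 (Or.inl rfl)⟩
    · rintro w u (h' | ⟨rfl, -, -, h'⟩)
      · exact ⟨(h.reserved.in_imp w u h').1, (hS u).2 (Or.inr (h.reserved.in_imp w u h').2)⟩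
      · exact ⟨h', (hS u).2 (Or.inl rfl)⟩
    · intro u hu
      rcases (hS u).1 hu with rfl | hu
      -- `X ∪ Z` costs `d / 50 + d / 250` arcs and the used ones are at most `d / 50 + 4`
      · have h1 := outCount_le_reserveOut E (UsedBy G l) O (X ∪ Z) u
        unfold arcCount at *
        omega
      · refine (h.reserved.outBig u hu).trans (Nat.mul_le_mul_left _ (outCount_imp _ _ fun w => ?_))
        exact Or.inl
    · intro u hu
      rcases (hS u).1 hu with rfl | hu
      · have h1 := inCount_le_reserveIn E (UsedBy G l) J (X ∪ Z) u
        unfold arcCount at *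
        omega
      · refine (h.reserved.inBig u hu).trans (Nat.mul_le_mul_left _ (inCount_imp _ _ fun w => ?_))
        exact Or.inl
    · intro u hu x hx
      rcases (hS u).1 hu with rfl | huS
      · rw [Function.update_self]
        rcases hx with hx | ⟨rfl, hx, -⟩
        · exact in_mem_arcsAt (Finset.mem_union_left _ (h.pendOut u hv x hx))
            (h.reserved.out_imp x u hx).1
        · exact absurd (Finset.mem_union_right _ hv) hx
      · rw [Function.update_of_ne (hne u huS)]
        rcases hx with hx | ⟨rfl, hx, -, hE⟩
        · exact h.reserved.land u huS x hx
        · exact h.futIn u huS (fun h' => hx (Finset.mem_union_left _ h')) x hv hE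
    · intro u hu x hx
      rcases (hS u).1 hu with rfl | huS
      · rw [Function.update_self]
        rcases hx with hx | ⟨rfl, hx, -⟩
        · exact out_mem_arcsAt (Finset.mem_union_left _ (h.pendIn u hv x hx))
            (h.reserved.in_imp u x hx).1
        · exact absurd (Finset.mem_union_right _ hv) hx
      · rw [Function.update_of_ne (hne u huS)]
        rcases hx with hx | ⟨rfl, hx, -, hE⟩
        · exact h.reserved.leave u huS x hx
        · exact h.futOut u huS (fun h' => hx (Finset.mem_union_left _ h')) x hv hE
    · intro u hu
      rcases (hS u).1 hu with rfl | hu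
      · rw [Function.update_self]
        have := card_arcsAt_le E (X ∪ Z) u
        omega
      · rw [Function.update_of_ne (hne u hu)]
        exact h.reserved.few u hu
  · rintro P hP u w (⟨hO, hw⟩ | ⟨hJ, hw⟩)
    · rcases hO with hO | ⟨rfl, -, hO, -⟩
      · rw [Function.update_of_ne (hne u (h.reserved.out_imp u w hO).2)]
        exact h.guarded P hP u w (Or.inl ⟨hO, hw⟩)
      · exact absurd ⟨P, hP, hw⟩ hO
    · rcases hJ with hJ | ⟨rfl, -, hJ, -⟩
      · rw [Function.update_of_ne (hne u (h.reserved.in_imp w u hJ).2)]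
        exact h.guarded P hP u w (Or.inr ⟨hJ, hw⟩)
      · exact absurd ⟨P, hP, hw⟩ hJ
  · rintro z hz u (hu | ⟨rfl, hu, -⟩)
    · exact h.pendOut z (Finset.mem_of_mem_erase hz) u hu
    · exact absurd (Finset.mem_union_right _ (Finset.mem_of_mem_erase hz)) hu
  · rintro z hz u (hu | ⟨rfl, hu, -⟩)
    · exact h.pendIn z (Finset.mem_of_mem_erase hz) u hu
    · exact absurd (Finset.mem_union_right _ (Finset.mem_of_mem_erase hz)) hu
  · intro u hu huX z hz hE
    have hz' := Finset.mem_of_mem_erase hz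
    rcases (hS u).1 hu with rfl | hu
    · rw [Function.update_self]
      exact in_mem_arcsAt (Finset.mem_union_right _ hz') hE
    · rw [Function.update_of_ne (hne u hu)]
      exact h.futIn u hu huX z hz' hE
  · intro u hu huX z hz hE
    have hz' := Finset.mem_of_mem_erase hz
    rcases (hS u).1 hu with rfl | hu
    · rw [Function.update_self]
      exact out_mem_arcsAt (Finset.mem_union_right _ hz') hE
    · rw [Function.update_of_ne (hne u hu)]
      exact h.futOut u hu huX z hz' hE

/-- The reservations of the vertices that stay in the set start the peeling procedure for the
others. -/
theorem Reserved.peeling {G : Network n} {l : List (List (Fin n))} {E : Fin n → Fin n → Prop}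
    {d : ℕ} {X Y : Finset (Fin n)} {O J O' J' : Fin n → Fin n → Prop}
    {I : Fin n → Finset (Fin n × Fin n)} (h : Reserved E d X O J I) (hG : Guarded G l O J I)
    (hO : ∀ u v, O' u v ↔ O u v ∧ u ∈ Y) (hJ : ∀ u v, J' u v ↔ J u v ∧ v ∈ Y) :
    Peeling G l E d (X ∩ Y) Y (Y \ X) O' J' I := by
  have hS : ∀ v, v ∈ Y \ (Y \ X) ↔ v ∈ X ∧ v ∈ Y := by
    intro v
    simp only [Finset.mem_sdiff]
    tauto
  constructor
  · exact Finset.sdiff_subset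
  · intro v hv hv'
    exact (Finset.mem_sdiff.1 hv).2 (Finset.mem_inter.1 hv').1
  · constructor
    · intro u v huv
      obtain ⟨h1, h2⟩ := (hO u v).1 huv
      exact ⟨(h.out_imp u v h1).1, (hS u).2 ⟨(h.out_imp u v h1).2, h2⟩⟩
    · intro u v huv
      obtain ⟨h1, h2⟩ := (hJ u v).1 huv
      exact ⟨(h.in_imp u v h1).1, (hS v).2 ⟨(h.in_imp u v h1).2, h2⟩⟩
    · intro v hv
      obtain ⟨h1, h2⟩ := (hS v).1 hv
      exact (h.outBig v h1).trans (Nat.mul_le_mul_left _ (outCount_imp _ _ fun w hw =>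
        (hO v w).2 ⟨hw, h2⟩))
    · intro v hv
      obtain ⟨h1, h2⟩ := (hS v).1 hv
      exact (h.inBig v h1).trans (Nat.mul_le_mul_left _ (inCount_imp _ _ fun w hw =>
        (hJ w v).2 ⟨hw, h2⟩))
    · exact fun v hv u hu => h.land v ((hS v).1 hv).1 u ((hO u v).1 hu).1
    · exact fun v hv u hu => h.leave v ((hS v).1 hv).1 u ((hJ v u).1 hu).1
    · exact fun v hv => h.few v ((hS v).1 hv).1
  · rintro P hP v w (⟨h1, h2⟩ | ⟨h1, h2⟩)
    · exact hG P hP v w (Or.inl ⟨((hO v w).1 h1).1, h2⟩)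
    · exact hG P hP v w (Or.inr ⟨((hJ w v).1 h1).1, h2⟩)
  · intro v _ u hu
    obtain ⟨h1, h2⟩ := (hO u v).1 hu
    exact Finset.mem_inter.2 ⟨(h.out_imp u v h1).2, h2⟩
  · intro v _ u hu
    obtain ⟨h1, h2⟩ := (hJ v u).1 hu
    exact Finset.mem_inter.2 ⟨(h.in_imp v u h1).2, h2⟩
  · exact fun v hv hv' => absurd (Finset.mem_inter.2 ((hS v).1 hv)) hv'
  · exact fun v hv hv' => absurd (Finset.mem_inter.2 ((hS v).1 hv)) hv'

end Reservations

/-! ### Few of the reserved arcs are in use -/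

section Available

variable {n : ℕ}

/-- By edge-disjointness, each arc of `I` accounts for at most one path. -/
theorem countP_pays_le {G : Network n} {l : List (List (Fin n))} (hl : l.Pairwise G.EdgeDisjoint)
    (I : Finset (Fin n × Fin n)) (v : Fin n) [DecidablePred fun P => Pays G P I v] :
    l.countP (fun P => Pays G P I v) ≤ endpointCount (l : Multiset (List (Fin n))) v + I.card := by
  classical
  have h1 : ∀ e : Fin n × Fin n, l.countP (fun P => decide (Uses G P e.1 e.2)) ≤ 1 := by
    intro e
    refine countP_le_one _ _ (hl.imp fun {P Q} hPQ h => ?_)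
    obtain ⟨⟨x, hx, hx'⟩, y, hy, hy'⟩ := And.imp of_decide_eq_true of_decide_eq_true h
    exact hPQ x hx y hy (hx'.trans hy'.symm)
  have h2 : ∀ l : List (List (Fin n)), l.countP (fun P => decide (Pays G P I v)) ≤
      l.countP (fun P => decide (P.head? = some v ∨ P.getLast? = some v)) +
        ∑ e ∈ I, l.countP (fun P => decide (Uses G P e.1 e.2)) := by
    intro l
    induction l with
    | nil => simp
    | cons P l ih =>
      simp only [List.countP_cons, Finset.sum_add_distrib]
      suffices h : (if decide (Pays G P I v) = true then 1 else 0) ≤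
          (if decide (P.head? = some v ∨ P.getLast? = some v) = true then 1 else 0) +
            ∑ e ∈ I, if decide (Uses G P e.1 e.2) = true then 1 else 0 by omega
      by_cases hp : Pays G P I v
      · rcases hp with hp | ⟨e, he, hp⟩
        · have : (P.head? = some v ∨ P.getLast? = some v) := hp
          simp only [this, decide_true, if_true]
          split_ifs <;> omega
        · have h3 := Finset.single_le_sum (f := fun e : Fin n × Fin n =>
            if decide (Uses G P e.1 e.2) = true then 1 else 0) (fun _ _ => Nat.zero_le _) he
          simp only [hp, decide_true, if_true] at h3
          refine le_trans ?_ (Nat.le_add_left _ _)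
          refine le_trans ?_ h3
          split_ifs <;> omega
      · simp [hp]
  have h3 : endpointCount (l : Multiset (List (Fin n))) v =
      l.countP (fun P => decide (P.head? = some v ∨ P.getLast? = some v)) := by
    unfold endpointCount
    rw [Multiset.coe_countP]
  rw [h3]
  refine le_trans (le_of_eq ?_) ((h2 l).trans (Nat.add_le_add_left
    ((Finset.sum_le_card_nsmul _ _ 1 fun e _ => h1 e).trans (by simp)) _))
  congr!

theorem outCount_eq_zero {R : Fin n → Fin n → Prop} (S : Finset (Fin n)) {v : Fin n}
    (h : ∀ w, ¬ R v w) : outCount R S v = 0 := by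
  classical
  simp [outCount, h]

theorem inCount_eq_zero {R : Fin n → Fin n → Prop} (S : Finset (Fin n)) {v : Fin n}
    (h : ∀ w, ¬ R w v) : inCount R S v = 0 := by
  classical
  simp [inCount, h]

theorem sum_map_le_mul_countP {α : Type*} (l : List α) (f : α → ℕ) (p : α → Prop) [DecidablePred p]
    (c : ℕ) (h : ∀ a ∈ l, f a ≤ if p a then c else 0) :
    (l.map f).sum ≤ c * l.countP (fun a => p a) := by
  induction l with
  | nil => simp
  | cons a l ih =>
    rw [List.map_cons, List.sum_cons, List.countP_cons]
    have h1 := h a List.mem_cons_self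
    have h2 := ih fun b hb => h b (List.mem_cons_of_mem _ hb)
    by_cases hp : p a
    · simp only [hp, if_true, decide_true] at h1 ⊢
      rw [Nat.mul_add]
      omega
    · simp only [hp, if_false, decide_false] at h1 ⊢
      simp
      omega

/-- If only paths with the property `p` use out-arcs of `v` that `O` assigns to it, then at most two
such arcs per path are in use. -/
theorem outCount_owned_used_le {G : Network n} {l : List (List (Fin n))} (O : Fin n → Fin n → Prop)
    (v : Fin n) (hl : ∀ P ∈ l, P.Nodup) (p : List (Fin n) → Prop) [DecidablePred p]
    (h : ∀ P ∈ l, ∀ w, O v w → Uses G P v w → p P) :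
    outCount (fun u w => O u w ∧ UsedBy G l u w) Finset.univ v ≤ 2 * l.countP (fun P => p P) := by
  classical
  refine le_trans ?_ (sum_map_le_mul_countP l
    (fun P => outCount (fun u w => O u w ∧ Uses G P u w) Finset.univ v) p 2 ?_)
  · clear h hl
    induction l with
    | nil => simp [outCount, UsedBy]
    | cons P l ih =>
      rw [List.map_cons, List.sum_cons]
      refine le_trans (outCount_imp _ _ ?_) ((outCount_or_le (fun u w => O u w ∧ Uses G P u w)
        (fun u w => O u w ∧ UsedBy G l u w) _ _).trans (Nat.add_le_add_left ih _))
      rintro w ⟨hO, Q, hQ, h⟩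
      rcases List.mem_cons.1 hQ with rfl | hQ
      · exact Or.inl ⟨hO, h⟩
      · exact Or.inr ⟨hO, Q, hQ, h⟩
  · intro P hP
    split_ifs with hp
    · exact (outCount_imp _ _ fun w h => h.2).trans (outCount_uses_le (hl P hP) v)
    · exact (outCount_eq_zero _ fun w hw => hp (h P hP w hw.1 hw.2)).le

theorem inCount_owned_used_le {G : Network n} {l : List (List (Fin n))} (J : Fin n → Fin n → Prop)
    (v : Fin n) (hl : ∀ P ∈ l, P.Nodup) (p : List (Fin n) → Prop) [DecidablePred p]
    (h : ∀ P ∈ l, ∀ w, J w v → Uses G P w v → p P) :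
    inCount (fun u w => J u w ∧ UsedBy G l u w) Finset.univ v ≤ 2 * l.countP (fun P => p P) := by
  classical
  refine le_trans ?_ (sum_map_le_mul_countP l
    (fun P => inCount (fun u w => J u w ∧ Uses G P u w) Finset.univ v) p 2 ?_)
  · clear h hl
    induction l with
    | nil => simp [inCount, UsedBy]
    | cons P l ih =>
      rw [List.map_cons, List.sum_cons]
      refine le_trans (inCount_imp _ _ ?_) ((inCount_or_le (fun u w => J u w ∧ Uses G P u w)
        (fun u w => J u w ∧ UsedBy G l u w) _ _).trans (Nat.add_le_add_left ih _))
      rintro w ⟨hO, Q, hQ, h⟩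
      rcases List.mem_cons.1 hQ with rfl | hQ
      · exact Or.inl ⟨hO, h⟩
      · exact Or.inr ⟨hO, Q, hQ, h⟩
  · intro P hP
    split_ifs with hp
    · exact (inCount_imp _ _ fun w h => h.2).trans (inCount_uses_le (hl P hP) v)
    · exact (inCount_eq_zero _ fun w hw => hp (h P hP w hw.1 hw.2)).le

/-- At most `d / 10` of the arcs owned by a vertex are in use, so it keeps at least `4 d / 5`
unused ones: at most `d / 200 + 1` paths end at `v`, at most `d / 40` paths use an arc of `I v`,
and each of them uses at most two of the arcs. -/
theorem Reserved.available {G : Network n} {l : List (List (Fin n))} {E : Fin n → Fin n → Prop}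
    {d : ℕ} {X : Finset (Fin n)} {O J : Fin n → Fin n → Prop} {I : Fin n → Finset (Fin n × Fin n)}
    (h : Reserved E d X O J I) (hG : Guarded G l O J I) (hd : 200 ≤ d)
    (hl : l.Pairwise G.EdgeDisjoint) (hnd : ∀ P ∈ l, P.Nodup) {v : Fin n} (hv : v ∈ X)
    (hend : 200 * endpointCount (l : Multiset (List (Fin n))) v ≤ d + 200) :
    8 * d ≤ 10 * outCount (fun u w => O u w ∧ ¬ UsedBy G l u w) Finset.univ v ∧
      8 * d ≤ 10 * inCount (fun u w => J u w ∧ ¬ UsedBy G l u w) Finset.univ v := by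
  classical
  have h1 := countP_pays_le hl (I v) v
  have h2 := outCount_owned_used_le (G := G) (l := l) O v hnd (fun P => Pays G P (I v) v)
    fun P hP w hO hU => hG P hP v w (Or.inl ⟨hO, hU⟩)
  have h3 := inCount_owned_used_le (G := G) (l := l) J v hnd (fun P => Pays G P (I v) v)
    fun P hP w hO hU => hG P hP v w (Or.inr ⟨hO, hU⟩)
  have h4 := h.few v hv
  have h5 := h.outBig v hv
  have h6 := h.inBig v hv
  have h7 : outCount O Finset.univ v ≤ outCount (fun u w => O u w ∧ UsedBy G l u w) Finset.univ v +
      outCount (fun u w => O u w ∧ ¬ UsedBy G l u w) Finset.univ v := by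
    refine le_trans (outCount_imp _ _ fun w hw => ?_) (outCount_or_le _ _ _ _)
    by_cases hc : UsedBy G l v w
    · exact Or.inl ⟨hw, hc⟩
    · exact Or.inr ⟨hw, hc⟩
  have h8 : inCount J Finset.univ v ≤ inCount (fun u w => J u w ∧ UsedBy G l u w) Finset.univ v +
      inCount (fun u w => J u w ∧ ¬ UsedBy G l u w) Finset.univ v := by
    refine le_trans (inCount_imp _ _ fun w hw => ?_) (inCount_or_le _ _ _ _)
    by_cases hc : UsedBy G l w v
    · exact Or.inl ⟨hw, hc⟩
    · exact Or.inr ⟨hw, hc⟩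
  constructor <;> omega

/-- Few of the arcs at `v` are owned by other vertices. -/
theorem Reserved.land_le {E : Fin n → Fin n → Prop} {d : ℕ} {X : Finset (Fin n)}
    {O J : Fin n → Fin n → Prop} {I : Fin n → Finset (Fin n × Fin n)} (h : Reserved E d X O J I)
    {v : Fin n} (hv : v ∈ X) :
    40 * inCount O Finset.univ v ≤ d ∧ 40 * outCount J Finset.univ v ≤ d := by
  classical
  have h4 := h.few v hv
  have h1 : inCount O Finset.univ v ≤ (I v).card := by
    refine Finset.card_le_card_of_injOn (fun u => (u, v)) ?_ ?_
    · intro u hu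
      exact h.land v hv u (Finset.mem_filter.1 hu).2
    · intro u _ w _ huw
      exact (Prod.mk.inj huw).1
  have h2 : outCount J Finset.univ v ≤ (I v).card := by
    refine Finset.card_le_card_of_injOn (fun u => (v, u)) ?_ ?_
    · intro u hu
      exact h.leave v hv u (Finset.mem_filter.1 hu).2
    · intro u _ w _ huw
      exact (Prod.mk.inj huw).2
  omega

end Available

/-! ### Growth of balls -/

section Growth

/-- There is a walk of exactly `k` steps from `x` to `y`. -/
def Steps {α : Type*} (R : α → α → Prop) : ℕ → α → α → Prop
  | 0, x, y => x = y
  | k + 1, x, y => ∃ z, Steps R k x z ∧ R z y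

theorem Steps.trans {α : Type*} {R : α → α → Prop} {j k : ℕ} {x y z : α} (h : Steps R j x y)
    (h' : Steps R k y z) : Steps R (j + k) x z := by
  induction k generalizing z with
  | zero => exact h' ▸ h
  | succ k ih =>
    obtain ⟨w, hw, hz⟩ := h'
    exact ⟨w, ih hw, hz⟩

theorem Steps.map {α β : Type*} {R : α → α → Prop} {R' : β → β → Prop} (f : α → β)
    (hf : ∀ x y, R x y → R' (f x) (f y)) {k : ℕ} {x y : α} (h : Steps R k x y) :
    Steps R' k (f x) (f y) := by
  induction k generalizing y with
  | zero => exact congrArg f h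
  | succ k ih =>
    obtain ⟨w, hw, hz⟩ := h
    exact ⟨f w, ih hw, hf _ _ hz⟩

theorem Steps.flip {α : Type*} {R : α → α → Prop} {k : ℕ} {x y : α}
    (h : Steps (fun u v => R v u) k x y) : Steps R k y x := by
  induction k generalizing y with
  | zero => exact h.symm
  | succ k ih =>
    obtain ⟨w, hw, hz⟩ := h
    have h1 : Steps R 1 y w := ⟨y, rfl, hz⟩
    rw [Nat.add_comm]
    exact h1.trans (ih hw)

theorem Steps.reaches {n : ℕ} {T : Fin n × Bool → Fin n × Bool → Prop} {b : Fin n} {k : ℕ}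
    {x y : Fin n × Bool} (h : Steps T k x y) {j : ℕ} (hy : Reaches T b j y) :
    Reaches T b (k + j) x := by
  induction k generalizing y j with
  | zero =>
    subst h
    simpa using hy
  | succ k ih =>
    obtain ⟨w, hw, hz⟩ := h
    rw [Nat.add_right_comm]
    exact ih (j := j + 1) hw ⟨y, hz, hy⟩

variable {n : ℕ}

open Classical in
/-- The vertices reached from `a` by at most `k` steps. -/
noncomputable def ball (R : Fin n → Fin n → Prop) (a : Fin n) (k : ℕ) : Finset (Fin n) :=
  Finset.univ.filter fun v => ∃ j ≤ k, Steps R j a v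

theorem mem_ball {R : Fin n → Fin n → Prop} {a v : Fin n} {k : ℕ} :
    v ∈ ball R a k ↔ ∃ j ≤ k, Steps R j a v := by
  simp [ball]

theorem self_mem_ball (R : Fin n → Fin n → Prop) (a : Fin n) (k : ℕ) : a ∈ ball R a k :=
  mem_ball.2 ⟨0, Nat.zero_le _, rfl⟩

theorem ball_mono (R : Fin n → Fin n → Prop) (a : Fin n) {j k : ℕ} (h : j ≤ k) :
    ball R a j ⊆ ball R a k := by
  intro v hv
  obtain ⟨i, hi, hs⟩ := mem_ball.1 hv
  exact mem_ball.2 ⟨i, hi.trans h, hs⟩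

theorem mem_ball_succ {R : Fin n → Fin n → Prop} {a u v : Fin n} {k : ℕ} (hu : u ∈ ball R a k)
    (h : R u v) : v ∈ ball R a (k + 1) := by
  obtain ⟨i, hi, hs⟩ := mem_ball.1 hu
  exact mem_ball.2 ⟨i + 1, by omega, u, hs, h⟩

/-- If every vertex of `X` has out-degree at least `4 d / 5` and in-degree at most `d / 40`, balls
inside `X` double in each step, so one cannot stay in `X` for long. -/
theorem exists_steps_notMem {R : Fin n → Fin n → Prop} {d : ℕ} (hd : 0 < d) {X : Finset (Fin n)}
    (hout : ∀ v ∈ X, 8 * d ≤ 10 * outCount R Finset.univ v)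
    (hin : ∀ v ∈ X, 40 * inCount R Finset.univ v ≤ d) (a : Fin n) :
    ∃ j ≤ Nat.log 2 n + 1, ∃ v ∉ X, Steps R j a v := by
  classical
  by_contra hcon
  have hX : ∀ k ≤ Nat.log 2 n + 1, ball R a k ⊆ X := by
    intro k hk v hv
    obtain ⟨j, hj, hs⟩ := mem_ball.1 hv
    by_contra hvX
    exact hcon ⟨j, hj.trans hk, v, hvX, hs⟩
  have hgrow : ∀ k ≤ Nat.log 2 n + 1, 2 ^ k ≤ (ball R a k).card := by
    intro k
    induction k with
    | zero =>
      intro _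
      exact Finset.card_pos.2 ⟨a, self_mem_ball _ _ _⟩
    | succ k ih =>
      intro hk
      have h1 := ih (by omega)
      set B := ball R a k with hB
      set B' := ball R a (k + 1) with hB'
      have h2 : ∀ v ∈ B, 8 * d ≤ 10 * outCount R B' v := by
        intro v hv
        refine (hout v (hX k (by omega) hv)).trans (Nat.mul_le_mul_left _ ?_)
        refine Finset.card_le_card fun w hw => ?_
        rw [Finset.mem_filter] at hw ⊢
        exact ⟨mem_ball_succ hv hw.2, hw.2⟩
      have h3 : ∀ w ∈ B', 40 * inCount R B w ≤ d := fun w hw =>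
        (Nat.mul_le_mul_left _ (inCount_mono R (Finset.subset_univ _) w)).trans
          (hin w (hX _ hk hw))
      have h4 := Finset.card_nsmul_le_sum _ _ _ h2
      have h5 := Finset.sum_le_card_nsmul _ _ _ h3
      rw [← Finset.mul_sum, smul_eq_mul] at h4 h5
      rw [sum_outCount] at h4
      have h6 : 2 * B.card ≤ B'.card := by
        refine Nat.le_of_mul_le_mul_left (c := d) ?_ hd
        nlinarith
      rw [pow_succ]
      omega
  have h1 := hgrow _ le_rfl
  have h2 : (ball R a (Nat.log 2 n + 1)).card ≤ n := (Finset.card_le_univ _).trans (by simp)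
  have h3 := Nat.lt_pow_succ_log_self (b := 2) (by norm_num) n
  omega

theorem innerCount_flip (R : Fin n → Fin n → Prop) (S : Finset (Fin n)) :
    innerCount (fun u v => R v u) S = innerCount R S := by
  unfold innerCount
  exact (sum_outCount R S S).symm

theorem Expanding.flip {E : Fin n → Fin n → Prop} {d m : ℕ} (h : Expanding E d m) :
    Expanding (fun u v => E v u) d m :=
  ⟨h.in_eq, h.out_eq, fun S hS => by rw [innerCount_flip]; exact h.sparse S hS,
    fun S hS => by rw [innerCount_flip]; exact h.expand S hS⟩

theorem IsClosedUnder.flip {E U : Fin n → Fin n → Prop} {d : ℕ} {C : Finset (Fin n)}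
    (h : IsClosedUnder E U d C) :
    IsClosedUnder (fun u v => E v u) (fun u v => U v u) d C := by
  intro v hv
  obtain ⟨h1, h2⟩ := h v hv
  unfold arcCount at *
  exact ⟨by rw [add_comm]; exact h1, by rw [add_comm]; exact h2⟩

/-- Outside a closed set, balls of unused arcs grow by a factor `5 / 4` until they contain more
than half of the vertices: at least `d / 3` arcs per vertex leave the ball, of which at most `d /
50` lead to `X` and at most `d / 50` are used. -/
theorem Expanding.card_ball {E U : Fin n → Fin n → Prop} {d m : ℕ} (hE : Expanding E d m)
    (hd : 0 < d) {X : Finset (Fin n)} (hX : IsClosedUnder E U d X) {a : Fin n} (ha : a ∉ X) :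
    n < 2 * (ball (fun u v => E u v ∧ ¬ U u v ∧ u ∉ X ∧ v ∉ X) a (4 * (Nat.log 2 n + 1))).card := by
  classical
  set R : Fin n → Fin n → Prop := fun u v => E u v ∧ ¬ U u v ∧ u ∉ X ∧ v ∉ X with hR
  by_contra hcon
  have hball : ∀ k v, v ∈ ball R a k → v ∉ X := by
    intro k v hv
    obtain ⟨j, -, hs⟩ := mem_ball.1 hv
    cases j with
    | zero => exact hs ▸ ha
    | succ j =>
      obtain ⟨w, -, hw⟩ := hs
      exact hw.2.2.2
  have hgrow : ∀ k < 4 * (Nat.log 2 n + 1),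
      5 * (ball R a k).card ≤ 4 * (ball R a (k + 1)).card := by
    intro k hk
    have hsub := ball_mono R a (Nat.le_succ k)
    set S := ball R a k with hS
    set S' := ball R a (k + 1) with hS'
    have h1 : ∀ v ∈ S, d ≤ outCount E S v + outCount E (S' \ S) v +
        (outCount E X v + outCount U Finset.univ v) := by
      intro v hv
      rw [← hE.out_eq v]
      simp only [outCount]
      refine le_trans (Finset.card_le_card ?_) ((Finset.card_union_le _ _).trans
        (add_le_add (Finset.card_union_le _ _) (Finset.card_union_le _ _)))
      intro w hw
      simp only [Finset.mem_union, Finset.mem_filter, Finset.mem_univ, true_and,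
        Finset.mem_sdiff] at hw ⊢
      by_cases hU : U v w
      · exact Or.inr (Or.inr hU)
      by_cases hw' : w ∈ X
      · exact Or.inr (Or.inl ⟨hw', hw⟩)
      by_cases hwS : w ∈ S
      · exact Or.inl (Or.inl ⟨hwS, hw⟩)
      · exact Or.inl (Or.inr ⟨⟨mem_ball_succ hv ⟨hw, hU, hball k v hv, hw'⟩, hwS⟩, hw⟩)
    have h2 : ∀ v ∈ S, 25 * d ≤ 25 * (outCount E S v + outCount E (S' \ S) v) + d := by
      intro v hv
      obtain ⟨g1, g2⟩ := hX v (hball k v hv)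
      have := h1 v hv
      unfold arcCount at g1 g2
      omega
    have h3 := Finset.sum_le_sum h2
    rw [Finset.sum_add_distrib, ← Finset.mul_sum, ← Finset.mul_sum, Finset.sum_add_distrib,
      Finset.sum_const, smul_eq_mul, sum_outCount E S (S' \ S)] at h3
    have h4 : ∑ w ∈ S' \ S, inCount E S w ≤ (S' \ S).card * d := by
      refine Finset.sum_le_card_nsmul _ _ _ fun w _ => ?_
      rw [← hE.in_eq w]
      exact inCount_mono E (Finset.subset_univ _) w
    have h5 : 3 * innerCount E S ≤ 2 * d * S.card := by
      refine hE.expand S ?_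
      have h0 : S.card ≤ _ := Finset.card_le_card (ball_mono R a hk.le)
      omega
    unfold innerCount at h5
    have h6 : (S' \ S).card = S'.card - S.card := Finset.card_sdiff_of_subset hsub
    have h7 := Finset.card_le_card hsub
    obtain ⟨c, hc⟩ := Nat.exists_eq_add_of_le h7
    rw [hc] at h6 ⊢
    have h8 : S.card ≤ 4 * c := by
      refine Nat.le_of_mul_le_mul_left (c := d) ?_ hd
      rw [show (S' \ S).card = c by omega] at h4
      nlinarith
    omega
  have hpow : ∀ k ≤ 4 * (Nat.log 2 n + 1), 5 ^ k ≤ 4 ^ k * (ball R a k).card := by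
    intro k
    induction k with
    | zero =>
      intro _
      simpa using Finset.card_pos.2 ⟨a, self_mem_ball R a 0⟩
    | succ k ih =>
      intro hk
      have h1 := ih (by omega)
      have h2 := hgrow k (by omega)
      calc 5 ^ (k + 1) = 5 ^ k * 5 := pow_succ _ _
        _ ≤ (4 ^ k * (ball R a k).card) * 5 := Nat.mul_le_mul_right _ h1
        _ = 4 ^ k * (5 * (ball R a k).card) := by ring
        _ ≤ 4 ^ k * (4 * (ball R a (k + 1)).card) := Nat.mul_le_mul_left _ h2
        _ = 4 ^ (k + 1) * (ball R a (k + 1)).card := by ring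
  have h1 := hpow _ le_rfl
  have h2 : (ball R a (4 * (Nat.log 2 n + 1))).card ≤ n := (Finset.card_le_univ _).trans (by simp)
  have h3 := Nat.lt_pow_succ_log_self (b := 2) (by norm_num) n
  -- four steps double the ball, as `2 * 4 ^ 4 ≤ 5 ^ 4`
  have h4 : 4 ^ (4 * (Nat.log 2 n + 1)) * 2 ^ (Nat.log 2 n + 1) ≤ 5 ^ (4 * (Nat.log 2 n + 1)) := by
    rw [pow_mul, pow_mul, ← mul_pow]
    exact Nat.pow_le_pow_left (by norm_num) _
  have h5 : 2 ^ (Nat.log 2 n + 1) ≤ (ball R a (4 * (Nat.log 2 n + 1))).card :=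
    Nat.le_of_mul_le_mul_left (h4.trans h1) (by positivity)
  omega

/-- Outside a closed set, any two vertices are joined by a short walk of unused arcs, since an
out-ball of the first meets an in-ball of the second. -/
theorem Expanding.exists_steps {E U : Fin n → Fin n → Prop} {d m : ℕ} (hE : Expanding E d m)
    (hd : 0 < d) {X : Finset (Fin n)} (hX : IsClosedUnder E U d X) {a b : Fin n} (ha : a ∉ X)
    (hb : b ∉ X) :
    ∃ j ≤ 8 * (Nat.log 2 n + 1), Steps (fun u v => E u v ∧ ¬ U u v ∧ u ∉ X ∧ v ∉ X) j a b := by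
  classical
  have h1 := hE.card_ball hd hX ha
  have h2 := hE.flip.card_ball hd hX.flip hb
  set A := ball (fun u v => E u v ∧ ¬ U u v ∧ u ∉ X ∧ v ∉ X) a (4 * (Nat.log 2 n + 1))
  set B := ball (fun u v => E v u ∧ ¬ U v u ∧ u ∉ X ∧ v ∉ X) b (4 * (Nat.log 2 n + 1))
  have h3 : (A ∩ B).Nonempty := by
    rw [← Finset.card_pos]
    have h4 := Finset.card_union_add_card_inter A B
    have h5 : (A ∪ B).card ≤ n := (Finset.card_le_univ _).trans (by simp)
    omega
  obtain ⟨v, hv⟩ := h3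
  rw [Finset.mem_inter] at hv
  obtain ⟨j, hj, hs⟩ := mem_ball.1 hv.1
  obtain ⟨k, hk, ht⟩ := mem_ball.1 hv.2
  have ht' : Steps (fun u v => E u v ∧ ¬ U u v ∧ u ∉ X ∧ v ∉ X) k v b :=
    Steps.flip (ht.map id fun x y h => ⟨h.1, h.2.1, h.2.2.2, h.2.2.1⟩)
  exact ⟨j + k, by omega, hs.trans ht'⟩

/-- The search succeeds: leave `X` along arcs reserved by their tails, walk outside `X`, and enter
`X` along arcs reserved by their heads. -/
theorem Expanding.exists_reaches {G : Network n} {l : List (List (Fin n))}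
    {E : Fin n → Fin n → Prop} {d m : ℕ} {X : Finset (Fin n)} {O J : Fin n → Fin n → Prop}
    {I : Fin n → Finset (Fin n × Fin n)} (hE : Expanding E d m)
    (h : Reserved E d X O J I) (hG : Guarded G l O J I) (hd : 200 ≤ d)
    (hX : IsClosedUnder E (UsedBy G l) d X)
    (hl : l.Pairwise G.EdgeDisjoint) (hnd : ∀ P ∈ l, P.Nodup)
    (hend : ∀ v, 200 * endpointCount (l : Multiset (List (Fin n))) v ≤ d + 200) (a b : Fin n) :
    ∃ L ≤ 10 * (Nat.log 2 n + 1),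
      Reaches (Trans (forwardArc E (UsedBy G l) O X) (backwardArc (UsedBy G l) J)) b L
        (a, false) := by
  obtain ⟨i, hi, a', ha', h1⟩ := exists_steps_notMem (R := fun u w => O u w ∧ ¬ UsedBy G l u w)
    (by omega : 0 < d) (fun v hv => (h.available hG hd hl hnd hv (hend v)).1)
    (fun v hv => (Nat.mul_le_mul_left _ (inCount_imp _ _ fun _ hw => hw.1)).trans (h.land_le hv).1) a
  obtain ⟨k, hk, b', hb', h3⟩ := exists_steps_notMem (R := fun u w => J w u ∧ ¬ UsedBy G l w u)
    (by omega : 0 < d) (fun v hv => (h.available hG hd hl hnd hv (hend v)).2)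
    (fun v hv => (Nat.mul_le_mul_left _ (outCount_imp (R := fun u w => J u w ∧ ¬ UsedBy G l u w) _ _
      fun _ hw => hw.1)).trans (h.land_le hv).2) b
  obtain ⟨j, hj, h2⟩ := hE.exists_steps (by omega) hX ha' hb'
  set T := Trans (forwardArc E (UsedBy G l) O X) (backwardArc (UsedBy G l) J) with hT
  have g1 : Steps T i (a, false) (a', false) := h1.map (fun v => (v, false)) fun x y hxy => by
    simp only [hT, Trans]
    exact ⟨trivial, hxy.2, Or.inl hxy.1⟩
  have g2 : Steps T j (a', false) (b', false) := h2.map (fun v => (v, false)) fun x y hxy => by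
    simp only [hT, Trans]
    exact ⟨trivial, hxy.2.1, Or.inr ⟨hxy.1, hxy.2.2⟩⟩
  have g3 : ∃ p, Steps T k (b', false) (b, p) := by
    have h4 : Steps (fun u w => J u w ∧ ¬ UsedBy G l u w) k b' b := Steps.flip h3
    clear h3 hk
    induction k generalizing b with
    | zero => exact ⟨false, by rw [show b' = b from h4]; rfl⟩
    | succ k ih =>
      obtain ⟨w, hw, hwb⟩ := h4
      obtain ⟨p, hp⟩ := ih w hw
      exact ⟨true, (w, p), hp, by simp only [hT, Trans, if_true]; exact ⟨hwb.2, hwb.1⟩⟩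
  obtain ⟨p, g3⟩ := g3
  exact ⟨i + j + k + 0, by omega, ((g1.trans g2).trans g3).reaches rfl⟩

end Growth

/-! ### The new path -/

section NewPath

variable {n : ℕ}

/-- The vertices visited by the first `k` steps of a walk of the search. -/
def route (f : ℕ → Fin n × Bool) (k : ℕ) : List (Fin n) := (List.range (k + 1)).map fun i => (f i).1

@[simp] theorem length_route (f : ℕ → Fin n × Bool) (k : ℕ) : (route f k).length = k + 1 := by
  simp [route]

@[simp] theorem getElem_route (f : ℕ → Fin n × Bool) (k i : ℕ) (h : i < (route f k).length) :
    (route f k)[i] = (f i).1 := by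
  simp [route]

theorem head?_route (f : ℕ → Fin n × Bool) (k : ℕ) : (route f k).head? = some (f 0).1 := by
  simp [route, List.head?_range]

theorem getLast?_route (f : ℕ → Fin n × Bool) (k : ℕ) : (route f k).getLast? = some (f k).1 := by
  simp [route, List.range_succ]

theorem nodup_route {f : ℕ → Fin n × Bool} {k : ℕ}
    (hf : ∀ i ≤ k, ∀ j ≤ k, (f i).1 = (f j).1 → i = j) : (route f k).Nodup := by
  refine List.Nodup.map_on ?_ List.nodup_range
  intro i hi j hj h
  rw [List.mem_range] at hi hj
  exact hf i (by omega) j (by omega) h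

theorem length_steps (P : List (Fin n)) : (Network.steps P).length = P.length - 1 := by
  simp [Network.steps]

theorem uses_route_iff {G : Network n} {f : ℕ → Fin n × Bool} {k : ℕ} {u v : Fin n} :
    Uses G (route f k) u v ↔ ∃ i < k, Marks G.flag (f i).1 (f (i + 1)).1 u v := by
  rw [uses_iff]
  simp only [getElem_route, length_route]
  constructor
  · rintro ⟨i, hi, h⟩
    exact ⟨i, by omega, h⟩
  · rintro ⟨i, hi, h⟩
    exact ⟨i, by omega, h⟩

theorem usedBy_cons {G : Network n} {P : List (Fin n)} {l : List (List (Fin n))} {u v : Fin n} :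
    UsedBy G (P :: l) u v ↔ UsedBy G l u v ∨ Uses G P u v := by
  simp [UsedBy, or_comm]

/-- A walk of the search uses unused arcs only. -/
theorem Trans.unused {E U O J : Fin n → Fin n → Prop} {X : Finset (Fin n)} {x y : Fin n × Bool}
    (h : Trans (forwardArc E U O X) (backwardArc U J) x y) : ¬ U x.1 y.1 := by
  unfold Trans at h
  split_ifs at h
  · exact h.1
  · exact h.2.1

theorem Trans.adj {E U O J : Fin n → Fin n → Prop} {X : Finset (Fin n)} {d : ℕ}
    {I : Fin n → Finset (Fin n × Fin n)} (hR : Reserved E d X O J I) {x y : Fin n × Bool}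
    (h : Trans (forwardArc E U O X) (backwardArc U J) x y) : E x.1 y.1 := by
  unfold Trans at h
  split_ifs at h
  · exact (hR.in_imp _ _ h.2).1
  · rcases h.2.2 with h' | h'
    · exact (hR.out_imp _ _ h').1
    · exact h'.1

/-- The walk arrives at an inner vertex of `X` on an arc that is owned by the preceding vertex (in
phase `false`), or it leaves it on an arc that is owned by the following vertex (in phase `true`).
-/
theorem pays_route {G : Network n} {E U O J : Fin n → Fin n → Prop} {X : Finset (Fin n)} {d : ℕ}
    {I : Fin n → Finset (Fin n × Fin n)} (hR : Reserved E d X O J I) {f : ℕ → Fin n × Bool} {k : ℕ}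
    (hf : ∀ i < k, Trans (forwardArc E U O X) (backwardArc U J) (f i) (f (i + 1)))
    {i : ℕ} (hi : i ≤ k) (hX : (f i).1 ∈ X) : Pays G (route f k) (I (f i).1) (f i).1 := by
  rcases Nat.eq_zero_or_pos i with rfl | h0
  · exact Or.inl (Or.inl (head?_route f k))
  rcases hi.eq_or_lt with rfl | hk
  · exact Or.inl (Or.inr (getLast?_route f i))
  right
  have h1 := hf i hk
  obtain ⟨j, rfl⟩ : ∃ j, i = j + 1 := ⟨i - 1, by omega⟩
  have h2 := hf j (by omega)
  unfold Trans at h1 h2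
  cases hp : (f (j + 1)).2 with
  | false =>
    simp only [hp] at h2
    rcases h2.2.2 with h3 | h3
    · exact ⟨_, hR.land _ hX _ h3, uses_route_iff.2 ⟨j, by omega, Or.inl ⟨rfl, rfl⟩⟩⟩
    · exact absurd hX h3.2.2
  | true =>
    split_ifs at h1 with h3
    · exact ⟨_, hR.leave _ hX _ h1.2, uses_route_iff.2 ⟨j + 1, hk, Or.inl ⟨rfl, rfl⟩⟩⟩
    · rw [hp] at h1
      exact absurd h1.1 (by simp)

/-- The invariant that is kept between requests, for the family of paths `l`, the set `X` of
congested vertices and their reservations. The slack of `200` is needed because a path raises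
`endpointCount` by at most `1` and the number of used arcs at a vertex by at most `4`, while the
conditions with the bound `d` hold before it is added. -/
structure Good (G : Network n) (d L : ℕ) (l : List (List (Fin n))) (X : Finset (Fin n))
    (O J : Fin n → Fin n → Prop) : Prop where
  disjoint : l.Pairwise G.EdgeDisjoint
  nodup : ∀ P ∈ l, P.Nodup
  length : ∀ P ∈ l, (Network.steps P).length ≤ L
  ends : ∀ v, 200 * endpointCount (l : Multiset (List (Fin n))) v ≤ d + 200
  cold : ∀ v ∉ X, 50 * arcCount (UsedBy G l) Finset.univ v ≤ d + 200 ∧ 50 * arcCount G.Adj X v ≤ d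
  exists_reserved : ∃ I, Reserved G.Adj d X O J I ∧ Guarded G l O J I

theorem EdgeDisjoint.symm {G : Network n} {P Q : List (Fin n)} (h : G.EdgeDisjoint P Q) :
    G.EdgeDisjoint Q P :=
  fun e he f hf hs => h f hf e he hs.symm

theorem not_uses_of_edgeDisjoint {G : Network n} {P Q : List (Fin n)} (h : G.EdgeDisjoint P Q)
    {u v : Fin n} (hP : Uses G P u v) : ¬ Uses G Q u v := by
  rintro ⟨f, hf, hf'⟩
  obtain ⟨e, he, he'⟩ := hP
  exact h e he f hf (he'.trans hf'.symm)

theorem arcCount_imp {R R' : Fin n → Fin n → Prop} (S : Finset (Fin n)) (v : Fin n)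
    (h : ∀ u w, R u w → R' u w) : arcCount R S v ≤ arcCount R' S v :=
  add_le_add (outCount_imp _ _ fun w => h v w) (inCount_imp _ _ fun w => h w v)

/-- Answering a request by a walk of the search keeps the invariant. -/
theorem Good.cons_route {G : Network n} {d L : ℕ} {l : List (List (Fin n))} {X : Finset (Fin n)}
    {O J : Fin n → Fin n → Prop} (h : Good G d L l X O J)
    (hX : IsClosedUnder G.Adj (UsedBy G l) d X) {f : ℕ → Fin n × Bool} {k : ℕ} (hk : k ≤ L)
    (hf : ∀ i < k, Trans (forwardArc G.Adj (UsedBy G l) O X) (backwardArc (UsedBy G l) J)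
      (f i) (f (i + 1)))
    (hinj : ∀ i ≤ k, ∀ j ≤ k, (f i).1 = (f j).1 → i = j)
    (h0 : 200 * endpointCount (l : Multiset (List (Fin n))) (f 0).1 ≤ d)
    (h1 : 200 * endpointCount (l : Multiset (List (Fin n))) (f k).1 ≤ d) :
    Good G d L (route f k :: l) X O J ∧ G.IsPath (f 0).1 (f k).1 (route f k) ∧
      ∀ Q ∈ l, G.EdgeDisjoint (route f k) Q := by
  obtain ⟨I, hR, hG⟩ := h.exists_reserved
  have hdis : ∀ Q ∈ l, G.EdgeDisjoint (route f k) Q := by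
    intro Q hQ e he g hg hs
    obtain ⟨i, hi, rfl⟩ := mem_steps.1 he
    rw [length_route] at hi
    refine (hf i (by omega)).unused ⟨Q, hQ, g, hg, ?_⟩
    simpa using hs.symm
  have hnd := nodup_route hinj
  refine ⟨⟨List.pairwise_cons.2 ⟨hdis, h.disjoint⟩, ?_, ?_, ?_, ?_, I, hR, ?_⟩, ?_, hdis⟩
  · exact List.forall_mem_cons.2 ⟨hnd, h.nodup⟩
  · refine List.forall_mem_cons.2 ⟨?_, h.length⟩
    rw [length_steps, length_route]
    omega
  · intro v
    rw [← Multiset.cons_coe, endpointCount, Multiset.countP_cons, ← endpointCount]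
    split_ifs with hv
    · rw [head?_route, getLast?_route, Option.some_inj, Option.some_inj] at hv
      rcases hv with rfl | rfl <;> omega
    · exact h.ends v
  · intro v hv
    obtain ⟨g1, g2⟩ := hX v hv
    refine ⟨?_, g2⟩
    have e1 := outCount_uses_le (G := G) hnd v
    have e2 := inCount_uses_le (G := G) hnd v
    have e3 : arcCount (UsedBy G (route f k :: l)) Finset.univ v ≤
        arcCount (UsedBy G l) Finset.univ v + (outCount (Uses G (route f k)) Finset.univ v +
          inCount (Uses G (route f k)) Finset.univ v) := by
      have e4 := outCount_or_le (UsedBy G l) (Uses G (route f k)) Finset.univ v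
      have e5 := inCount_or_le (UsedBy G l) (Uses G (route f k)) Finset.univ v
      have e6 := arcCount_imp (R := UsedBy G (route f k :: l))
        (R' := fun u w => UsedBy G l u w ∨ Uses G (route f k) u w) Finset.univ v
        fun u w => usedBy_cons.1
      unfold arcCount at *
      omega
    omega
  · refine List.forall_mem_cons.2 ⟨?_, hG⟩
    have key : ∀ v, v ∈ X → (∃ i ≤ k, (f i).1 = v) → Pays G (route f k) (I v) v := by
      rintro _ hv ⟨i, hi, rfl⟩
      exact pays_route hR hf hi hv
    have hmem : ∀ u v, Uses G (route f k) u v → (∃ i ≤ k, (f i).1 = u) ∧ ∃ i ≤ k, (f i).1 = v := by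
      intro u v huv
      obtain ⟨i, hi, ⟨rfl, rfl⟩ | ⟨-, rfl, rfl⟩⟩ := uses_route_iff.1 huv
      · exact ⟨⟨i, by omega, rfl⟩, i + 1, by omega, rfl⟩
      · exact ⟨⟨i + 1, by omega, rfl⟩, i, by omega, rfl⟩
    rintro v w (⟨hO, hu⟩ | ⟨hJ, hu⟩)
    · exact key v (hR.out_imp v w hO).2 (hmem v w hu).1
    · exact key v (hR.in_imp w v hJ).2 (hmem w v hu).2
  · refine ⟨head?_route f k, getLast?_route f k, hnd, ?_⟩
    rw [List.isChain_iff_getElem]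
    intro i hi
    rw [length_route] at hi
    rw [getElem_route, getElem_route]
    exact (hf i (by omega)).adj hR

theorem Good.of_cons {G : Network n} {d L : ℕ} {l : List (List (Fin n))} {P : List (Fin n)}
    {X : Finset (Fin n)} {O J : Fin n → Fin n → Prop} (h : Good G d L (P :: l) X O J) :
    Good G d L l X O J := by
  obtain ⟨I, hR, hG⟩ := h.exists_reserved
  refine ⟨(List.pairwise_cons.1 h.disjoint).2, fun Q hQ => h.nodup Q (List.mem_cons_of_mem _ hQ),
    fun Q hQ => h.length Q (List.mem_cons_of_mem _ hQ), fun v => ?_, fun v hv => ?_, I, hR,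
    fun Q hQ => hG Q (List.mem_cons_of_mem _ hQ)⟩
  · refine le_trans (Nat.mul_le_mul_left _ ?_) (h.ends v)
    rw [← Multiset.cons_coe, endpointCount, endpointCount, Multiset.countP_cons]
    exact Nat.le_add_right _ _
  · obtain ⟨h1, h2⟩ := h.cold v hv
    exact ⟨(Nat.mul_le_mul_left _ (arcCount_imp _ _ fun u w h => usedBy_cons.2 (Or.inl h))).trans h1,
      h2⟩

theorem Good.perm {G : Network n} {d L : ℕ} {l l' : List (List (Fin n))} {X : Finset (Fin n)}
    {O J : Fin n → Fin n → Prop} (h : Good G d L l X O J) (hl : l.Perm l') :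
    Good G d L l' X O J := by
  obtain ⟨I, hR, hG⟩ := h.exists_reserved
  have hU : UsedBy G l' = UsedBy G l := by
    funext u v
    refine propext ?_
    unfold UsedBy
    simp only [hl.mem_iff]
  refine ⟨(hl.pairwise_iff fun h => EdgeDisjoint.symm h).1 h.disjoint,
    fun Q hQ => h.nodup Q (hl.mem_iff.2 hQ), fun Q hQ => h.length Q (hl.mem_iff.2 hQ), ?_, ?_, I, hR,
    fun Q hQ => hG Q (hl.mem_iff.2 hQ)⟩
  · rw [← Multiset.coe_eq_coe.2 hl]
    exact h.ends
  · rw [hU]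
    exact h.cold

theorem good_nil (G : Network n) (d L : ℕ) : Good G d L [] ∅ (fun _ _ => False) fun _ _ => False := by
  refine ⟨List.Pairwise.nil, by simp, by simp, by simp [endpointCount], fun v _ => ?_,
    fun _ => ∅, ⟨by simp, by simp, by simp, by simp, by simp, by simp, by simp⟩, by simp [Guarded]⟩
  classical
  simp [arcCount, outCount, inCount, UsedBy]

end NewPath

/-! ### Regular expanders as expanding relations -/

section Networks

variable {n : ℕ}

theorem outCount_univ_eq_ncard (R : Fin n → Fin n → Prop) (v : Fin n) :
    outCount R Finset.univ v = {w | R v w}.ncard := by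
  classical
  rw [outCount, ← Set.ncard_coe_finset]
  congr 1
  ext w
  simp

theorem inCount_univ_eq_ncard (R : Fin n → Fin n → Prop) (v : Fin n) :
    inCount R Finset.univ v = {w | R w v}.ncard :=
  outCount_univ_eq_ncard (fun u w => R w u) v

open Classical in
theorem innerCount_eq_card (R : Fin n → Fin n → Prop) (S : Finset (Fin n)) :
    innerCount R S = ((S ×ˢ S).filter fun e => R e.1 e.2).card := by
  unfold innerCount outCount
  simp only [Finset.card_filter]
  rw [Finset.sum_product]

theorem innerCount_directed (D : Digraph (Fin n)) (h : ∀ v, ¬ D.Adj v v) (S : Finset (Fin n)) :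
    innerCount D.Adj S = (Network.directed D h).edgesInside S := by
  classical
  rw [innerCount_eq_card, Network.edgesInside, ← Set.ncard_coe_finset]
  congr 1
  ext e
  simp only [Finset.coe_filter, Finset.mem_product, Set.mem_ofPred_eq]
  tauto

/-- Each edge inside `S` is traversed in at most two directions. -/
theorem innerCount_undirected (H : SimpleGraph (Fin n)) (S : Finset (Fin n)) :
    innerCount H.Adj S ≤ 2 * (Network.undirected H).edgesInside S := by
  classical
  rw [innerCount_eq_card]
  refine (Finset.card_le_mul_card_image (f := fun e : Fin n × Fin n => s(e.1, e.2)) _ 2 ?_).trans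
    (Nat.mul_le_mul_left _ ?_)
  · rintro ⟨p, q⟩ -
    refine (Finset.card_le_card (t := {(p, q), (q, p)}) ?_).trans Finset.card_le_two
    rintro ⟨x, y⟩ he
    rw [Finset.mem_filter] at he
    rcases Sym2.eq_iff.1 he.2 with ⟨h1, h2⟩ | ⟨h1, h2⟩
    · simp [show x = p from h1, show y = q from h2]
    · simp [show x = q from h1, show y = p from h2]
  · rw [Network.edgesInside, ← Set.ncard_coe_finset]
    refine Set.ncard_le_ncard ?_ (Set.toFinite _)
    intro e he
    rw [Finset.mem_coe, Finset.mem_image] at he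
    obtain ⟨⟨x, y⟩, hxy, rfl⟩ := he
    rw [Finset.mem_filter, Finset.mem_product] at hxy
    refine ⟨hxy.2, fun v hv => ?_⟩
    rcases Sym2.mem_iff.1 hv with rfl | rfl
    · exact hxy.1.1
    · exact hxy.1.2

theorem Network.innerCount_le {G : Network n} {d : ℕ} {c : ℝ} (S : Finset (Fin n))
    (h : (G.edgesInside S : ℝ) ≤ c * G.underlyingDegree d * S.card) :
    (innerCount G.Adj S : ℝ) ≤ 2 * c * d * S.card := by
  cases G with
  | undirected H =>
    have h1 : (innerCount H.Adj S : ℝ) ≤ 2 * ((Network.undirected H).edgesInside S : ℝ) := by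
      exact_mod_cast innerCount_undirected H S
    simp only [Network.underlyingDegree] at h
    change (innerCount H.Adj S : ℝ) ≤ _
    linarith
  | directed D hD =>
    have h1 : (innerCount D.Adj S : ℝ) = ((Network.directed D hD).edgesInside S : ℝ) := by
      exact_mod_cast innerCount_directed D hD S
    simp only [Network.underlyingDegree] at h
    push_cast at h
    change (innerCount D.Adj S : ℝ) ≤ _
    linarith

/-- A small set spans at most `2 * d / 1000` arcs per vertex, as an undirected edge gives two arcs
and the degree of the multigraph that underlies a directed graph is `2 * d`. -/
theorem Network.expanding {G : Network n} {d m : ℕ} {β γ : ℝ} (hreg : G.IsRegular d)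
    (hexp : G.IsExpander d β γ) (hγ : γ < 1 / 1000) (hm : (m : ℝ) ≤ β * n) (hm2 : 2 * m ≤ n) :
    Expanding G.Adj d m := by
  have hhalf : ∀ S : Finset (Fin n), 2 * S.card ≤ n → (S.card : ℝ) ≤ n / 2 := by
    intro S hS
    have : (2 * S.card : ℝ) ≤ n := by exact_mod_cast hS
    linarith
  have hsparse : ∀ S : Finset (Fin n), (S.card : ℝ) ≤ n / 2 → (S.card : ℝ) ≤ β * n →
      (innerCount G.Adj S : ℝ) ≤ 2 * (1 / 1000) * d * S.card := by
    intro S h1 h2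
    refine G.innerCount_le S (((hexp S h1).1 h2).trans ?_)
    gcongr
  constructor
  · intro v
    rw [outCount_univ_eq_ncard]
    cases G with
    | undirected H => exact hreg v
    | directed D hD => exact (hreg v).1
  · intro v
    rw [inCount_univ_eq_ncard]
    cases G with
    | undirected H =>
      refine Eq.trans ?_ (hreg v)
      congr 1
      ext w
      exact H.adj_comm w v
    | directed D hD => exact (hreg v).2
  · intro S hS
    have h1 := hsparse S (hhalf S (by omega))
      (le_trans (by exact_mod_cast hS) hm)
    have : (500 * innerCount G.Adj S : ℝ) ≤ d * S.card := by linarith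
    exact_mod_cast this
  · intro S hS
    have h0 : (0 : ℝ) ≤ d * S.card := by positivity
    have h1 : (innerCount G.Adj S : ℝ) ≤ 2 * (1 / 3) * d * S.card := by
      rcases le_or_gt (S.card : ℝ) (β * n) with h | h
      · have := hsparse S (hhalf S hS) h
        linarith
      · refine G.innerCount_le S (((hexp S (hhalf S hS)).2 h).trans (le_of_eq ?_))
        ring
    have : (3 * innerCount G.Adj S : ℝ) ≤ 2 * d * S.card := by linarith
    exact_mod_cast this

end Networks

/-! ### The program -/

section Router

variable {n : ℕ}

/-- Answer a request for a path: find the congested vertices (array `8`), let them make their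
reservations (arrays `5`, `6`), and search. -/
def findPath : Prog :=
  .seq buildMatrix (.seq computeClosure (.seq prepare (.seq (peelStep.sweep 16 10 0)
    (.seq copySet (.seq search traceback)))))

/-- The program for Router. Variable `3` tells the two kinds of requests apart. -/
def router : Prog := .cond (.var 3) unmarkPath findPath

/-- What the memory holds between two requests, when `l` lists the current paths. Array `3` is the
adjacency matrix (still empty before the first request for a path), array `4` the matrix of used
arcs, array `7` the set of congested vertices, and arrays `5` and `6` the arcs reserved by their
tails and by their heads. -/
structure Ready (G : Network n) {d : ℕ} (N : Fin n → Fin d → Fin n) (L : ℕ)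
    (l : List (List (Fin n))) (s : Store) : Prop where
  var0 : s.var 0 = n
  var1 : s.var 1 = d
  var2 : s.var 2 = G.flag
  arr0 : ∀ (v : Fin n) (i : Fin d), s.arr 0 (v * d + i) = N v i
  mat3 : ∀ u v, matOf n (s.arr 3) u v → G.Adj u v
  mat4 : matOf n (s.arr 4) = UsedBy G l
  good : Good G d L l (setOf n (s.arr 7)) (matOf n (s.arr 5)) (matOf n (s.arr 6))

/-- The variables that describe the network and the request are unchanged. -/
def Keeps (s s' : Store) : Prop :=
  s'.var 0 = s.var 0 ∧ s'.var 1 = s.var 1 ∧ s'.var 2 = s.var 2 ∧ s'.var 4 = s.var 4 ∧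
    s'.var 5 = s.var 5

theorem Keeps.trans {s s' s'' : Store} (h : Keeps s s') (h' : Keeps s' s'') : Keeps s s'' := by
  unfold Keeps at *
  omega

theorem Same.keeps {p : Prog} {s s' : Store} (h : Same p s s') (h0 : ¬ p.ModVar 0)
    (h1 : ¬ p.ModVar 1) (h2 : ¬ p.ModVar 2) (h4 : ¬ p.ModVar 4) (h5 : ¬ p.ModVar 5) : Keeps s s' :=
  ⟨h.1 0 h0, h.1 1 h1, h.1 2 h2, h.1 4 h4, h.1 5 h5⟩

theorem findPath_runs {W d m L : ℕ} {s : Store} {G : Network n} {N : Fin n → Fin d → Fin n}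
    {l : List (List (Fin n))} (hW : 1000 * (n * n + 1) ≤ W) (hd : 200 < d) (hdn : d < n)
    (hE : Expanding G.Adj d m) (hN : IsAdjacencyList G N) (h : Ready G N L l s) (a b : Fin n)
    (h4 : s.var 4 = (a : ℕ)) (h5 : s.var 5 = (b : ℕ)) (hL : 10 * (Nat.log 2 n + 1) ≤ L)
    (hLn : L ≤ n) (ha : 200 * endpointCount (l : Multiset (List (Fin n))) a ≤ d)
    (hb : 200 * endpointCount (l : Multiset (List (Fin n))) b ≤ d)
    (hC : ∃ C, IsClosedUnder G.Adj (UsedBy G l) d C ∧ C.card ≤ m) :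
    Runs W findPath s (10000 * (n + 3) ^ 3) (fun s' => ∃ P, Answers s' P ∧ G.IsPath a b P ∧
      (∀ Q ∈ l, G.EdgeDisjoint P Q) ∧ Ready G N L (P :: l) s') := by
  obtain ⟨C, hC, hCm⟩ := hC
  have hmain : Runs W findPath s (100 * (n + 1) ^ 2 + (1000 * (n + 3) ^ 3 + (1000 * (n + 3) ^ 3 +
      (1000 * (n + 3) ^ 3 + (20 * (n + 1) + (1000 * (n + 3) ^ 3 + 200 * (n + 1)))))))
      (fun s' => ∃ P, Answers s' P ∧ G.IsPath a b P ∧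
      (∀ Q ∈ l, G.EdgeDisjoint P Q) ∧ Ready G N L (P :: l) s') := by
    refine Runs.seq (buildMatrix_runs hW h.var0 h.var1 hdn G.Adj N (fun v w => (hN v).2 w) h.arr0
      h.mat3) ?_
    intro s₁ m3 hS₁
    have k₁ : Keeps s s₁ := by
      refine hS₁.keeps ?_ ?_ ?_ ?_ ?_ <;> simp [buildMatrix, Prog.forUp, Prog.ModVar]
    have f₁ : ∀ A, A ≠ 3 → s₁.arr A = s.arr A := fun A hA =>
      hS₁.2 A (by simpa [buildMatrix, Prog.forUp, Prog.ModArr] using hA)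
    have m4 : matOf n (s₁.arr 4) = UsedBy G l := by rw [f₁ 4 (by decide), h.mat4]
    refine Runs.seq (computeClosure_runs hW (k₁.1.trans h.var0) (k₁.2.1.trans h.var1) C
      (by rw [m3, m4]; exact hC)) ?_
    rintro s₂ ⟨hYC, hY⟩ hS₂
    rw [m3, m4] at hY
    set Y := setOf n (s₂.arr 8) with hYdef
    have hYm : Y.card ≤ m := (Finset.card_le_card hYC).trans hCm
    have k₂ : Keeps s s₂ := by
      refine k₁.trans (hS₂.keeps ?_ ?_ ?_ ?_ ?_) <;> simp [computeClosure, closureStep, mark,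
        countArcs, setIdx, incr, Prog.sweep, Prog.forUp, Prog.ModVar]
    have f₂ : ∀ A, A ≠ 8 → s₂.arr A = s₁.arr A := fun A hA =>
      hS₂.2 A (by simpa [computeClosure, closureStep, mark,
        countArcs, setIdx, incr, Prog.sweep, Prog.forUp, Prog.ModArr] using hA)
    refine Runs.seq (prepare_runs hW (k₂.1.trans h.var0)) ?_
    intro s₃ hP hS₃
    have k₃ : Keeps s s₃ := by
      refine k₂.trans (hS₃.keeps ?_ ?_ ?_ ?_ ?_) <;> simp [prepare, setIdx, Prog.forUp, Prog.ModVar]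
    have f₃ : ∀ A, A ≠ 5 → A ≠ 6 → A ≠ 7 → A ≠ 9 → s₃.arr A = s₂.arr A := fun A g1 g2 g3 g4 =>
      hS₃.2 A (by simp [prepare, setIdx, Prog.forUp, Prog.ModArr, g1, g2, g3, g4])
    set X := setOf n (s.arr 7) with hXdef
    set O := matOf n (s.arr 5) with hOdef
    set J := matOf n (s.arr 6) with hJdef
    have a7 : s₂.arr 7 = s.arr 7 := by rw [f₂ 7 (by decide), f₁ 7 (by decide)]
    have a5 : s₂.arr 5 = s.arr 5 := by rw [f₂ 5 (by decide), f₁ 5 (by decide)]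
    have a6 : s₂.arr 6 = s.arr 6 := by rw [f₂ 6 (by decide), f₁ 6 (by decide)]
    have b3 : matOf n (s₃.arr 3) = G.Adj := by
      rw [f₃ 3 (by decide) (by decide) (by decide) (by decide), f₂ 3 (by decide), m3]
    have b4 : matOf n (s₃.arr 4) = UsedBy G l := by
      rw [f₃ 4 (by decide) (by decide) (by decide) (by decide), f₂ 4 (by decide), m4]
    have b7 : setOf n (s₃.arr 7) = X ∩ Y := by
      ext v
      rw [hP.set7, a7, Finset.mem_inter]
      simp [X, Y]
    have b9 : setOf n (s₃.arr 9) = Y \ X := by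
      ext v
      rw [hP.set9 v v.2, a7, Finset.mem_sdiff]
    obtain ⟨I, hR, hG⟩ := h.good.exists_reserved
    have hpeel : Peeling G l G.Adj d (X ∩ Y) Y (setOf n (s₃.arr 9)) (matOf n (s₃.arr 5))
        (matOf n (s₃.arr 6)) I := by
      rw [b9]
      refine hR.peeling hG (fun u v => ?_) fun u v => ?_
      · rw [hP.mat5, a5]
        simp [Y]
      · rw [hP.mat6, a6]
        simp [Y]
    refine Runs.seq (peel_runs hW (k₃.1.trans h.var0) (k₃.2.1.trans h.var1) (fun Z O J =>
      Z ⊆ Y \ X ∧ ∃ I, Peeling G l G.Adj d (X ∩ Y) Y Z O J I) ?_ ⟨b9.le, I, hpeel⟩) ?_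
    · rintro Z O J v ⟨hZ, I, hI⟩ hv hZv
      rw [b3] at hZv
      rw [b3, b4, b7]
      have hvX := (Finset.mem_sdiff.1 (hZ hv)).2
      obtain ⟨c1, c2⟩ := h.good.cold v hvX
      refine ⟨(Finset.erase_subset _ _).trans hZ, _, hI.step hd.le hv (hE.out_eq v) (hE.in_eq v)
        ((Nat.mul_le_mul_left _ (arcCount_mono _ Finset.inter_subset_left v)).trans c2) c1 hZv⟩
    rintro s₄ ⟨⟨-, I', hpeel'⟩, hZ⟩ hS₄
    rw [b3] at hZ
    have hZe := hE.eq_empty ((Finset.card_le_card hpeel'.subset).trans hYm) hZ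
    rw [hZe] at hpeel'
    have hR' := hpeel'.reserved
    have hG' := hpeel'.guarded
    rw [Finset.sdiff_empty] at hR'
    have k₄ : Keeps s s₄ := by
      refine k₃.trans (hS₄.keeps ?_ ?_ ?_ ?_ ?_) <;> simp [peelStep, reserve,
        countArcs, setIdx, incr, Prog.sweep, Prog.forUp, Prog.ModVar]
    have f₄ : ∀ A, A ≠ 5 → A ≠ 6 → A ≠ 9 → s₄.arr A = s₃.arr A := fun A g1 g2 g3 =>
      hS₄.2 A (by simp [peelStep, reserve, countArcs, setIdx, incr, Prog.sweep, Prog.forUp,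
        Prog.ModArr, g1, g2, g3])
    refine Runs.seq (copySet_runs hW (k₄.1.trans h.var0)) ?_
    intro s₅ c7 hS₅
    have k₅ : Keeps s s₅ := by
      refine k₄.trans (hS₅.keeps ?_ ?_ ?_ ?_ ?_) <;> simp [copySet, Prog.forUp, Prog.ModVar]
    have f₅ : ∀ A, A ≠ 7 → s₅.arr A = s₄.arr A := fun A g1 =>
      hS₅.2 A (by simpa [copySet, Prog.forUp, Prog.ModArr] using g1)
    have c3 : matOf n (s₅.arr 3) = G.Adj := by
      rw [f₅ 3 (by decide), f₄ 3 (by decide) (by decide) (by decide), b3]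
    have c4 : matOf n (s₅.arr 4) = UsedBy G l := by
      rw [f₅ 4 (by decide), f₄ 4 (by decide) (by decide) (by decide), b4]
    have c7' : setOf n (s₅.arr 7) = Y := by
      rw [c7, f₄ 8 (by decide) (by decide) (by decide),
        f₃ 8 (by decide) (by decide) (by decide) (by decide)]
    rw [← f₅ 5 (by decide), ← f₅ 6 (by decide)] at hR' hG'
    have hgood : Good G d L l Y (matOf n (s₅.arr 5)) (matOf n (s₅.arr 6)) :=
      ⟨h.good.disjoint, h.good.nodup, h.good.length, h.good.ends,
        fun v hv => ⟨(hY v hv).1.trans (Nat.le_add_right _ _), (hY v hv).2⟩, I', hR', hG'⟩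
    obtain ⟨L', hL', hreach⟩ := hE.exists_reaches hR' hG' hd.le hY h.good.disjoint h.good.nodup
      h.good.ends a b
    have hT : storeTrans n s₅.arr = Trans (forwardArc G.Adj (UsedBy G l) (matOf n (s₅.arr 5)) Y)
        (backwardArc (UsedBy G l) (matOf n (s₅.arr 6))) := by
      rw [storeTrans, c3, c4, c7']
    refine Runs.seq (search_runs hW (k₅.1.trans h.var0) a b (k₅.2.2.2.1.trans h4)
      (k₅.2.2.2.2.trans h5) (L := L') (by omega) (by rw [hT]; exact hreach)) ?_
    rintro s₆ ⟨k, hk, hI, hne⟩ hS₆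
    rw [hT] at hI
    have k₆ : Keeps s s₆ := by
      refine k₅.trans (hS₆.keeps ?_ ?_ ?_ ?_ ?_) <;> simp [search, initSearch, relax, tryStep,
        setIdx, incr, Prog.forUp, Prog.ModVar]
    have f₆ : ∀ A, A ≠ 10 → A ≠ 11 → s₆.arr A = s₅.arr A := fun A g1 g2 =>
      hS₆.2 A (by simp [search, initSearch, relax, tryStep, setIdx, incr, Prog.forUp, Prog.ModArr,
        g1, g2])
    obtain ⟨t, ht⟩ := Nat.exists_eq_succ_of_ne_zero hne
    have htk := hI.le (a, false)
    obtain ⟨f, f0, f1, f2, f3⟩ := hI.exists_path ht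
    have hfb : (f t).1 = b := by
      rw [← hI.one, f2 t le_rfl]
      omega
    refine (traceback_runs hW (k₆.1.trans h.var0) (k₆.2.2.1.trans h.var2) f
      (by rw [k₆.2.2.2.1, h4, f0]; simp [stateIdx]) (by rw [f0]) (l := t) (by omega)
      (fun i hi => (f1 i hi).2) f2).same.mono le_rfl ?_
    rintro s₇ ⟨⟨v6, r2, r4⟩, hS₇⟩
    have k₇ : Keeps s s₇ := by
      refine k₆.trans (hS₇.keeps ?_ ?_ ?_ ?_ ?_) <;> simp [traceback, markEdge, setIdx, incr,
        Prog.ModVar]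
    have f₇ : ∀ A, A ≠ 2 → A ≠ 4 → s₇.arr A = s₆.arr A := fun A g1 g2 =>
      hS₇.2 A (by simp [traceback, markEdge, setIdx, incr, Prog.ModArr, g1, g2])
    obtain ⟨hg, hpath, hdis⟩ := hgood.cons_route hY (f := f) (k := t) (by omega)
      (fun i hi => (f1 i hi).1) f3 (by rw [f0]; exact ha) (by rw [hfb]; exact hb)
    rw [f0, hfb] at hpath
    have fin : ∀ A, A ≠ 2 → A ≠ 4 → A ≠ 10 → A ≠ 11 → s₇.arr A = s₅.arr A := fun A g1 g2 g3 g4 => by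
      rw [f₇ A g1 g2, f₆ A g3 g4]
    refine ⟨route f t, ⟨?_, ?_⟩, hpath, hdis, k₇.1.trans h.var0, k₇.2.1.trans h.var1,
      k₇.2.2.1.trans h.var2, ?_, ?_, ?_, ?_⟩
    · rw [v6, length_route]
    · intro i hi
      rw [length_route] at hi
      rw [r2 i (by omega), getElem_route]
    · intro v i
      rw [fin 0 (by decide) (by decide) (by decide) (by decide), f₅ 0 (by decide),
        f₄ 0 (by decide) (by decide) (by decide),
        f₃ 0 (by decide) (by decide) (by decide) (by decide), f₂ 0 (by decide), f₁ 0 (by decide),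
        h.arr0]
    · intro u v huv
      rw [fin 3 (by decide) (by decide) (by decide) (by decide), c3] at huv
      exact huv
    · funext u v
      refine propext ?_
      rw [r4, f₆ 4 (by decide) (by decide), c4, usedBy_cons, uses_route_iff]
    · rw [fin 7 (by decide) (by decide) (by decide) (by decide), c7',
        fin 5 (by decide) (by decide) (by decide) (by decide),
        fin 6 (by decide) (by decide) (by decide) (by decide)]
      exact hg
  refine hmain.mono ?_ fun _ => id
  nlinarith [Nat.zero_le (n ^ 2), Nat.zero_le (n ^ 3)]

/-- As the paths are edge-disjoint, the edges of a removed path are not used by the others. -/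
theorem unmarkPath_ready {W d L : ℕ} {s : Store} {G : Network n} {N : Fin n → Fin d → Fin n}
    {l : List (List (Fin n))} {P : List (Fin n)} (hW : 1000 * (n * n + 1) ≤ W)
    (h : Ready G N L (P :: l) s) (h4 : s.var 4 = P.length)
    (h1 : ∀ (k : ℕ) (h : k < P.length), s.arr 1 k = P[k]) :
    Runs W unmarkPath s (200 * (n + 1)) (Ready G N L l) := by
  have hP : P.length ≤ n := by
    simpa using (h.good.nodup P List.mem_cons_self).length_le_card
  refine (unmarkPath_runs hW h.var0 h.var2 P hP h4 h1).same.mono le_rfl ?_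
  rintro s' ⟨hU, hS⟩
  have f : ∀ A, A ≠ 4 → s'.arr A = s.arr A := fun A g1 =>
    hS.2 A (by simpa [unmarkPath, markEdge, setIdx, incr, Prog.ModArr] using g1)
  have k : Keeps s s' := by
    refine hS.keeps ?_ ?_ ?_ ?_ ?_ <;> simp [unmarkPath, markEdge, setIdx, incr, Prog.ModVar]
  refine ⟨k.1.trans h.var0, k.2.1.trans h.var1, k.2.2.1.trans h.var2, ?_, ?_, ?_, ?_⟩
  · rw [f 0 (by decide)]
    exact h.arr0
  · rw [f 3 (by decide)]
    exact h.mat3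
  · funext u v
    refine propext ?_
    rw [hU, h.mat4, usedBy_cons, ← uses_iff]
    have hdis := (List.pairwise_cons.1 h.good.disjoint).1
    constructor
    · rintro ⟨h1 | h1, h2⟩
      · exact h1
      · exact absurd h1 h2
    · rintro ⟨Q, hQ, hu⟩
      exact ⟨Or.inl ⟨Q, hQ, hu⟩, fun hc => not_uses_of_edgeDisjoint (hdis Q hQ) hc hu⟩
  · rw [f 7 (by decide), f 5 (by decide), f 6 (by decide)]
    exact h.good.of_cons

end Router

/-! ### Winning the game -/

section Game

variable {n : ℕ}

theorem Ready.congr {d L : ℕ} {G : Network n} {N : Fin n → Fin d → Fin n}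
    {l : List (List (Fin n))} {s s' : Store} (h : Ready G N L l s)
    (hv : ∀ x < 3, s'.var x = s.var x) (ha : ∀ A, A ≠ 1 → s'.arr A = s.arr A) :
    Ready G N L l s' := by
  refine ⟨(hv 0 (by decide)).trans h.var0, (hv 1 (by decide)).trans h.var1,
    (hv 2 (by decide)).trans h.var2, ?_, ?_, ?_, ?_⟩
  · rw [ha 0 (by decide)]
    exact h.arr0
  · rw [ha 3 (by decide)]
    exact h.mat3
  · rw [ha 4 (by decide)]
    exact h.mat4
  · rw [ha 7 (by decide), ha 5 (by decide), ha 6 (by decide)]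
    exact h.good

theorem Ready.perm {d L : ℕ} {G : Network n} {N : Fin n → Fin d → Fin n}
    {l l' : List (List (Fin n))} {s : Store} (h : Ready G N L l s) (hl : l.Perm l') :
    Ready G N L l' s := by
  refine ⟨h.var0, h.var1, h.var2, h.arr0, h.mat3, ?_, h.good.perm hl⟩
  rw [h.mat4]
  funext u v
  refine propext ?_
  unfold UsedBy
  simp only [hl.mem_iff]

theorem Ready.loadFind {d L : ℕ} {G : Network n} {N : Fin n → Fin d → Fin n}
    {l : List (List (Fin n))} {s : Store} (h : Ready G N L l s) (a b : Fin n) :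
    Ready G N L l (loadFind s a b) := by
  refine h.congr (fun x hx => ?_) fun _ _ => rfl
  simp [Routing.loadFind, show x ≠ 3 by omega, show x ≠ 4 by omega, show x ≠ 5 by omega]

theorem Ready.loadRemove {d L : ℕ} {G : Network n} {N : Fin n → Fin d → Fin n}
    {l : List (List (Fin n))} {s : Store} (h : Ready G N L l s) (P : List (Fin n)) :
    Ready G N L l (loadRemove s P) := by
  refine h.congr (fun x hx => ?_) fun A hA => ?_
  · simp [Routing.loadRemove, show x ≠ 3 by omega, show x ≠ 4 by omega]
  · funext k
    simp [Routing.loadRemove, hA]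

theorem ready_initialStore {d L : ℕ} {G : Network n} {N : Fin n → Fin d → Fin n} :
    Ready G N L [] (initialStore G N) := by
  refine ⟨by simp [initialStore], by simp [initialStore], by simp [initialStore], ?_, ?_, ?_, ?_⟩
  · intro v i
    have hlt : (v : ℕ) * d + i < n * d := by
      have h1 := v.2
      have h2 := i.2
      calc (v : ℕ) * d + i < v * d + d := by omega
        _ = (v + 1) * d := by ring
        _ ≤ n * d := Nat.mul_le_mul_right _ h1
    have h1 : Fin.divNat (⟨v * d + i, hlt⟩ : Fin (n * d)) = v := by
      refine Fin.ext ?_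
      change ((v : ℕ) * d + i) / d = v
      rw [mul_comm, Nat.mul_add_div (by have := i.2; omega), Nat.div_eq_of_lt i.2, add_zero]
    have h2 : Fin.modNat (⟨v * d + i, hlt⟩ : Fin (n * d)) = i := by
      refine Fin.ext ?_
      change ((v : ℕ) * d + i) % d = i
      rw [mul_comm, Nat.mul_add_mod, Nat.mod_eq_of_lt i.2]
    simp only [initialStore, if_true]
    rw [dif_pos hlt, h1, h2]
  · simp [matOf, initialStore]
  · funext u v
    simp [matOf, initialStore, UsedBy]
  · have h1 : setOf n ((initialStore G N).arr 7) = ∅ := by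
      ext v
      simp [initialStore]
    have h2 : ∀ A, A ≠ 0 → matOf n ((initialStore G N).arr A) = fun _ _ => False := by
      intro A hA
      funext u v
      simp [matOf, initialStore, hA]
    rw [h1, h2 5 (by decide), h2 6 (by decide)]
    exact good_nil G d L

theorem Answers.unique {s : Store} {P Q : List (Fin n)} (hP : Answers s P) (hQ : Answers s Q) :
    P = Q := by
  refine List.ext_getElem (hP.1.symm.trans hQ.1) fun i h1 h2 => ?_
  exact Fin.ext ((hP.2 i h1).symm.trans (hQ.2 i h2))

/-- Few short paths use few arcs, so there is a small closed set. -/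
theorem exists_isClosedUnder_of_length_le {G : Network n} {d m h L : ℕ} {l : List (List (Fin n))}
    (hE : Expanding G.Adj d m) (hd : 0 < d) (hL : ∀ P ∈ l, (Network.steps P).length ≤ L)
    (hl : 200 * (l.length * L) ≤ d * h) (hm : 2 * h + 1 ≤ m) :
    ∃ C, IsClosedUnder G.Adj (UsedBy G l) d C ∧ C.card ≤ m := by
  refine hE.exists_isClosedUnder hd ?_ hm
  have := sum_arcCount_usedBy_le G l L hL
  omega

theorem router_wins {W d m h L : ℕ} {r : ℝ} {G : Network n} {N : Fin n → Fin d → Fin n}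
    (hW : 1000 * (n * n + 1) ≤ W) (hd : 200 < d) (hdn : d < n)
    (hE : Expanding G.Adj d m) (hN : IsAdjacencyList G N) (hL : 10 * (Nat.log 2 n + 1) ≤ L)
    (hLn : L ≤ n) (hr : ∀ c : ℕ, (c : ℝ) < r → 200 * (c * L) ≤ d * h) (hm : 2 * h + 1 ≤ m) :
    Wins G d r router W (initialStore G N) (20000 * (n + 3) ^ 3) L := by
  have hfind : ∀ (s : Store) (l : List (List (Fin n))) (a b : Fin n), Ready G N L l s →
      MayFind d r (l : Multiset (List (Fin n))) a b →
      Runs W router (loadFind s a b) (20000 * (n + 3) ^ 3) (fun s' => ∃ P, Answers s' P ∧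
        G.IsPath a b P ∧ (∀ Q ∈ l, G.EdgeDisjoint P Q) ∧ Ready G N L (P :: l) s') := by
    rintro s l a b hs ⟨ha, hb, hc⟩
    have hend : ∀ v : Fin n, (endpointCount (l : Multiset (List (Fin n))) v : ℝ) < d / 200 →
        200 * endpointCount (l : Multiset (List (Fin n))) v ≤ d := by
      intro v hv
      have h1 : (200 * endpointCount (l : Multiset (List (Fin n))) v : ℝ) ≤ d := by linarith
      exact_mod_cast h1
    refine (Runs.cond (T := 10000 * (n + 3) ^ 3) (fun h => absurd ?_ h) fun _ => ?_).mono
      ?_ fun _ => id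
    · simp [Term.eval, loadFind]
    · refine findPath_runs hW hd hdn hE hN (hs.loadFind a b) a b (by simp [loadFind])
        (by simp [loadFind]) hL hLn (hend a ha) (hend b hb)
        (exists_isClosedUnder_of_length_le hE (by omega) hs.good.length (hr _ ?_) hm)
      simpa using hc
    · have := Nat.pow_le_pow_left (show 3 ≤ n + 3 by omega) 3
      simp only [Term.cost]
      omega
  have hremove : ∀ (s : Store) (l : List (List (Fin n))) (P : List (Fin n)),
      Ready G N L (P :: l) s →
      Runs W router (loadRemove s P) (20000 * (n + 3) ^ 3) (Ready G N L l) := by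
    intro s l P hs
    refine (Runs.cond (T := 10000 * (n + 3) ^ 3) (fun _ => ?_) (fun h => ?_)).mono
      ?_ fun _ => id
    · refine (unmarkPath_ready hW (hs.loadRemove P) ?_ ?_).mono ?_ fun _ => id
      · simp [loadRemove]
      · intro k hk
        simp [loadRemove, hk]
      · have : n + 1 ≤ (n + 3) ^ 3 := by nlinarith [Nat.zero_le (n ^ 2), Nat.zero_le (n ^ 3)]
        omega
    · simp [Term.eval, loadRemove] at h
    · have := Nat.pow_le_pow_left (show 3 ≤ n + 3 by omega) 3
      simp only [Term.cost]
      omega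
  have hperm : ∀ (l : List (List (Fin n))) (P : List (Fin n)),
      P ∈ (l : Multiset (List (Fin n))) →
      ∃ l', l.Perm (P :: l') ∧ (l : Multiset (List (Fin n))).erase P = l' := by
    intro l P hP
    classical
    refine ⟨l.erase P, List.perm_cons_erase hP, ?_⟩
    rw [Multiset.coe_erase]
    congr!
  -- the program is deterministic, so the memories that Adversary can reach are those computed above
  have hinv : ∀ s F, Reachable d r router W (initialStore G N) s F →
      ∃ l : List (List (Fin n)), (l : Multiset (List (Fin n))) = F ∧ Ready G N L l s := by
    intro s F h
    induction h with
    | start => exact ⟨[], rfl, ready_initialStore⟩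
    | @find s s' F a b t P _ hmay hexec hans ih =>
      obtain ⟨l, rfl, hs⟩ := ih
      obtain ⟨t', s'', hexec', -, P', hans', -, -, hs''⟩ := hfind s l a b hs hmay
      obtain ⟨-, rfl⟩ := hexec.deterministic hexec'
      rw [hans.unique hans']
      exact ⟨P' :: l, rfl, hs''⟩
    | @remove s s' F t P _ hP hexec ih =>
      obtain ⟨l, rfl, hs⟩ := ih
      obtain ⟨l', hl, hl'⟩ := hperm l P hP
      obtain ⟨t', s'', hexec', -, hs''⟩ := hremove s l' P (hs.perm hl)
      obtain ⟨-, rfl⟩ := hexec.deterministic hexec'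
      exact ⟨l', hl'.symm, hs''⟩
  intro s F h
  obtain ⟨l, rfl, hs⟩ := hinv s F h
  constructor
  · intro a b hmay
    obtain ⟨t, s', hexec, ht, P, hans, hpath, hdis, hs'⟩ := hfind s l a b hs hmay
    exact ⟨t, s', P, hexec, ht, hans, hpath, hdis,
      by exact_mod_cast hs'.good.length P List.mem_cons_self⟩
  · intro P hP
    obtain ⟨l', hl, -⟩ := hperm l P hP
    obtain ⟨t, s', hexec, ht, -⟩ := hremove s l' P (hs.perm hl)
    exact ⟨t, s', hexec, ht⟩

theorem Wins.mono {G : Network n} {d W T T' : ℕ} {r ℓ ℓ' : ℝ} {p : Prog} {s₀ : Store}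
    (h : Wins G d r p W s₀ T ℓ) (hT : T ≤ T') (hℓ : ℓ ≤ ℓ') : Wins G d r p W s₀ T' ℓ' := by
  intro s F hs
  refine ⟨fun a b hmay => ?_, fun P hP => ?_⟩
  · obtain ⟨t, s', P, h1, h2, h3, h4, h5, h6⟩ := (h s F hs).1 a b hmay
    exact ⟨t, s', P, h1, h2.trans hT, h3, h4, h5, h6.trans hℓ⟩
  · obtain ⟨t, s', h1, h2⟩ := (h s F hs).2 P hP
    exact ⟨t, s', h1, h2.trans hT⟩

theorem ten_mul_log_le {n : ℕ} (hn : 128 ≤ n) : 10 * (Nat.log 2 n + 1) ≤ n := by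
  have h1 : 7 ≤ Nat.log 2 n := Nat.le_log_of_pow_le (by norm_num) (by norm_num; exact hn)
  have h2 : 2 ^ Nat.log 2 n ≤ n := Nat.pow_log_le_self 2 (by omega)
  refine le_trans ?_ h2
  generalize Nat.log 2 n = k at h1
  induction k, h1 using Nat.le_induction with
  | base => norm_num
  | succ k hk ih =>
    rw [pow_succ]
    omega

theorem ten_mul_log_le_log {n : ℕ} (hn : 3 ≤ n) :
    1 ≤ Real.log n ∧ ((10 * (Nat.log 2 n + 1) : ℕ) : ℝ) ≤ 30 * Real.log n := by
  have h3 : (3 : ℝ) ≤ n := by exact_mod_cast hn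
  have h1 : 1 ≤ Real.log n := by
    rw [Real.le_log_iff_exp_le (by linarith)]
    exact (Real.exp_one_lt_d9.le.trans (by norm_num)).trans h3
  have h2 : (Nat.log 2 n : ℝ) ≤ Real.logb 2 n := Real.natLog_le_logb n 2
  have h4 : Real.logb 2 n ≤ 2 * Real.log n := by
    rw [Real.logb, div_le_iff₀ (Real.log_pos (by norm_num))]
    have := Real.log_two_gt_d9
    nlinarith
  refine ⟨h1, ?_⟩
  push_cast
  linarith

end Game

end Routing

theorem theorem1 :
    ∃ C K : ℕ, ∀ β γ : ℝ, 0 < β → 0 < γ → γ < 1 / 1000 →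
      ∃ (ε : ℝ) (n₀ : ℕ) (p : Routing.Prog), 0 < ε ∧
        ∀ n : ℕ, n₀ ≤ n → ∀ d : ℕ, 200 < d → d < n →
          ∀ G : Routing.Network n, G.IsRegular d → G.IsExpander d β γ →
            ∀ N : Fin n → Fin d → Fin n, Routing.IsAdjacencyList G N →
              Routing.Wins G d (ε * n * d / Real.log n) p (n ^ K) (Routing.initialStore G N)
                (C * n ^ 3 * d ^ 3) (C * Real.log n) := by
  -- paths have at most `10 * (Nat.log 2 n + 1) ≤ 30 * log n` edges, so fewer than `r` paths give a
  -- sum of `arcCount` of at most `120 * r * log n = 120 * ε * n * d`; with `ε = δ / 100000` there is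
  -- a closed set of at most `δ * n` vertices
  refine ⟨160000, 4, fun β γ hβ _ hγ => ?_⟩
  obtain ⟨δ, hδ0, hδβ, hδ⟩ : ∃ δ : ℝ, 0 < δ ∧ δ ≤ β ∧ δ ≤ 1 / 2 :=
    ⟨min β (1 / 2), by positivity, min_le_left _ _, min_le_right _ _⟩
  refine ⟨δ / 100000, max 128 ⌈5 / δ⌉₊, Routing.router, by positivity, ?_⟩
  intro n hn d hd hdn G hreg hexp N hN
  have hn1 : 128 ≤ n := (le_max_left _ _).trans hn
  have hn2 : 5 ≤ δ * n := by
    have h1 : 5 / δ ≤ n := (Nat.le_ceil _).trans (by exact_mod_cast (le_max_right _ _).trans hn)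
    rw [div_le_iff₀ hδ0] at h1
    linarith
  have hnpos : (0 : ℝ) ≤ n := Nat.cast_nonneg n
  obtain ⟨hlog, hL⟩ := Routing.ten_mul_log_le_log (n := n) (by omega)
  have hm : (⌊δ * n⌋₊ : ℝ) ≤ δ * n := Nat.floor_le (by positivity)
  have hm' : δ * n < ⌊δ * n⌋₊ + 1 := Nat.lt_floor_add_one _
  have hh : δ * n * (6 / 100) ≤ ⌈δ * n * (6 / 100)⌉₊ := Nat.le_ceil _
  have hh' : (⌈δ * n * (6 / 100)⌉₊ : ℝ) < δ * n * (6 / 100) + 1 := Nat.ceil_lt_add_one (by positivity)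
  have hE : Routing.Expanding G.Adj d ⌊δ * n⌋₊ := by
    refine Routing.Network.expanding hreg hexp hγ (hm.trans (by gcongr)) ?_
    have : (2 * ⌊δ * n⌋₊ : ℝ) ≤ n := by nlinarith
    exact_mod_cast this
  refine Routing.Wins.mono (Routing.router_wins (h := ⌈δ * n * (6 / 100)⌉₊) ?_ hd hdn hE hN le_rfl
    (Routing.ten_mul_log_le hn1) ?_ ?_) ?_ ?_
  · nlinarith [Nat.pow_le_pow_left hn1 2, Nat.zero_le (n ^ 2)]
  · intro c hc
    rw [lt_div_iff₀ (by linarith)] at hc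
    have h1 : (200 * (c * (10 * (Nat.log 2 n + 1) : ℕ)) : ℝ) ≤ d * ⌈δ * n * (6 / 100)⌉₊ := by
      calc (200 * (c * (10 * (Nat.log 2 n + 1) : ℕ)) : ℝ) ≤ 200 * (c * (30 * Real.log n)) := by
            gcongr
        _ = 6000 * (c * Real.log n) := by ring
        _ ≤ 6000 * (δ / 100000 * n * d) := by linarith
        _ = d * (δ * n * (6 / 100)) := by ring
        _ ≤ d * ⌈δ * n * (6 / 100)⌉₊ := by gcongr
    exact_mod_cast h1
  · have : (2 * ⌈δ * n * (6 / 100)⌉₊ + 1 : ℝ) ≤ ⌊δ * n⌋₊ := by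
      by_contra hc
      linarith
    exact_mod_cast this
  · have h1 : (n + 3) ^ 3 ≤ (2 * n) ^ 3 := Nat.pow_le_pow_left (by omega) 3
    have h2 : 1 ≤ d ^ 3 := Nat.one_le_pow _ _ (by omega)
    calc 20000 * (n + 3) ^ 3 ≤ 20000 * (2 * n) ^ 3 := Nat.mul_le_mul_left _ h1
      _ = 160000 * n ^ 3 * 1 := by ring
      _ ≤ 160000 * n ^ 3 * d ^ 3 := Nat.mul_le_mul_left _ h2
  · refine hL.trans ?_
    push_cast
    linarith
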